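/- Rings are unital, not necessarily commutative; homomorphisms preserve $1$; $U(R)$ is the group of units and $J(R)$ the Jacobson radical of $R$; a homomorphism $\phi:R\to R'$ is local if $\phi^{-1}(U(R'))=U(R)$. For a subset $S$ of a ring $A$, $A_S=\langle A,\{x_s\}_{s\in S}\mid x_ss=sx_s=1\rangle$. **Affine F-schemes.** A homomorphism $\phi:A\to B$ with $B\neq 0$ defines a sequence $\mathcal S=(S_1,S_2,\dots)$ by $A_0=A$, $\phi_0=\phi$, $S_{n+1}=\phi_n^{-1}(U(B))\subset A_n$, $A_{n+1}=(A_n)_{S_{n+1}}$, $\phi_{n+1}:A_{n+1}\to B$ the induced homomorphism. Such sequences are the *fully invertible systems* on $A$; they form the set $F(A)$, and $A_{\mathcal S}=\varinjlim_n A_n$. A *fraction* of $A$ is a tuple $\mathbf a=(a_1,\dots,a_n)$ with $a_1\in A$, $a_2\in A_{a_1}$, $a_3\in (A_{a_1})_{a_2}$, etc.; $D(\mathbf a)\subset F(A)$ is the set of $\mathcal S$ such that all $a_i$ become invertible in $A_{\mathcal S}$. Give $F(A)$ the topology generated by the sets $D(\mathbf a)$. The sheaf $\mathcal O_A$ has as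 sections over an open set $U$ the functions $t$ on $U$ with $t(\mathcal S)\in A_{\mathcal S}$ which locally, on small open sets $V$, are given by one noncommutative polynomial expression with integer coefficients in elements of $A$ and inverses $x_s$, where each $s$ is in turn such an expression, invertible in $A_{\mathcal S}$ for all $\mathcal S\in V$. **F-schemes.** An *F-scheme* is a ringed space (with sheaf of possibly noncommutative rings) which is locally isomorphic to ringed spaces of the form $(F(A),\mathcal O_A)$. A *morphism* of F-schemes is a morphism of ringed spaces all of whose stalk maps $\mathcal O_{Y,f(x)}\to\mathcal O_{X,x}$ are local. **Quasi-coherent ideals.** A sheaf $\mathcal I$ of two-sided ideals of $\mathcal O_X$ is *quasi-coherent* if $X$ has an open covering by affine pieces $U_i\cong F(A_i)$ and there are two-sided ideals $I_i\subset A_i$ such that $\mathcal I|_{U_i}$ corresponds to the sheaf of ideals of $\mathcal O_{A_i}$ generated by $I_i$, that is, the sheaf of those sections $t$ for which $t(\mathcal S)$ lies in the two-sided ideal of $(A_i)_{\mathcal S}$ generated by the image of $I_i$ for all $\mathcal S$. Put $Z(\mathcal I)=\{x\in X\mid \mathcal I_x\subset J(\mathcal O_{X,x})\}$, a ringed space with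 structure sheaf the restriction of $\mathcal O_X/\mathcal I$ to $Z(\mathcal I)$. A subset of $X$ is *semi-closed* if it equals $Z(\mathcal I)$ for some quasi-coherent sheaf $\mathcal I$ of two-sided ideals. A morphism $f:X\to Y$ is a *closed immersion* if there are a quasi-coherent sheaf $\mathcal I$ of two-sided ideals on $Y$ and an isomorphism of ringed spaces $X\cong(Z(\mathcal I),\mathcal O_Y/\mathcal I)$ identifying $f$ with the inclusion morphism $(Z(\mathcal I),\mathcal O_Y/\mathcal I)\to Y$. **Proposition.** 1. A morphism $f:X\to Y$ of F-schemes is a closed immersion if and only if $f$ induces a homeomorphism from $X$ onto a semi-closed subset of $Y$ and the homomorphism of sheaves $\mathcal O_Y\to f_*\mathcal O_X$ is surjective. 2. Let $f:X\to Y$ be a morphism of F-schemes and $\{U_i\}$ an open covering of $Y$. Then $f$ is a closed immersion if and only if $f^{-1}(U_i)\to U_i$ is a closed immersion for each $i$. 3. If $f:X\to Y$ and $g:Y\to Z$ are morphisms of F-schemes which are closed immersions, then $g\circ f$ is a closed immersion. -/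

import Mathlib

open CategoryTheory TopologicalSpace Opposite AlgebraicGeometry

universe u

namespace FSch

noncomputable section

/-- Ringed spaces, with sheaves of not necessarily commutative rings. -/
abbrev NCRingedSpace : Type (u + 1) := SheafedSpace.{u + 1, u, u} RingCat.{u}

/-! ### Universal localization of a noncommutative ring -/

/-- Defining relations of the ring `⟨A, (x_s)_{s ∈ S} | x_s s = s x_s = 1⟩`. The generator
`Sum.inl a` stands for `a` and `Sum.inr s` stands for `x_s`. -/
inductive LocRel (A : Type u) [Ring A] (S : Set A) :
    FreeAlgebra ℤ (A ⊕ S) → FreeAlgebra ℤ (A ⊕ S) → Prop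
  | one : LocRel A S (FreeAlgebra.ι ℤ (Sum.inl 1)) 1
  | add (a b : A) : LocRel A S (FreeAlgebra.ι ℤ (Sum.inl (a + b)))
      (FreeAlgebra.ι ℤ (Sum.inl a) + FreeAlgebra.ι ℤ (Sum.inl b))
  | mul (a b : A) : LocRel A S (FreeAlgebra.ι ℤ (Sum.inl (a * b)))
      (FreeAlgebra.ι ℤ (Sum.inl a) * FreeAlgebra.ι ℤ (Sum.inl b))
  | left_inv (s : S) : LocRel A S
      (FreeAlgebra.ι ℤ (Sum.inr s) * FreeAlgebra.ι ℤ (Sum.inl (s : A))) 1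
  | right_inv (s : S) : LocRel A S
      (FreeAlgebra.ι ℤ (Sum.inl (s : A)) * FreeAlgebra.ι ℤ (Sum.inr s)) 1

/-- The localization `A_S` of a ring `A` at an arbitrary subset `S`. -/
def Loc (A : Type u) [Ring A] (S : Set A) : Type u := RingQuot (LocRel A S)

instance (A : Type u) [Ring A] (S : Set A) : Ring (Loc A S) :=
  inferInstanceAs (Ring (RingQuot (LocRel A S)))

namespace Loc

variable {A : Type u} [Ring A] (S : Set A)

/-- The canonical homomorphism `i_S : A → A_S`. -/
def of : A →+* Loc A S :=
  RingHom.mk' 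
    { toFun := fun a => RingQuot.mkRingHom (LocRel A S) (FreeAlgebra.ι ℤ (Sum.inl a))
      map_one' := (RingQuot.mkRingHom_rel LocRel.one).trans (map_one _)
      map_mul' := fun a b => (RingQuot.mkRingHom_rel (LocRel.mul a b)).trans (map_mul _ _ _) }
    (fun a b => (RingQuot.mkRingHom_rel (LocRel.add a b)).trans (map_add _ _ _))

/-- The generator `x_s` of `A_S`. -/
def inv (s : S) : Loc A S :=
  RingQuot.mkRingHom (LocRel A S) (FreeAlgebra.ι ℤ (Sum.inr s))

theorem inv_mul (s : S) : inv S s * of S (s : A) = 1 :=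
  (map_mul (RingQuot.mkRingHom (LocRel A S)) _ _).symm.trans
    ((RingQuot.mkRingHom_rel (LocRel.left_inv s)).trans (map_one _))

theorem mul_inv (s : S) : of S (s : A) * inv S s = 1 :=
  (map_mul (RingQuot.mkRingHom (LocRel A S)) _ _).symm.trans
    ((RingQuot.mkRingHom_rel (LocRel.right_inv s)).trans (map_one _))

variable {B : Type u} [Ring B] (φ : A →+* B) (h : ∀ s ∈ S, IsUnit (φ s))

/-- The homomorphism `φ_S : A_S → B` induced by `φ : A → B` with `φ(S) ⊆ U(B)`. -/
def lift : Loc A S →+* B :=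
  RingQuot.lift ⟨(FreeAlgebra.lift ℤ
      (Sum.elim φ (fun s : S => (((h s.1 s.2).unit⁻¹ : Bˣ) : B))) :
        FreeAlgebra ℤ (A ⊕ S) →ₐ[ℤ] B).toRingHom, by
    intro x y hxy
    cases hxy <;> simp⟩

theorem lift_of (a : A) : lift S φ h (of S a) = φ a := by
  refine (RingQuot.lift_mkRingHom_apply _ _ _).trans ?_
  simp

theorem hom_ext {f g : Loc A S →+* B} (hfg : ∀ a, f (of S a) = g (of S a)) : f = g := by
  refine RingQuot.ringQuot_ext _ _ ?_
  suffices H : ((f.comp (RingQuot.mkRingHom (LocRel A S))).toIntAlgHom) =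
      ((g.comp (RingQuot.mkRingHom (LocRel A S))).toIntAlgHom) from
    RingHom.ext fun x => DFunLike.congr_fun H x
  refine FreeAlgebra.hom_ext (funext fun x => ?_)
  rcases x with a | s
  · exact hfg a
  · have e1 : g (of S (s : A)) * f (inv S s) = 1 := by
      rw [← hfg, ← map_mul, mul_inv, map_one]
    have e2 : g (inv S s) * g (of S (s : A)) = 1 := by rw [← map_mul, inv_mul, map_one]
    exact (left_inv_eq_right_inv e2 e1).symm

end Loc

/-! ### Fully invertible systems and the full spectrum -/

/-- A type of indices together with a ring for each index. -/
structure RingFamily where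
  Idx : Type u
  ring : Idx → RingCat.{u}

/-- `(stages A n).Idx` is the type of sequences `(S_1, …, S_n)` where `S_1` is a subset of `A_0 = A`
and `S_{k+1}` is a subset of `A_k`, with `A_{k+1} = (A_k)_{S_{k+1}}`; the ring attached to such a
sequence is `A_n`. -/
def stages (A : Type u) [Ring A] : ℕ → RingFamily.{u}
  | 0 => ⟨PUnit, fun _ => RingCat.of A⟩
  | n + 1 => ⟨Σ p : (stages A n).Idx, Set ((stages A n).ring p),
      fun q => RingCat.of (Loc ((stages A n).ring q.1) q.2)⟩

/-- An infinite sequence `(S_1, S_2, …)` as above, given by its compatible truncations. -/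
@[ext]
structure LocSeq (A : Type u) [Ring A] where
  trunc : ∀ n : ℕ, (stages A n).Idx
  coherent : ∀ n : ℕ, Sigma.fst (trunc (n + 1)) = trunc n

section OfHom

variable {A : Type u} [Ring A] {B : Type u} [Ring B] (φ : A →+* B)

/-- The first `n` steps of the successive localizations defined by `φ : A → B`, with the induced
homomorphism `φ_n : A_n → B`. The next set is `S_{n+1} = φ_n⁻¹(U(B))`. -/
def ofHomAux : ∀ n : ℕ, Σ p : (stages A n).Idx, ((stages A n).ring p →+* B)
  | 0 => ⟨PUnit.unit, φ⟩
  | n + 1 => ⟨⟨(ofHomAux n).1, {a | IsUnit ((ofHomAux n).2 a)}⟩,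
      Loc.lift _ (ofHomAux n).2 (fun _ hs => hs)⟩

/-- The sequence `(S_1, S_2, …)` coming from `φ : A → B`. -/
def LocSeq.ofHom : LocSeq A where
  trunc n := (ofHomAux φ n).1
  coherent _ := rfl

end OfHom

/-- The full spectrum `F(A)`: the set of all fully invertible systems on `A`, i.e. of all sequences
coming from a homomorphism from `A` to a nonzero ring. -/
def FullSpectrum (A : Type u) [Ring A] : Type u :=
  {s : LocSeq A // ∃ (B : Type u) (_ : Ring B) (_ : Nontrivial B) (φ : A →+* B),
    s = LocSeq.ofHom φ}

/-- The canonical map from a stage to the next one. -/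
def stageMap {A : Type u} [Ring A] {n : ℕ} (p : (stages A n).Idx) (q : (stages A (n + 1)).Idx)
    (h : Sigma.fst q = p) : (stages A n).ring p ⟶ (stages A (n + 1)).ring q :=
  eqToHom (congrArg _ h.symm) ≫
    RingCat.ofHom (Loc.of (A := (stages A n).ring (Sigma.fst q)) (Sigma.snd q))

namespace FullSpectrum

variable {A : Type u} [Ring A]

/-- The tower `A = A_{𝒮,0} → A_{𝒮,1} → A_{𝒮,2} → ⋯`. -/
def tower (s : FullSpectrum A) : ℕ ⥤ RingCat.{u} :=
  Functor.ofSequence (X := fun n => (stages A n).ring (s.1.trunc n))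
    (fun n => stageMap (s.1.trunc n) (s.1.trunc (n + 1)) (s.1.coherent n))

/-- The transition maps of the tower, as ring homomorphisms. -/
def towerMap (s : FullSpectrum A) (i j : ℕ) (h : i ≤ j) : s.tower.obj i →+* s.tower.obj j :=
  (s.tower.map (homOfLE h)).hom

instance (s : FullSpectrum A) :
    DirectedSystem (fun n => s.tower.obj n) (fun i j h => s.towerMap i j h) where
  map_self i x := by
    have h : s.tower.map (homOfLE (le_refl i)) = 𝟙 _ := s.tower.map_id i
    change (s.tower.map (homOfLE (le_refl i))).hom x = x
    rw [h]; rfl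
  map_map k j i hij hjk x := by
    have h : s.tower.map (homOfLE (hij.trans hjk)) =
      s.tower.map (homOfLE hij) ≫ s.tower.map (homOfLE hjk) := s.tower.map_comp _ _
    change (s.tower.map (homOfLE hjk)).hom ((s.tower.map (homOfLE hij)).hom x) =
      (s.tower.map (homOfLE (hij.trans hjk))).hom x
    rw [h]; rfl

/-- The localization `A_𝒮 = colim_n A_{𝒮,n}` of `A` at a fully invertible system `𝒮`. -/
def LocAt (s : FullSpectrum A) : Type u :=
  DirectLimit (fun n => s.tower.obj n) (fun i j h => s.towerMap i j h)

instance (s : FullSpectrum A) : Ring s.LocAt :=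
  inferInstanceAs (Ring (DirectLimit (fun n => s.tower.obj n) (fun i j h => s.towerMap i j h)))

/-- The canonical homomorphism `A_{𝒮,n} → A_𝒮`. -/
def ofStage (s : FullSpectrum A) (n : ℕ) : (stages A n).ring (s.1.trunc n) →+* s.LocAt :=
  RingHom.mk'
    { toFun := fun a => (⟦⟨n, a⟩⟧ :
        DirectLimit (fun n => s.tower.obj n) (fun i j h => s.towerMap i j h))
      map_one' := (DirectLimit.one_def (f := fun i j h => s.towerMap i j h) n).symm
      map_mul' := fun a b =>
        (DirectLimit.mul_def (f := fun i j h => s.towerMap i j h) n a b).symm }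
    (fun a b => (DirectLimit.add_def (f := fun i j h => s.towerMap i j h) n a b).symm)

/-- The canonical homomorphism `i_𝒮 : A → A_𝒮`. -/
def of (s : FullSpectrum A) : A →+* s.LocAt := s.ofStage 0

end FullSpectrum

/-! ### Fractions and the topology of the full spectrum -/

/-- Fractions `(a_1, …, a_n)` of `A`: `a_1 ∈ A` and `(a_2, …, a_n)` is a fraction of `A_{a_1}`. -/
def Fraction : ∀ (_ : ℕ) (A : Type u) [Ring A], Type u
  | 0, _, _ => PUnit
  | n + 1, A, _ => Σ a : A, Fraction n (Loc A {a})

/-- For `φ : A → B` and a fraction `(a_1, …, a_n)` of `A`: all `a_i` become invertible in `B`, where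
`a_i` is successively mapped to `B` by the homomorphisms induced by `φ`. -/
def Fraction.Invertible : ∀ {n : ℕ} {A : Type u} [Ring A] {B : Type u} [Ring B]
    (_ : A →+* B) (_ : Fraction n A), Prop
  | 0, _, _, _, _, _, _ => True
  | n + 1, A, _, B, _, φ, a => ∃ h : IsUnit (φ (Sigma.fst a)),
      Fraction.Invertible (n := n) (A := Loc A {Sigma.fst a}) (B := B)
        (Loc.lift {Sigma.fst a} φ (fun s hs => by rw [Set.mem_singleton_iff.1 hs]; exact h))
        (Sigma.snd a)

/-- The fundamental subset `D(𝐚) = {𝒮 | 𝐚 ∈ 𝒮}` of `F(A)`; `𝐚 ∈ 𝒮` means that every `a_i` is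
invertible in `A_𝒮`. -/
def FullSpectrum.D {A : Type u} [Ring A] {n : ℕ} (a : Fraction n A) : Set (FullSpectrum A) :=
  {s | a.Invertible s.of}

instance (A : Type u) [Ring A] : TopologicalSpace (FullSpectrum A) :=
  TopologicalSpace.generateFrom {U | ∃ (n : ℕ) (a : Fraction n A), U = FullSpectrum.D a}

/-! ### Sheaves of rings of locally given functions -/

/-- Rings of functions `x ↦ t(x) ∈ R x` on the open subsets of `X`, compatible with restriction. -/
structure PrelocalRing (X : TopCat.{u}) (R : X → Type u) [∀ x, Ring (R x)] where
  sub : ∀ U : Opens X, Subring (∀ x : U, R x)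
  res : ∀ {U V : Opens X} (h : V ≤ U) (t : ∀ x : U, R x), t ∈ sub U →
    (fun x : V => t ⟨x.1, h x.2⟩) ∈ sub V

namespace PrelocalRing

variable {X : TopCat.{u}} {R : X → Type u} [∀ x, Ring (R x)] (P : PrelocalRing X R)

/-- The predicate of belonging locally to `P`. -/
def localPred : TopCat.LocalPredicate R :=
  TopCat.PrelocalPredicate.sheafify
    { pred := fun {U} t => t ∈ P.sub U
      res := fun i t ht => P.res i.le t ht }

/-- The ring of functions on `U` which locally belong to `P`. -/
def sections (U : Opens X) : Subring (∀ x : U, R x) where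
  carrier := {t | P.localPred.pred t}
  zero_mem' x := ⟨U, x.2, 𝟙 _, (P.sub U).zero_mem⟩
  one_mem' x := ⟨U, x.2, 𝟙 _, (P.sub U).one_mem⟩
  neg_mem' {s} hs x := by
    obtain ⟨V, m, i, h⟩ := hs x
    exact ⟨V, m, i, (P.sub V).neg_mem h⟩
  add_mem' {s t} hs ht x := by
    obtain ⟨V, m, i, h⟩ := hs x
    obtain ⟨V', m', i', h'⟩ := ht x
    exact ⟨V ⊓ V', ⟨m, m'⟩, Opens.infLELeft _ _ ≫ i,
      (P.sub _).add_mem (P.res inf_le_left _ h) (P.res inf_le_right _ h')⟩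
  mul_mem' {s t} hs ht x := by
    obtain ⟨V, m, i, h⟩ := hs x
    obtain ⟨V', m', i', h'⟩ := ht x
    exact ⟨V ⊓ V', ⟨m, m'⟩, Opens.infLELeft _ _ ≫ i,
      (P.sub _).mul_mem (P.res inf_le_left _ h) (P.res inf_le_right _ h')⟩

/-- The presheaf of rings `U ↦ P.sections U`, with the restriction of functions. -/
def presheaf : TopCat.Presheaf RingCat.{u} X where
  obj U := RingCat.of (P.sections U.unop)
  map i := RingCat.ofHom
    { toFun := fun t => ⟨fun x => t.1 ⟨x.1, i.unop.le x.2⟩, P.localPred.res i.unop t.1 t.2⟩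
      map_zero' := rfl
      map_one' := rfl
      map_add' := fun _ _ => rfl
      map_mul' := fun _ _ => rfl }

theorem presheaf_isSheaf : P.presheaf.IsSheaf :=
  (TopCat.Presheaf.isSheaf_iff_isSheaf_comp (forget RingCat.{u}) P.presheaf).2
    (TopCat.Presheaf.isSheaf_of_iso
      (NatIso.ofComponents (fun _ => Iso.refl _) :
        (TopCat.subsheafToTypes P.localPred).1 ≅ P.presheaf ⋙ forget RingCat.{u})
      (TopCat.subsheafToTypes P.localPred).2)

/-- The ringed space with structure sheaf `P.presheaf`. -/
def space : NCRingedSpace.{u} where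
  carrier := X
  presheaf := P.presheaf
  IsSheaf := P.presheaf_isSheaf

end PrelocalRing

/-! ### Affine F-schemes -/

section Affine

variable (A : Type u) [Ring A]

/-- The functions `t` on `U ⊆ F(A)`, with `t(𝒮) ∈ A_𝒮`, given on all of `U` by one noncommutative
polynomial expression in elements of `A` and inverses `x_s`, where each `s` is in turn such an
expression which is invertible in `A_𝒮` for every `𝒮 ∈ U`. -/
inductive IsExpression (U : Set (FullSpectrum A)) :
    (∀ s : U, (s : FullSpectrum A).LocAt) → Prop
  | const (a : A) : IsExpression U (fun s => s.1.of a)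
  | neg (f) : IsExpression U f → IsExpression U (-f)
  | add (f g) : IsExpression U f → IsExpression U g → IsExpression U (f + g)
  | mul (f g) : IsExpression U f → IsExpression U g → IsExpression U (f * g)
  | inv (f g) : IsExpression U f → f * g = 1 → g * f = 1 → IsExpression U g

/-- Functions given by one expression, as a restriction-compatible family of rings. -/
def expressions : PrelocalRing (TopCat.of (FullSpectrum A)) (fun s => FullSpectrum.LocAt s) where
  sub U :=
    { carrier := {t | IsExpression A (U : Set (FullSpectrum A)) t}
      zero_mem' := by
        have h := IsExpression.const (A := A) (U := (U : Set (FullSpectrum A))) 0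
        simp only [map_zero] at h
        exact h
      one_mem' := by
        have h := IsExpression.const (A := A) (U := (U : Set (FullSpectrum A))) 1
        simp only [map_one] at h
        exact h
      neg_mem' := fun h => IsExpression.neg _ h
      add_mem' := fun h h' => IsExpression.add _ _ h h'
      mul_mem' := fun h h' => IsExpression.mul _ _ h h' }
  res {U V} hVU t ht := by
    change IsExpression A (V : Set (FullSpectrum A)) _
    replace ht : IsExpression A (U : Set (FullSpectrum A)) t := ht
    induction ht with
    | const a => exact IsExpression.const a
    | neg f _ ih => exact IsExpression.neg _ ih
    | add f g _ _ ih ih' => exact IsExpression.add _ _ ih ih'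
    | mul f g _ _ ih ih' => exact IsExpression.mul _ _ ih ih'
    | inv f g _ h h' ih =>
      exact IsExpression.inv _ _ ih
        (funext fun s => congrFun h ⟨s.1, hVU s.2⟩) (funext fun s => congrFun h' ⟨s.1, hVU s.2⟩)

/-- The ringed space `(F(A), 𝒪_A)`. -/
def affine : NCRingedSpace.{u} := (expressions A).space

end Affine

/-! ### F-schemes and their morphisms -/

/-- An F-scheme is a ringed space every point of which has an open neighbourhood isomorphic, as a
ringed space, to `F(A)` for some ring `A`. -/
def IsFScheme (X : NCRingedSpace.{u}) : Prop :=
  ∀ x : X, ∃ U : Opens X, x ∈ U ∧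
    ∃ (A : Type u) (_ : Ring A), Nonempty (X.restrict U.isOpenEmbedding ≅ affine A)

/-- Local morphisms of ringed spaces; these are the morphisms of F-schemes. -/
def IsLocalMorphism {X Y : NCRingedSpace.{u}} (f : X ⟶ Y) : Prop :=
  ∀ x : X, IsLocalHom (f.hom.stalkMap x).hom

/-! ### Quasi-coherent sheaves of ideals -/

/-- A sheaf of two-sided ideals of the structure sheaf of a ringed space. -/
structure IdealSheaf (X : NCRingedSpace.{u}) where
  ideal : ∀ U : Opens X, TwoSidedIdeal (X.presheaf.obj (op U))
  res_mem : ∀ {U V : Opens X} (h : V ≤ U) (s : X.presheaf.obj (op U)), s ∈ ideal U →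
    (X.presheaf.map (homOfLE h).op).hom s ∈ ideal V
  glue : ∀ (U : Opens X) (s : X.presheaf.obj (op U)),
    (∀ x ∈ U, ∃ (V : Opens X) (h : V ≤ U), x ∈ V ∧
      (X.presheaf.map (homOfLE h).op).hom s ∈ ideal V) → s ∈ ideal U

/-- The sections over `U ⊆ F(A)` of the sheaf of ideals of `𝒪_A` generated by a two-sided ideal `I`
of `A`: the sections `t` such that `t(𝒮)` lies in the ideal of `A_𝒮` generated by `I`, for all
`𝒮 ∈ U`. -/
def hatIdeal {A : Type u} [Ring A] (I : TwoSidedIdeal A)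
    (U : Opens (TopCat.of (FullSpectrum A))) : Set ((affine A).presheaf.obj (op U)) :=
  {t | ∀ (s : FullSpectrum A) (hs : s ∈ U),
    (show (expressions A).sections U from t).1 ⟨s, hs⟩ ∈
      TwoSidedIdeal.span (R := s.LocAt) (s.of '' (I : Set A))}

namespace IdealSheaf

variable {X : NCRingedSpace.{u}} (𝓘 : IdealSheaf X)

/-- Quasi-coherence: `X` is covered by open subspaces `j : F(A) ↪ X` on which `𝓘` corresponds to the
sheaf of ideals generated by some two-sided ideal `I` of `A`. -/
def QuasiCoherent : Prop :=
  ∀ x : X, ∃ (A : Type u) (_ : Ring A) (j : affine A ⟶ X),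
    SheafedSpace.IsOpenImmersion j ∧ x ∈ Set.range j.hom.base ∧
    ∃ I : TwoSidedIdeal A, ∀ W : Opens X, (W : Set X) ⊆ Set.range j.hom.base →
      ∀ t : X.presheaf.obj (op W), t ∈ 𝓘.ideal W ↔
        (j.hom.c.app (op W)).hom t ∈ hatIdeal I ((Opens.map j.hom.base).obj W)

/-- The stalk `𝓘_x`, as an ideal of `𝒪_{X,x}`. -/
def stalk (x : X) : TwoSidedIdeal (X.presheaf.stalk x) :=
  TwoSidedIdeal.span {g | ∃ (U : Opens X) (hx : x ∈ U), ∃ t ∈ 𝓘.ideal U,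
    g = (X.presheaf.germ U x hx).hom t}

/-- `Z(𝓘) = {x | 𝓘_x ⊆ J(𝒪_{X,x})}`. -/
def zeroLocus : Set X :=
  {x | (𝓘.stalk x : Set (X.presheaf.stalk x)) ⊆ Ring.jacobson (X.presheaf.stalk x)}

/-- The stalk `𝒪_{X,x} / 𝓘_x` of the quotient sheaf. -/
abbrev QuotStalk (x : X) : Type u := (𝓘.stalk x).ringCon.Quotient

/-- The class in `𝒪_{X,x} / 𝓘_x` of a section of `𝒪_X` around `x`. -/
def quotGerm (U : Opens X) (x : X) (hx : x ∈ U) : X.presheaf.obj (op U) →+* 𝓘.QuotStalk x :=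
  (RingCon.mk' (𝓘.stalk x).ringCon).comp (X.presheaf.germ U x hx).hom

theorem quotGerm_res {U V : Opens X} (h : V ≤ U) (x : X) (hx : x ∈ V)
    (s : X.presheaf.obj (op U)) :
    𝓘.quotGerm V x hx ((X.presheaf.map (homOfLE h).op).hom s) = 𝓘.quotGerm U x (h hx) s :=
  congrArg (RingCon.mk' (𝓘.stalk x).ringCon)
    (TopCat.Presheaf.germ_res_apply X.presheaf (homOfLE h) x hx s)

/-- The functions on open subsets `V` of `Z(𝓘)` of the form `z ↦ s_z mod 𝓘_z` for a section `s` of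
`𝒪_X` over an open set containing `V`. -/
def quotSections : PrelocalRing (TopCat.of 𝓘.zeroLocus) (fun z => 𝓘.QuotStalk z.1) where
  sub V :=
    { carrier := {t | ∃ (U : Opens X) (h : ∀ z : V, z.1.1 ∈ U) (s : X.presheaf.obj (op U)),
        ∀ z : V, t z = 𝓘.quotGerm U z.1.1 (h z) s}
      zero_mem' := ⟨⊤, fun _ => trivial, 0, fun _ => (map_zero _).symm⟩
      one_mem' := ⟨⊤, fun _ => trivial, 1, fun _ => (map_one _).symm⟩
      neg_mem' := by
        rintro t ⟨U, h, s, hs⟩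
        exact ⟨U, h, -s, fun z => by rw [map_neg, ← hs]; rfl⟩
      add_mem' := by
        rintro t t' ⟨U, h, s, hs⟩ ⟨U', h', s', hs'⟩
        refine ⟨U ⊓ U', fun z => ⟨h z, h' z⟩,
          (X.presheaf.map (homOfLE inf_le_left).op).hom s +
            (X.presheaf.map (homOfLE inf_le_right).op).hom s', fun z => ?_⟩
        exact (congrArg₂ (· + ·) ((hs z).trans (𝓘.quotGerm_res inf_le_left _ _ s).symm)
          ((hs' z).trans (𝓘.quotGerm_res inf_le_right _ _ s').symm)).trans (map_add _ _ _).symm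
      mul_mem' := by
        rintro t t' ⟨U, h, s, hs⟩ ⟨U', h', s', hs'⟩
        refine ⟨U ⊓ U', fun z => ⟨h z, h' z⟩,
          (X.presheaf.map (homOfLE inf_le_left).op).hom s *
            (X.presheaf.map (homOfLE inf_le_right).op).hom s', fun z => ?_⟩
        exact (congrArg₂ (· * ·) ((hs z).trans (𝓘.quotGerm_res inf_le_left _ _ s).symm)
          ((hs' z).trans (𝓘.quotGerm_res inf_le_right _ _ s').symm)).trans (map_mul _ _ _).symm }
  res := by
    rintro V W hWV t ⟨U, h, s, hs⟩
    exact ⟨U, fun z => h ⟨z.1, hWV z.2⟩, s, fun z => hs ⟨z.1, hWV z.2⟩⟩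

/-- The ringed space `(Z(𝓘), 𝒪_X/𝓘)`; its structure sheaf is the restriction to `Z(𝓘)` of the
quotient sheaf, realised by functions `z ↦ t(z) ∈ 𝒪_{X,z}/𝓘_z` which locally come from sections
of `𝒪_X`. -/
def closedSub : NCRingedSpace.{u} := 𝓘.quotSections.space

/-- The inclusion morphism `(Z(𝓘), 𝒪_X/𝓘) → X`. -/
def closedSubι : 𝓘.closedSub ⟶ X :=
  InducedCategory.homMk
    { base := TopCat.ofHom ⟨fun z : 𝓘.zeroLocus => z.1, continuous_subtype_val⟩
      c :=
        { app := fun U => RingCat.ofHom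
            { toFun := fun s => (⟨fun z => 𝓘.quotGerm U.unop z.1.1 z.2 s, fun z =>
                ⟨_, z.2, 𝟙 _, U.unop, fun z => z.2, s, fun _ => rfl⟩⟩ :
                  𝓘.quotSections.sections _)
              map_zero' := Subtype.ext (funext fun _ => map_zero _)
              map_one' := Subtype.ext (funext fun _ => map_one _)
              map_add' := fun _ _ => Subtype.ext (funext fun _ => map_add _ _ _)
              map_mul' := fun _ _ => Subtype.ext (funext fun _ => map_mul _ _ _) }
          naturality := fun U V i => by
            refine RingCat.hom_ext (RingHom.ext fun s => Subtype.ext (funext fun z => ?_))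
            exact 𝓘.quotGerm_res i.unop.le z.1.1 z.2 s } }

end IdealSheaf

/-! ### Semi-closed subsets and closed immersions -/

/-- A subset is semi-closed if it is `Z(𝓘)` for a quasi-coherent sheaf of two-sided ideals `𝓘`. -/
def IsSemiClosed {X : NCRingedSpace.{u}} (T : Set X) : Prop :=
  ∃ 𝓘 : IdealSheaf X, 𝓘.QuasiCoherent ∧ T = 𝓘.zeroLocus

/-- A morphism `f : X → Y` is a closed immersion if it is equivalent to an inclusion morphism
`(Z(𝓘), 𝒪_Y/𝓘) → Y` with `𝓘` a quasi-coherent sheaf of two-sided ideals on `Y`. -/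
def IsClosedImmersion {X Y : NCRingedSpace.{u}} (f : X ⟶ Y) : Prop :=
  ∃ 𝓘 : IdealSheaf Y, 𝓘.QuasiCoherent ∧
    ∃ e : X ≅ 𝓘.closedSub, f = e.hom ≫ 𝓘.closedSubι

/-- The open subspace of a ringed space on an open subset. -/
abbrev openSub (X : NCRingedSpace.{u}) (U : Opens X) : NCRingedSpace.{u} :=
  X.restrict U.isOpenEmbedding

/-- The restriction `f⁻¹(U) → U` of a morphism `f : X → Y` over an open subset `U` of `Y`: the unique
morphism compatible with `f` and the inclusions. -/
def restrictTarget {X Y : NCRingedSpace.{u}} (f : X ⟶ Y) (U : Opens Y) :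
    openSub X ((Opens.map f.hom.base).obj U) ⟶ openSub Y U :=
  InducedCategory.homMk
    (@PresheafedSpace.IsOpenImmersion.lift _ _ _ _ _ (Y.ofRestrict U.isOpenEmbedding).hom
      (PresheafedSpace.IsOpenImmersion.ofRestrict Y.toPresheafedSpace U.isOpenEmbedding)
      ((X.ofRestrict ((Opens.map f.hom.base).obj U).isOpenEmbedding).hom ≫ f.hom)
      (by
        rintro _ ⟨x, rfl⟩
        exact ⟨⟨f.hom.base x.1, x.2⟩, rfl⟩))

end

end FSch

/-! Everything rests on the smallness of affine F-schemes. A point of `F(A)` is a class of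
homomorphisms from `A` to nonzero rings, where `φ` and `χ ∘ φ` agree for local `χ` (`pt_eq_iff`),
and every neighbourhood of the point of `A → B` contains the points of all composites `A → B → C`
(`pt_comp_mem_of_isOpen`). For `A ≠ 0` the point of the identity therefore has only `F(A)` itself as
a neighbourhood. Consequently global sections of `𝒪_A` are elements of `A` (`exists_const_eq`), and
local morphisms `F(B) → F(A)` come from homomorphisms `A → B` (`exists_eq_comap`). In the same way a
nonempty `Z(I)` has a least point, namely that of `A → A/I`, all of whose neighbourhoods contain
`Z(I)` (`exists_least_of_locus`), and sections near it are constant modulo `I` on `Z(I)`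
(`exists_const_mod`).

A surjection `φ : A → B` induces an embedding `F(B) → F(A)` onto `Z(ker φ)`, and the sections of
`𝒪_A` that die on `F(B)` are exactly those of the ideal sheaf generated by `ker φ`
(`mem_hatIdeal_ker_iff`).

The three assertions then follow from one criterion, `isClosedImmersion_iff`: a morphism is a closed
immersion iff it is locally surjective on sheaves and each point of the target has arbitrarily small
affine neighbourhoods whose preimage is empty or affine (`AffineOver`). If the criterion holds,
`exists_surjective` describes the morphism over such neighbourhoods by ring surjections, so its
kernel is quasi-coherent and it identifies the source with the zero locus of the kernel. Conversely,
least points give `AffineOver` (`affineOver_of_isEmbedding`) and lifts of sections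
(`IsClosedImmersion.isLocallySurjective`). The criterion is visibly local on the target, and it is
stable under composition because an affine piece is the smallest neighbourhood of one of its points.
-/

namespace FSch
noncomputable section

/-! ### Local homomorphisms and the points of the full spectrum -/

namespace Loc

theorem isUnit_of {A : Type u} [Ring A] (S : Set A) {s : A} (hs : s ∈ S) : IsUnit (of S s) :=
  ⟨⟨of S s, inv S ⟨s, hs⟩, mul_inv S ⟨s, hs⟩, inv_mul S ⟨s, hs⟩⟩, rfl⟩

theorem lift_comp_of {A : Type u} [Ring A] (S : Set A) {B : Type u} [Ring B] (φ : A →+* B)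
    (h : ∀ s ∈ S, IsUnit (φ s)) : (lift S φ h).comp (of S) = φ :=
  RingHom.ext fun a => lift_of S φ h a

end Loc

section Points

variable {A : Type u} [Ring A] {B : Type u} [Ring B] {C : Type u} [Ring C]

/-- A local `χ` reflects units, so `φ` and `χ ∘ φ` invert the same elements at each stage. The
induction has to carry the induced homomorphism along, since it determines the next set. -/
theorem ofHomAux_comp (φ : A →+* B) (χ : B →+* C) [IsLocalHom χ] (n : ℕ) :
    ofHomAux (χ.comp φ) n = ⟨(ofHomAux φ n).1, χ.comp (ofHomAux φ n).2⟩ := by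
  induction n with
  | zero => rfl
  | succ n ih =>
    have key : ∀ (p : Σ p : (stages A n).Idx, ((stages A n).ring p →+* B)),
        (⟨⟨p.1, {a | IsUnit ((χ.comp p.2) a)}⟩, Loc.lift _ (χ.comp p.2) (fun _ hs => hs)⟩ :
          Σ q : (stages A (n + 1)).Idx, ((stages A (n + 1)).ring q →+* C)) =
        ⟨⟨p.1, {a | IsUnit (p.2 a)}⟩, χ.comp (Loc.lift _ p.2 (fun _ hs => hs))⟩ := by
      intro p
      have hS : {a | IsUnit ((χ.comp p.2) a)} = {a | IsUnit (p.2 a)} :=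
        Set.ext fun a => isUnit_map_iff χ (p.2 a)
      -- The ring at the next stage depends on the set, so the two sets are made variables before
      -- their equality is eliminated.
      have : ∀ (S T : Set ((stages A n).ring p.1)) (h : ∀ s ∈ S, IsUnit (χ.comp p.2 s))
          (h' : ∀ s ∈ T, IsUnit (p.2 s)), S = T →
          (⟨⟨p.1, S⟩, Loc.lift S (χ.comp p.2) h⟩ :
            Σ q : (stages A (n + 1)).Idx, ((stages A (n + 1)).ring q →+* C)) =
          ⟨⟨p.1, T⟩, χ.comp (Loc.lift T p.2 h')⟩ := by
        rintro S _ h h' rfl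
        congr 1
        exact Loc.hom_ext S fun a =>
          (Loc.lift_of S (χ.comp p.2) h a).trans (congrArg χ (Loc.lift_of S p.2 h' a).symm)
      exact this _ _ _ _ hS
    have e : ofHomAux (χ.comp φ) (n + 1) =
        (fun p : (Σ p : (stages A n).Idx, ((stages A n).ring p →+* C)) =>
          (⟨⟨p.1, {a | IsUnit (p.2 a)}⟩, Loc.lift _ p.2 (fun _ hs => hs)⟩ :
            Σ q : (stages A (n + 1)).Idx, ((stages A (n + 1)).ring q →+* C)))
          (ofHomAux (χ.comp φ) n) := rfl
    rw [e, ih]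
    exact key (ofHomAux φ n)

theorem LocSeq.ofHom_comp (φ : A →+* B) (χ : B →+* C) [IsLocalHom χ] :
    LocSeq.ofHom (χ.comp φ) = LocSeq.ofHom φ :=
  LocSeq.ext (funext fun n => congrArg Sigma.fst (ofHomAux_comp φ χ n))

/-- The point of `F(A)` defined by a homomorphism from `A` to a nonzero ring. -/
def pt [Nontrivial B] (φ : A →+* B) : FullSpectrum A :=
  ⟨LocSeq.ofHom φ, B, inferInstance, inferInstance, φ, rfl⟩

theorem pt_comp [Nontrivial B] [Nontrivial C] (φ : A →+* B) (χ : B →+* C) [IsLocalHom χ] :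
    pt (χ.comp φ) = pt φ :=
  Subtype.ext (LocSeq.ofHom_comp φ χ)

namespace FullSpectrum

theorem towerMap_succ (s : FullSpectrum A) (n : ℕ) :
    s.towerMap n (n + 1) n.le_succ =
      (stageMap (s.1.trunc n) (s.1.trunc (n + 1)) (s.1.coherent n)).hom :=
  congrArg RingCat.Hom.hom (Functor.ofSequence_map_homOfLE_succ _ n)

theorem ofStage_towerMap (s : FullSpectrum A) {i j : ℕ} (h : i ≤ j) (a : s.tower.obj i) :
    s.ofStage j (s.towerMap i j h a) = s.ofStage i a :=
  (Quotient.sound ⟨j, h, le_rfl, by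
    change s.towerMap i j h a = s.towerMap j j le_rfl (s.towerMap i j h a)
    exact (DirectedSystem.map_self (f := fun i j h => s.towerMap i j h) _).symm⟩ :
      (⟦⟨i, a⟩⟧ : DirectLimit (fun n => s.tower.obj n) (fun i j h => s.towerMap i j h)) =
        ⟦⟨j, s.towerMap i j h a⟩⟧).symm

theorem exists_ofStage (s : FullSpectrum A) (z : s.LocAt) : ∃ n a, s.ofStage n a = z := by
  induction z using Quotient.inductionOn with
  | h z => exact ⟨z.1, z.2, rfl⟩

/-- For a system given as `pt φ` the coherence proofs are `rfl`, so the transition map of the tower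
is `Loc.of` by definition; a general point has to be replaced by some `pt φ` first. -/
theorem ofStage_succ_of (φ : A →+* B) [Nontrivial B] (n : ℕ)
    (a : (stages A n).ring ((pt φ).1.trunc n)) :
    (pt φ).ofStage (n + 1) (Loc.of {a | IsUnit ((ofHomAux φ n).2 a)} a) = (pt φ).ofStage n a :=
  (congrArg ((pt φ).ofStage (n + 1)) (DFunLike.congr_fun (towerMap_succ (pt φ) n) a).symm).trans
    (ofStage_towerMap (pt φ) n.le_succ a)

theorem exists_ofStage₂ (s : FullSpectrum A) (x y : s.LocAt) :
    ∃ n a b, s.ofStage n a = x ∧ s.ofStage n b = y := by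
  obtain ⟨m, a, rfl⟩ := s.exists_ofStage x
  obtain ⟨n, b, rfl⟩ := s.exists_ofStage y
  exact ⟨max m n, s.towerMap _ _ (le_max_left m n) a, s.towerMap _ _ (le_max_right m n) b,
    ofStage_towerMap s _ a, ofStage_towerMap s _ b⟩

/-- `A → A_𝒮` is an epimorphism because each stage is obtained from the previous one by adjoining
inverses, and these are unique. -/
theorem hom_ext (s : FullSpectrum A) {f g : s.LocAt →+* C} (h : f.comp s.of = g.comp s.of) :
    f = g := by
  obtain ⟨_, B, _, _, φ, rfl⟩ := s
  refine RingHom.ext fun z => ?_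
  obtain ⟨n, a, rfl⟩ := exists_ofStage _ z
  suffices H : ∀ n, f.comp ((pt φ).ofStage n) = g.comp ((pt φ).ofStage n) from
    DFunLike.congr_fun (H n) a
  intro n
  induction n with
  | zero => exact h
  | succ n ih =>
    refine Loc.hom_ext {a | IsUnit ((ofHomAux φ n).2 a)} fun a => ?_
    exact (congrArg f (ofStage_succ_of φ n a)).trans
      ((DFunLike.congr_fun ih a).trans (congrArg g (ofStage_succ_of φ n a)).symm)

end FullSpectrum

theorem ofHomAux_towerMap [Nontrivial B] (φ : A →+* B) {i j : ℕ} (h : i ≤ j)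
    (a : (pt φ).tower.obj i) :
    (ofHomAux φ j).2 ((pt φ).towerMap i j h a) = (ofHomAux φ i).2 a := by
  induction j, h using Nat.le_induction with
  | base =>
    exact congrArg _ (DirectedSystem.map_self (f := fun i j h => (pt φ).towerMap i j h) _)
  | succ j h ih =>
    rw [← DirectedSystem.map_map (f := fun i j h => (pt φ).towerMap i j h) h j.le_succ, ← ih,
      FullSpectrum.towerMap_succ]
    exact Loc.lift_of {a | IsUnit ((ofHomAux φ j).2 a)} (ofHomAux φ j).2 (fun _ h => h) _

/-- The map underlying `ptLift`. -/
def ptLiftFun [Nontrivial B] (φ : A →+* B) : (pt φ).LocAt → B :=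
  DirectLimit.lift (fun i j h => (pt φ).towerMap i j h)
    (fun n a => (ofHomAux φ n).2 a) (fun _ _ h a => (ofHomAux_towerMap φ h a).symm)

/-- The local homomorphism `A_𝒮 → B` for the point `𝒮` defined by `A → B`. -/
def ptLift [Nontrivial B] (φ : A →+* B) : (pt φ).LocAt →+* B :=
  RingHom.mk'
    { toFun := ptLiftFun φ
      map_one' := (congrArg (ptLiftFun φ) (map_one ((pt φ).ofStage 0))).symm.trans
        (map_one (ofHomAux φ 0).2)
      map_mul' := fun x y => by
        obtain ⟨n, a, b, rfl, rfl⟩ := FullSpectrum.exists_ofStage₂ _ x y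
        exact (congrArg (ptLiftFun φ) (map_mul ((pt φ).ofStage n) a b)).symm.trans
          (map_mul (ofHomAux φ n).2 a b) }
    (fun x y => by
      obtain ⟨n, a, b, rfl, rfl⟩ := FullSpectrum.exists_ofStage₂ _ x y
      exact (congrArg (ptLiftFun φ) (map_add ((pt φ).ofStage n) a b)).symm.trans
        (map_add (ofHomAux φ n).2 a b))

theorem ptLift_comp_of [Nontrivial B] (φ : A →+* B) : (ptLift φ).comp (pt φ).of = φ := rfl

/-- An element of stage `n` that becomes a unit in `B` belongs to `S_{n+1}`, hence is already
inverted at stage `n + 1`. -/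
instance [Nontrivial B] (φ : A →+* B) : IsLocalHom (ptLift φ) where
  map_nonunit z hz := by
    obtain ⟨n, a, rfl⟩ := FullSpectrum.exists_ofStage _ z
    rw [← FullSpectrum.ofStage_succ_of]
    exact (Loc.isUnit_of {a | IsUnit ((ofHomAux φ n).2 a)} hz).map ((pt φ).ofStage (n + 1))

instance (s : FullSpectrum A) : Nontrivial s.LocAt := by
  obtain ⟨_, B, _, _, φ, rfl⟩ := s
  exact (ptLift φ).domain_nontrivial

/-- If `s` comes from `φ`, then `φ` is `s.of` followed by the local homomorphism `ptLift φ`, and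
local homomorphisms do not change the point. Together with `pt_eq_iff` this replaces sequences of
subsets by local homomorphisms out of `A_𝒮`. -/
theorem pt_of (s : FullSpectrum A) : pt s.of = s := by
  obtain ⟨_, B, _, _, φ, rfl⟩ := s
  exact (pt_comp (pt φ).of (ptLift φ)).symm

theorem pt_eq_iff [Nontrivial B] {φ : A →+* B} {s : FullSpectrum A} :
    pt φ = s ↔ ∃ χ : s.LocAt →+* B, χ.comp s.of = φ ∧ IsLocalHom χ := by
  constructor
  · rintro rfl
    exact ⟨ptLift φ, rfl, inferInstance⟩
  · rintro ⟨χ, rfl, _⟩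
    rw [pt_comp, pt_of]

theorem pt_eq_of_isLocalHom [Nontrivial B] {s : FullSpectrum A} (χ : s.LocAt →+* B) [IsLocalHom χ]
    {φ : A →+* B} (h : χ.comp s.of = φ) : pt φ = s :=
  pt_eq_iff.2 ⟨χ, h, inferInstance⟩

end Points
/-! ### Fractions -/

namespace Fraction

variable {A : Type u} [Ring A] {B : Type u} [Ring B] {C : Type u} [Ring C]

theorem invertible_succ {n : ℕ} (a : A) (b : Fraction n (Loc A {a})) (φ : A →+* B) :
    Invertible (n := n + 1) φ ⟨a, b⟩ ↔
      ∃ ψ : Loc A {a} →+* B, ψ.comp (Loc.of {a}) = φ ∧ b.Invertible ψ := by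
  constructor
  · rintro ⟨h, hb⟩
    exact ⟨_, Loc.lift_comp_of _ _ _, hb⟩
  · rintro ⟨ψ, rfl, hb⟩
    refine ⟨(Loc.isUnit_of {a} rfl).map ψ, ?_⟩
    convert hb using 1
    exact Loc.hom_ext _ fun x => Loc.lift_of _ _ _ x

/-- The fraction `(c)` of length one. -/
def single (c : A) : Fraction 1 A := ⟨c, PUnit.unit⟩

theorem single_invertible (c : A) (φ : A →+* B) : (single c).Invertible φ ↔ IsUnit (φ c) :=
  ⟨fun h => h.1, fun h => ⟨h, trivial⟩⟩

/-- The ring `A_𝐚 = ((A_{a_1})_{a_2})…` for a fraction `𝐚 = (a_1, a_2, …)`. -/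
def ring : ∀ {n : ℕ} {A : Type u} [Ring A], Fraction n A → RingCat.{u}
  | 0, A, _, _ => RingCat.of A
  | n + 1, A, _, a => ring (n := n) (A := Loc A {Sigma.fst a}) (Sigma.snd a)

/-- The canonical homomorphism `A → A_𝐚`. -/
def of : ∀ {n : ℕ} {A : Type u} [Ring A] (a : Fraction n A), A →+* a.ring
  | 0, A, _, _ => RingHom.id A
  | n + 1, A, _, a => RingHom.comp (of (n := n) (A := Loc A {Sigma.fst a}) (Sigma.snd a))
      (Loc.of {Sigma.fst a})

/-- The universal property of `A_𝐚`; with `Fraction.hom_ext` the factorization is unique. -/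
theorem invertible_iff {n : ℕ} : ∀ {A : Type u} [Ring A] (a : Fraction n A) (φ : A →+* B),
    a.Invertible φ ↔ ∃ ψ : a.ring →+* B, ψ.comp a.of = φ := by
  induction n with
  | zero => exact fun a φ => ⟨fun _ => ⟨φ, rfl⟩, fun _ => trivial⟩
  | succ n ih =>
    rintro A _ ⟨a, b⟩ φ
    rw [invertible_succ]
    constructor
    · rintro ⟨ψ, rfl, hb⟩
      obtain ⟨χ, rfl⟩ := (ih b ψ).1 hb
      exact ⟨χ, rfl⟩
    · rintro ⟨χ, rfl⟩
      exact ⟨RingHom.comp (α := Loc A {a}) χ b.of, rfl, (ih b _).2 ⟨χ, rfl⟩⟩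

theorem hom_ext {n : ℕ} : ∀ {A : Type u} [Ring A] (a : Fraction n A) {f g : a.ring →+* B},
    f.comp a.of = g.comp a.of → f = g := by
  induction n with
  | zero => exact fun a f g h => h
  | succ n ih =>
    rintro A _ ⟨a, b⟩ f g h
    exact ih b (Loc.hom_ext {a} fun x => DFunLike.congr_fun h x)

theorem Invertible.comp {n : ℕ} {a : Fraction n A} {φ : A →+* B} (h : a.Invertible φ)
    (χ : B →+* C) : a.Invertible (χ.comp φ) := by
  obtain ⟨ψ, rfl⟩ := (invertible_iff a φ).1 h
  exact (invertible_iff a _).2 ⟨χ.comp ψ, rfl⟩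

/-- Reflection of units, applied to each entry of the fraction in turn. It allows membership in
`D(𝐚)` to be tested on any homomorphism defining the point (`pt_mem_D`). -/
theorem invertible_comp_iff {n : ℕ} (χ : B →+* C) [IsLocalHom χ] :
    ∀ {A : Type u} [Ring A] (a : Fraction n A) (φ : A →+* B),
      a.Invertible (χ.comp φ) ↔ a.Invertible φ := by
  induction n with
  | zero => exact fun _ _ => Iff.rfl
  | succ n ih =>
    rintro A _ ⟨a, b⟩ φ
    refine ⟨?_, fun h => h.comp χ⟩
    rw [invertible_succ, invertible_succ]
    rintro ⟨ψ, hψ, hb⟩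
    have hu : ∀ s ∈ ({a} : Set A), IsUnit (φ s) := by
      intro s hs
      rw [← isUnit_map_iff χ, ← RingHom.comp_apply, ← hψ]
      exact (Loc.isUnit_of {a} hs).map ψ
    refine ⟨Loc.lift _ φ hu, Loc.lift_comp_of _ _ _, (ih b _).1 ?_⟩
    convert hb using 1
    refine Loc.hom_ext _ fun x => ?_
    exact (congrArg χ (Loc.lift_of _ _ _ x)).trans (DFunLike.congr_fun hψ x).symm

theorem exists_concat {n m : ℕ} : ∀ {A : Type u} [Ring A] (a : Fraction n A)
    (b : Fraction m a.ring), ∃ (k : ℕ) (c : Fraction k A), ∀ {B : Type u} [Ring B] (φ : A →+* B),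
      c.Invertible φ ↔ ∃ ψ : a.ring →+* B, ψ.comp a.of = φ ∧ b.Invertible ψ := by
  induction n with
  | zero =>
    intro A _ a b
    refine ⟨m, b, fun φ => ⟨fun h => ⟨φ, rfl, h⟩, ?_⟩⟩
    rintro ⟨ψ, rfl, h⟩
    exact h
  | succ n ih =>
    rintro A _ ⟨a, a'⟩ b
    obtain ⟨k, c, hc⟩ := ih a' b
    refine ⟨k + 1, ⟨a, c⟩, fun φ => ?_⟩
    rw [invertible_succ]
    constructor
    · rintro ⟨ψ, rfl, h⟩
      obtain ⟨χ, rfl, h'⟩ := (hc ψ).1 h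
      exact ⟨χ, rfl, h'⟩
    · rintro ⟨χ, rfl, h⟩
      exact ⟨RingHom.comp (α := Loc A {a}) χ a'.of, rfl, (hc _).2 ⟨χ, rfl, h⟩⟩

/-- The homomorphism `A_a → B_{φ(a)}` induced by `φ : A → B`. -/
def locMap (φ : A →+* B) (a : A) : Loc A {a} →+* Loc B {φ a} :=
  Loc.lift {a} ((Loc.of {φ a}).comp φ) (by rintro _ rfl; exact Loc.isUnit_of _ rfl)

theorem locMap_comp_of (φ : A →+* B) (a : A) :
    (locMap φ a).comp (Loc.of {a}) = (Loc.of {φ a}).comp φ :=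
  Loc.lift_comp_of _ _ _

/-- The square formed by `A → A_a` and `B → B_{φ(a)}` is a pushout. -/
theorem exists_locMap_comp {φ : A →+* B} {a : A} {ψ : B →+* C} {χ : Loc A {a} →+* C}
    (h : χ.comp (Loc.of {a}) = ψ.comp φ) :
    ∃ χ' : Loc B {φ a} →+* C, χ'.comp (Loc.of {φ a}) = ψ ∧ χ'.comp (locMap φ a) = χ := by
  have hu : ∀ s ∈ ({φ a} : Set B), IsUnit (ψ s) := by
    rintro _ rfl
    rw [← RingHom.comp_apply, ← h]
    exact (Loc.isUnit_of {a} rfl).map χ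
  refine ⟨Loc.lift _ ψ hu, Loc.lift_comp_of _ _ _, Loc.hom_ext _ fun x => ?_⟩
  rw [← RingHom.comp_apply, RingHom.comp_assoc, locMap_comp_of, ← RingHom.comp_assoc,
    Loc.lift_comp_of, ← h]
  rfl

/-- The image of a fraction under a homomorphism. -/
def map : ∀ {n : ℕ} {A : Type u} [Ring A] {B : Type u} [Ring B], (A →+* B) → Fraction n A →
    Fraction n B
  | 0, _, _, _, _, _, _ => PUnit.unit
  | n + 1, A, _, B, _, φ, a => ⟨φ (Sigma.fst a), map (n := n) (A := Loc A {Sigma.fst a})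
      (B := Loc B {φ (Sigma.fst a)}) (locMap φ _) (Sigma.snd a)⟩

theorem map_invertible {n : ℕ} : ∀ {A : Type u} [Ring A] {B : Type u} [Ring B] (φ : A →+* B)
    (a : Fraction n A) (ψ : B →+* C), (a.map φ).Invertible ψ ↔ a.Invertible (ψ.comp φ) := by
  induction n with
  | zero => exact fun _ _ _ => Iff.rfl
  | succ n ih =>
    rintro A _ B _ φ ⟨a, b⟩ ψ
    refine (invertible_succ (φ a) (b.map (locMap φ a)) ψ).trans ?_
    rw [invertible_succ]
    constructor
    · rintro ⟨χ, rfl, h⟩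
      refine ⟨χ.comp (locMap φ a), ?_, (ih _ _ _).1 h⟩
      rw [RingHom.comp_assoc, locMap_comp_of]; rfl
    · rintro ⟨χ, hχ, h⟩
      obtain ⟨χ', rfl, rfl⟩ := exists_locMap_comp hχ
      exact ⟨χ', rfl, (ih _ _ _).2 h⟩

/-- The elements satisfying `P` form a subring through which `A → A_S` lifts. The lift followed by
the inclusion is the identity by `Loc.hom_ext`, so the subring is everything. -/
theorem _root_.FSch.Loc.induction {S : Set A} {P : Loc A S → Prop} (hof : ∀ a, P (Loc.of S a))
    (hinv : ∀ s, P (Loc.inv S s)) (hneg : ∀ x, P x → P (-x))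
    (hadd : ∀ x y, P x → P y → P (x + y)) (hmul : ∀ x y, P x → P y → P (x * y)) (x : Loc A S) :
    P x := by
  let E : Subring (Loc A S) :=
    { carrier := {x | P x}
      zero_mem' := by simpa using hof 0
      one_mem' := by simpa using hof 1
      neg_mem' := fun {x} hx => hneg x hx
      add_mem' := fun {x y} hx hy => hadd x y hx hy
      mul_mem' := fun {x y} hx hy => hmul x y hx hy }
  let ψ : Loc A S →+* E := Loc.lift S ((Loc.of S).codRestrict E hof) fun s hs =>
    ⟨⟨⟨Loc.of S s, hof s⟩, ⟨Loc.inv S ⟨s, hs⟩, hinv _⟩, Subtype.ext (Loc.mul_inv S ⟨s, hs⟩),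
      Subtype.ext (Loc.inv_mul S ⟨s, hs⟩)⟩, rfl⟩
  have h : E.subtype.comp ψ = RingHom.id _ := Loc.hom_ext S fun a =>
    congrArg Subtype.val (Loc.lift_of S ((Loc.of S).codRestrict E hof) _ a)
  have := (ψ x).2
  rwa [show ((ψ x : E) : Loc A S) = x from DFunLike.congr_fun h x] at this

theorem locMap_surjective {φ : A →+* B} (hφ : Function.Surjective φ) (a : A) :
    Function.Surjective (locMap φ a) := by
  have hof : ∀ x, locMap φ a (Loc.of {a} x) = Loc.of {φ a} (φ x) := fun x =>
    DFunLike.congr_fun (locMap_comp_of φ a) x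
  intro y
  induction y using Loc.induction with
  | hof b =>
    obtain ⟨x, rfl⟩ := hφ b
    exact ⟨_, hof x⟩
  | hinv s =>
    obtain ⟨_, rfl⟩ := s
    refine ⟨Loc.inv {a} ⟨a, rfl⟩, left_inv_eq_right_inv (a := Loc.of {φ a} (φ a)) ?_
      (Loc.mul_inv {φ a} ⟨φ a, rfl⟩)⟩
    rw [← hof, ← map_mul, Loc.inv_mul {a} ⟨a, rfl⟩, map_one]
  | hneg x h => obtain ⟨y, rfl⟩ := h; exact ⟨-y, map_neg _ _⟩
  | hadd x y h h' => obtain ⟨x, rfl⟩ := h; obtain ⟨y, rfl⟩ := h'; exact ⟨x + y, map_add _ _ _⟩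
  | hmul x y h h' => obtain ⟨x, rfl⟩ := h; obtain ⟨y, rfl⟩ := h'; exact ⟨x * y, map_mul _ _ _⟩

/-- Surjectivity passes to `A_a → B_{φ(a)}` since the inverse of `φ(a)` is the image of that of `a`.
This is what makes the topology of `F(B)` induced from `F(A)`. -/
theorem map_surjective {n : ℕ} : ∀ {A : Type u} [Ring A] {B : Type u} [Ring B] {φ : A →+* B},
    Function.Surjective φ → Function.Surjective (map (n := n) φ) := by
  induction n with
  | zero => exact fun _ _ => ⟨PUnit.unit, rfl⟩
  | succ n ih =>
    rintro A _ B _ φ hφ ⟨b, c⟩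
    obtain ⟨a, rfl⟩ := hφ b
    obtain ⟨d, rfl⟩ := ih (locMap_surjective hφ a) c
    exact ⟨⟨a, d⟩, rfl⟩

/-- Append to `𝐚` the image of `𝐛` in `A_𝐚`. -/
theorem exists_inter {n m : ℕ} (a : Fraction n A) (b : Fraction m A) :
    ∃ (k : ℕ) (c : Fraction k A), ∀ {B : Type u} [Ring B] (φ : A →+* B),
      c.Invertible φ ↔ a.Invertible φ ∧ b.Invertible φ := by
  obtain ⟨k, c, hc⟩ := exists_concat a (b.map a.of)
  refine ⟨k, c, fun φ => ?_⟩
  rw [hc]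
  constructor
  · rintro ⟨ψ, rfl, h⟩
    exact ⟨(invertible_iff a _).2 ⟨ψ, rfl⟩, (map_invertible _ _ _).1 h⟩
  · rintro ⟨h, h'⟩
    obtain ⟨ψ, rfl⟩ := (invertible_iff a _).1 h
    exact ⟨ψ, rfl, (map_invertible _ _ _).2 h'⟩

end Fraction

/-! ### The topology of the full spectrum -/

section Topology

variable {A : Type u} [Ring A] {B : Type u} [Ring B] {C : Type u} [Ring C]

theorem pt_mem_D [Nontrivial B] (φ : A →+* B) {n : ℕ} (a : Fraction n A) :
    pt φ ∈ FullSpectrum.D a ↔ a.Invertible φ :=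
  (Fraction.invertible_comp_iff (ptLift φ) a (pt φ).of).symm

theorem isTopologicalBasis_D : IsTopologicalBasis
    {U : Set (FullSpectrum A) | ∃ (n : ℕ) (a : Fraction n A), U = FullSpectrum.D a} where
  exists_subset_inter := by
    rintro _ ⟨n, a, rfl⟩ _ ⟨m, b, rfl⟩ x ⟨hx, hx'⟩
    obtain ⟨k, c, hc⟩ := Fraction.exists_inter a b
    exact ⟨_, ⟨k, c, rfl⟩, (hc _).2 ⟨hx, hx'⟩, fun y hy => (hc _).1 hy⟩
  sUnion_eq := Set.eq_univ_of_forall fun x =>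
    ⟨_, ⟨0, PUnit.unit, rfl⟩, (trivial : Fraction.Invertible (n := 0) x.of PUnit.unit)⟩
  eq_generateFrom := rfl

theorem exists_D_subset {U : Set (FullSpectrum A)} (hU : IsOpen U) {s : FullSpectrum A}
    (hs : s ∈ U) : ∃ (n : ℕ) (a : Fraction n A), s ∈ FullSpectrum.D a ∧ FullSpectrum.D a ⊆ U := by
  obtain ⟨_, ⟨n, a, rfl⟩, h, h'⟩ := isTopologicalBasis_D.exists_subset_of_mem_open hs hU
  exact ⟨n, a, h, h'⟩

theorem isOpen_D {n : ℕ} (a : Fraction n A) : IsOpen (FullSpectrum.D a) :=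
  isTopologicalBasis_D.isOpen ⟨n, a, rfl⟩

/-- Neighbourhoods of the point of `A → B` contain all points of `A → B → C`. -/
theorem pt_comp_mem_of_isOpen [Nontrivial B] [Nontrivial C] {U : Set (FullSpectrum A)}
    (hU : IsOpen U) (φ : A →+* B) (χ : B →+* C) (h : pt φ ∈ U) : pt (χ.comp φ) ∈ U := by
  obtain ⟨n, a, ha, haU⟩ := exists_D_subset hU h
  exact haU ((pt_mem_D _ a).2 (((pt_mem_D _ a).1 ha).comp χ))

theorem mem_of_pt_id_mem [Nontrivial A] {U : Set (FullSpectrum A)} (hU : IsOpen U)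
    (h : pt (RingHom.id A) ∈ U) (s : FullSpectrum A) : s ∈ U := by
  rw [← pt_of s]
  exact pt_comp_mem_of_isOpen hU _ s.of h

/-- The map `F(B) → F(A)` induced by `φ : A → B`. -/
def comap (φ : A →+* B) (s : FullSpectrum B) : FullSpectrum A := pt (s.of.comp φ)

/-- The homomorphism of localizations induced by `φ : A → B`. -/
def comapLift (φ : A →+* B) (s : FullSpectrum B) : (comap φ s).LocAt →+* s.LocAt :=
  ptLift (s.of.comp φ)

theorem comapLift_comp_of (φ : A →+* B) (s : FullSpectrum B) :
    (comapLift φ s).comp (comap φ s).of = s.of.comp φ := rfl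

theorem comapLift_of (φ : A →+* B) (s : FullSpectrum B) (a : A) :
    comapLift φ s ((comap φ s).of a) = s.of (φ a) := rfl

instance (φ : A →+* B) (s : FullSpectrum B) : IsLocalHom (comapLift φ s) :=
  inferInstanceAs (IsLocalHom (ptLift (s.of.comp φ)))

theorem comap_pt [Nontrivial C] (φ : A →+* B) (ψ : B →+* C) : comap φ (pt ψ) = pt (ψ.comp φ) :=
  (pt_comp ((pt ψ).of.comp φ) (ptLift ψ)).symm

theorem comap_mem_D (φ : A →+* B) (s : FullSpectrum B) {n : ℕ} (a : Fraction n A) :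
    comap φ s ∈ FullSpectrum.D a ↔ s ∈ FullSpectrum.D (a.map φ) :=
  (pt_mem_D _ a).trans (Fraction.map_invertible φ a s.of).symm

theorem continuous_comap (φ : A →+* B) : Continuous (comap φ) := by
  refine continuous_generateFrom_iff.2 ?_
  rintro _ ⟨n, a, rfl⟩
  rw [show comap φ ⁻¹' FullSpectrum.D a = FullSpectrum.D (a.map φ) from
    Set.ext fun s => comap_mem_D φ s a]
  exact isOpen_D _

/-- The identity of homomorphisms holds because `A → A_𝐚` is an epimorphism; the identity of points
follows because `comapLift` is local. -/
theorem Fraction.lift_eq_pt {n : ℕ} (a : Fraction n A) (s : FullSpectrum a.ring) :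
    ∀ ψ : a.ring →+* (comap a.of s).LocAt, ψ.comp a.of = (comap a.of s).of →
      (comapLift a.of s).comp ψ = s.of ∧ pt ψ = s := by
  intro ψ hψ
  have h : (comapLift a.of s).comp ψ = s.of := Fraction.hom_ext a (by
    rw [RingHom.comp_assoc, hψ, comapLift_comp_of])
  refine ⟨h, ?_⟩
  rw [← pt_comp ψ (comapLift a.of s), h, pt_of]

theorem Fraction.exists_lift_of_mem_D {n : ℕ} {a : Fraction n A} {y : FullSpectrum A}
    (hy : y ∈ FullSpectrum.D a) : ∃ ψ : a.ring →+* y.LocAt, ψ.comp a.of = y.of :=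
  (Fraction.invertible_iff a _).1 hy

theorem comap_fraction_mem_D {n : ℕ} (a : Fraction n A) (s : FullSpectrum a.ring) :
    comap a.of s ∈ FullSpectrum.D a :=
  (pt_mem_D _ a).2 ((Fraction.invertible_iff a _).2 ⟨s.of, rfl⟩)

theorem comap_fraction_injective {n : ℕ} (a : Fraction n A) : Function.Injective (comap a.of) := by
  -- The point `s` is recovered from its image `y` as `pt ψ`, with `ψ` independent of `s`. The image
  -- is a variable because the type of `ψ` depends on it.
  have key : ∀ (y : FullSpectrum A) (s : FullSpectrum a.ring), comap a.of s = y →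
      ∀ ψ : a.ring →+* y.LocAt, ψ.comp a.of = y.of → pt ψ = s := by
    rintro _ s rfl ψ hψ
    exact (a.lift_eq_pt s ψ hψ).2
  intro s s' h
  obtain ⟨ψ, hψ⟩ := Fraction.exists_lift_of_mem_D (comap_fraction_mem_D a s)
  rw [← key _ s rfl ψ hψ, ← key _ s' h.symm ψ hψ]

theorem comap_pt_fraction {n : ℕ} (a : Fraction n A) {y : FullSpectrum A}
    (ψ : a.ring →+* y.LocAt) (hψ : ψ.comp a.of = y.of) : comap a.of (pt ψ) = y := by
  rw [comap_pt, hψ, pt_of]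

theorem range_comap_fraction {n : ℕ} (a : Fraction n A) :
    Set.range (comap a.of) = FullSpectrum.D a := by
  ext y
  constructor
  · rintro ⟨s, rfl⟩
    exact comap_fraction_mem_D a s
  · intro hy
    obtain ⟨ψ, hψ⟩ := Fraction.exists_lift_of_mem_D hy
    exact ⟨pt ψ, comap_pt_fraction a ψ hψ⟩

theorem isOpenEmbedding_comap_fraction {n : ℕ} (a : Fraction n A) :
    Topology.IsOpenEmbedding (comap a.of) := by
  refine .of_continuous_injective_isOpenMap (continuous_comap _) (comap_fraction_injective a) ?_
  refine isTopologicalBasis_D.isOpenMap_iff.2 ?_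
  rintro _ ⟨m, b, rfl⟩
  obtain ⟨k, c, hc⟩ := Fraction.exists_concat a b
  rw [show comap a.of '' FullSpectrum.D b = FullSpectrum.D c from ?_]
  · exact isOpen_D _
  ext y
  constructor
  · rintro ⟨s, hs, rfl⟩
    exact (pt_mem_D _ c).2 ((hc _).2 ⟨s.of, rfl, hs⟩)
  · intro hy
    obtain ⟨ψ, hψ, hb⟩ := (hc _).1 hy
    exact ⟨pt ψ, (pt_mem_D _ b).2 hb, comap_pt_fraction a ψ hψ⟩

/-- The factorization `ψ` of `A → A_𝒮` through `A_𝐚` defines the point `s`, so it extends to the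
localization at `s`. This extension is inverse to `comapLift`, both localizations being epimorphic.
-/
theorem comapLift_fraction_bijective {n : ℕ} (a : Fraction n A) (s : FullSpectrum a.ring) :
    Function.Bijective (comapLift a.of s) := by
  obtain ⟨ψ, hψ⟩ := Fraction.exists_lift_of_mem_D (comap_fraction_mem_D a s)
  obtain ⟨h, hs⟩ := a.lift_eq_pt s ψ hψ
  obtain ⟨χ, hχ, -⟩ := pt_eq_iff.1 hs
  have h1 : (comapLift a.of s).comp χ = RingHom.id _ := FullSpectrum.hom_ext _ (by
    rw [RingHom.comp_assoc, hχ, h]; rfl)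
  have h2 : χ.comp (comapLift a.of s) = RingHom.id _ := FullSpectrum.hom_ext _ (by
    rw [RingHom.comp_assoc, comapLift_comp_of, ← RingHom.comp_assoc, hχ, hψ]; rfl)
  exact Function.bijective_iff_has_inverse.2
    ⟨χ, fun x => DFunLike.congr_fun h2 x, fun x => DFunLike.congr_fun h1 x⟩

end Topology

/-! ### Sections and germs -/

section Germs

variable {X Y Z : NCRingedSpace.{u}}

/-- The ring of sections of the structure sheaf. -/
abbrev Sec (X : NCRingedSpace.{u}) (U : Opens X) : Type u := X.presheaf.obj (op U)

/-- The stalk of the structure sheaf. -/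
abbrev Stalk (X : NCRingedSpace.{u}) (x : X) : Type u := X.presheaf.stalk x

/-- Restriction of sections. -/
def res {U V : Opens X} (h : V ≤ U) : Sec X U →+* Sec X V := (X.presheaf.map (homOfLE h).op).hom

/-- The germ of a section. -/
def germ (x : X) {U : Opens X} (hx : x ∈ U) : Sec X U →+* Stalk X x :=
  (X.presheaf.germ U x hx).hom

theorem germ_res {U V : Opens X} (h : V ≤ U) (x : X) (hx : x ∈ V) (s : Sec X U) :
    germ x hx (res h s) = germ x (h hx) s :=
  TopCat.Presheaf.germ_res_apply X.presheaf (homOfLE h) x hx s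

theorem exists_germ (x : X) (g : Stalk X x) {U : Opens X} (hx : x ∈ U) :
    ∃ (V : Opens X) (_ : V ≤ U) (hV : x ∈ V) (s : Sec X V), germ x hV s = g := by
  obtain ⟨V, h, hV, s, hs⟩ := TopCat.Presheaf.exists_le_germ_eq X.presheaf g hx
  exact ⟨V, h, hV, s, hs⟩

theorem exists_res_eq {U V : Opens X} {x : X} (hU : x ∈ U) (hV : x ∈ V) {s : Sec X U} {t : Sec X V}
    (h : germ x hU s = germ x hV t) :
    ∃ (W : Opens X) (hWU : W ≤ U) (hWV : W ≤ V), x ∈ W ∧ res hWU s = res hWV t := by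
  obtain ⟨W, hW, i, j, e⟩ := TopCat.Presheaf.germ_eq X.presheaf x hU hV s t h
  exact ⟨W, i.le, j.le, hW, e⟩

theorem section_ext {U : Opens X} {s t : Sec X U}
    (h : ∀ x (hx : x ∈ U), germ x hx s = germ x hx t) : s = t :=
  TopCat.Presheaf.section_ext X.sheaf U s t h

/-- Pullback of sections along a morphism. -/
def pull (f : X ⟶ Y) (U : Opens Y) : Sec Y U →+* Sec X ((Opens.map f.hom.base).obj U) :=
  (f.hom.c.app (op U)).hom

/-- The map of stalks, as a ring homomorphism. -/
def stalkHom (f : X ⟶ Y) (x : X) : Stalk Y (f.hom.base x) →+* Stalk X x := (f.hom.stalkMap x).hom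

theorem stalkHom_germ (f : X ⟶ Y) (x : X) {U : Opens Y} (hx : f.hom.base x ∈ U) (s : Sec Y U) :
    stalkHom f x (germ (f.hom.base x) hx s) =
      germ (X := X) (U := (Opens.map f.hom.base).obj U) x hx (pull f U s) :=
  PresheafedSpace.stalkMap_germ_apply f.hom U x hx s

theorem pull_res (f : X ⟶ Y) {U V : Opens Y} (h : V ≤ U) (s : Sec Y U) :
    pull f V (res h s) = res (X := X) (U := (Opens.map f.hom.base).obj U)
      (V := (Opens.map f.hom.base).obj V) (fun _ hx => h hx) (pull f U s) :=
  congrArg (fun k => k.hom s) (f.hom.c.naturality (homOfLE h).op)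

section StalkDesc

variable (x : X) {C : Type u} [Ring C] (h : ∀ U : Opens X, x ∈ U → (Sec X U →+* C))
    (hres : ∀ {U V : Opens X} (hVU : V ≤ U) (hx : x ∈ V),
      (h V hx).comp (res hVU) = h U (hVU hx))

/-- The cocone defined by a compatible family of homomorphisms. -/
def stalkCocone : Limits.Cocone ((OpenNhds.inclusion x).op ⋙ X.presheaf) where
  pt := RingCat.of C
  ι := { app := fun U => RingCat.ofHom (h U.unop.1 U.unop.2)
         naturality := fun _ V i => RingCat.hom_ext (hres (leOfHom i.unop) V.unop.2) }

/-- The homomorphism from a stalk defined by a compatible family of homomorphisms. -/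
def stalkDesc : Stalk X x →+* C :=
  (Limits.colimit.desc ((OpenNhds.inclusion x).op ⋙ X.presheaf) (stalkCocone x h hres)).hom

theorem stalkDesc_germ {U : Opens X} (hx : x ∈ U) (s : Sec X U) :
    stalkDesc x h hres (germ x hx s) = h U hx s :=
  congrArg (fun k : X.presheaf.obj (op U) ⟶ RingCat.of C => k.hom s)
    (Limits.colimit.ι_desc (F := (OpenNhds.inclusion x).op ⋙ X.presheaf)
      (stalkCocone x h hres) (op ⟨U, hx⟩))

end StalkDesc

theorem isLocalHom_stalkHom {f : X ⟶ Y} (hf : IsLocalMorphism f) (x : X) :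
    IsLocalHom (stalkHom f x) := hf x

end Germs

/-! ### Sections and stalks of affine F-schemes -/

section Affine

variable {A : Type u} [Ring A] {B : Type u} [Ring B] {C : Type u} [Ring C]

/-- The value of a section of `𝒪_A` at a point. -/
def evalAt (s : FullSpectrum A) {W : Opens (TopCat.of (FullSpectrum A))} (hs : s ∈ W) :
    Sec (affine A) W →+* s.LocAt :=
  (Pi.evalRingHom (fun s : W => FullSpectrum.LocAt s.1) ⟨s, hs⟩).comp
    ((expressions A).sections W).subtype

/-- A function given by one expression, as a section. -/
def ofExpression {W : Opens (TopCat.of (FullSpectrum A))} (f : ∀ s : W, s.1.LocAt)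
    (hf : IsExpression A (W : Set (FullSpectrum A)) f) : Sec (affine A) W :=
  (⟨f, fun x => ⟨W, x.2, 𝟙 _, hf⟩⟩ : (expressions A).sections W)

theorem eval_ext {W : Opens (TopCat.of (FullSpectrum A))} {t t' : Sec (affine A) W}
    (h : ∀ s (hs : s ∈ W), evalAt s hs t = evalAt s hs t') : t = t' :=
  Subtype.ext (funext fun s => h s.1 s.2)

theorem exists_ofExpression {W : Opens (TopCat.of (FullSpectrum A))} (t : Sec (affine A) W)
    {s : FullSpectrum A} (hs : s ∈ W) : ∃ (V : Opens (TopCat.of (FullSpectrum A))) (h : V ≤ W)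
      (f : _) (hf : IsExpression A (V : Set (FullSpectrum A)) f),
      s ∈ V ∧ res (X := affine A) h t = ofExpression f hf := by
  obtain ⟨V, hV, i, hf⟩ := (show (expressions A).sections W from t).2 ⟨s, hs⟩
  exact ⟨V, i.le, _, hf, hV, rfl⟩

/-- The constant section defined by an element of `A`. -/
def const (W : Opens (TopCat.of (FullSpectrum A))) : A →+* Sec (affine A) W where
  toFun a := ofExpression (fun s => s.1.of a) (.const a)
  map_zero' := eval_ext fun s _ => map_zero s.of
  map_one' := eval_ext fun s _ => map_one s.of
  map_add' a b := eval_ext fun s _ => map_add s.of a b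
  map_mul' a b := eval_ext fun s _ => map_mul s.of a b

theorem evalAt_const {W : Opens (TopCat.of (FullSpectrum A))} (a : A) (s : FullSpectrum A)
    (hs : s ∈ W) : evalAt s hs (const W a) = s.of a := rfl

/-- Sums and products are formed over a common fraction. If `f` is given by `c ∈ A_𝐚`, its inverse
is given by `c⁻¹` over the fraction `𝐚` extended by `c`. -/
theorem IsExpression.exists_fraction {U : Set (FullSpectrum A)} {f : ∀ s : U, s.1.LocAt}
    (hf : IsExpression A U f) (s : U) : ∃ (n : ℕ) (a : Fraction n A) (c : a.ring),
      s.1 ∈ FullSpectrum.D a ∧ ∀ y : U, ∀ ψ : a.ring →+* y.1.LocAt, ψ.comp a.of = y.1.of →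
        f y = ψ c := by
  have exists_common : ∀ {n m : ℕ} (a : Fraction n A) (b : Fraction m A),
      s.1 ∈ FullSpectrum.D a → s.1 ∈ FullSpectrum.D b →
      ∃ (k : ℕ) (d : Fraction k A) (χ : a.ring →+* d.ring) (ξ : b.ring →+* d.ring),
        χ.comp a.of = d.of ∧ ξ.comp b.of = d.of ∧ s.1 ∈ FullSpectrum.D d := by
    intro n m a b ha hb
    obtain ⟨k, d, hd⟩ := Fraction.exists_inter a b
    have := (hd d.of).1 ((Fraction.invertible_iff d _).2 ⟨RingHom.id _, rfl⟩)
    obtain ⟨χ, hχ⟩ := (Fraction.invertible_iff a _).1 this.1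
    obtain ⟨ξ, hξ⟩ := (Fraction.invertible_iff b _).1 this.2
    exact ⟨k, d, χ, ξ, hχ, hξ, (hd _).2 ⟨ha, hb⟩⟩
  induction hf with
  | const a =>
    exact ⟨0, PUnit.unit, a, trivial, fun y ψ hψ => (DFunLike.congr_fun hψ a).symm⟩
  | neg f _ ih =>
    obtain ⟨n, a, c, hs, h⟩ := ih
    exact ⟨n, a, -c, hs, fun y ψ hψ => by rw [map_neg, ← h y ψ hψ]; rfl⟩
  | add f g _ _ ih ih' =>
    obtain ⟨n, a, c, hs, h⟩ := ih
    obtain ⟨m, b, c', hs', h'⟩ := ih'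
    obtain ⟨k, d, χ, ξ, hχ, hξ, hd⟩ := exists_common a b hs hs'
    refine ⟨k, d, χ c + ξ c', hd, fun y ψ hψ => ?_⟩
    rw [map_add, ← RingHom.comp_apply, ← RingHom.comp_apply,
      ← h y (ψ.comp χ) (by rw [RingHom.comp_assoc, hχ, hψ]),
      ← h' y (ψ.comp ξ) (by rw [RingHom.comp_assoc, hξ, hψ])]
    rfl
  | mul f g _ _ ih ih' =>
    obtain ⟨n, a, c, hs, h⟩ := ih
    obtain ⟨m, b, c', hs', h'⟩ := ih'
    obtain ⟨k, d, χ, ξ, hχ, hξ, hd⟩ := exists_common a b hs hs'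
    refine ⟨k, d, χ c * ξ c', hd, fun y ψ hψ => ?_⟩
    rw [map_mul, ← RingHom.comp_apply, ← RingHom.comp_apply,
      ← h y (ψ.comp χ) (by rw [RingHom.comp_assoc, hχ, hψ]),
      ← h' y (ψ.comp ξ) (by rw [RingHom.comp_assoc, hξ, hψ])]
    rfl
  | inv f g _ hfg hgf ih =>
    obtain ⟨n, a, c, hs, h⟩ := ih
    obtain ⟨k, d, hd⟩ := Fraction.exists_concat a (Fraction.single c)
    obtain ⟨χ, hχ, hc⟩ := (hd d.of).1 ((Fraction.invertible_iff d _).2 ⟨RingHom.id _, rfl⟩)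
    rw [Fraction.single_invertible] at hc
    obtain ⟨e, he, -⟩ := hc.exists_right_inv.imp fun e he => And.intro he trivial
    have hu : ∀ y : U, f y * g y = 1 ∧ g y * f y = 1 := fun y => ⟨congrFun hfg y, congrFun hgf y⟩
    refine ⟨k, d, e, (hd _).2 ?_, fun y ψ hψ => ?_⟩
    · obtain ⟨ψ, hψ⟩ := Fraction.exists_lift_of_mem_D hs
      refine ⟨ψ, hψ, (Fraction.single_invertible _ _).2 ?_⟩
      rw [← h s ψ hψ]
      exact ⟨⟨_, _, (hu s).1, (hu s).2⟩, rfl⟩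
    · refine left_inv_eq_right_inv (hu y).2 ?_
      rw [h y (ψ.comp χ) (by rw [RingHom.comp_assoc, hχ, hψ]), RingHom.comp_apply, ← map_mul, he,
        map_one]

/-- Locally, sections of `𝒪_A` are given by elements of the rings `A_𝐚`. -/
theorem exists_fraction {W : Opens (TopCat.of (FullSpectrum A))} (t : Sec (affine A) W)
    {s : FullSpectrum A} (hs : s ∈ W) : ∃ (n : ℕ) (a : Fraction n A) (c : a.ring),
      s ∈ FullSpectrum.D a ∧ FullSpectrum.D a ⊆ (W : Set (FullSpectrum A)) ∧
        ∀ y (hy : y ∈ W), ∀ ψ : a.ring →+* y.LocAt, ψ.comp a.of = y.of →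
          evalAt y hy t = ψ c := by
  obtain ⟨V, hVW, f, hf, hV, e⟩ := exists_ofExpression t hs
  obtain ⟨n, a, c, ha, h⟩ := hf.exists_fraction ⟨s, hV⟩
  obtain ⟨m, b, hb, hbV⟩ := exists_D_subset V.2 hV
  obtain ⟨k, d, hd⟩ := Fraction.exists_inter a b
  have := (hd d.of).1 ((Fraction.invertible_iff d _).2 ⟨RingHom.id _, rfl⟩)
  obtain ⟨χ, hχ⟩ := (Fraction.invertible_iff a _).1 this.1
  have hdV : FullSpectrum.D d ⊆ V := fun y hy => hbV ((hd _).1 hy).2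
  refine ⟨k, d, χ c, (hd _).2 ⟨ha, hb⟩, hdV.trans hVW, fun y hy ψ hψ => ?_⟩
  have hyV : y ∈ V := hdV ((Fraction.invertible_iff d _).2 ⟨ψ, hψ⟩)
  exact (DFunLike.congr_arg (evalAt y hyV) e).trans
    (h ⟨y, hyV⟩ (ψ.comp χ) (by rw [RingHom.comp_assoc, hχ, hψ]))

/-- A section which is invertible at a point is invertible in a neighbourhood. -/
theorem exists_isUnit_res {W : Opens (TopCat.of (FullSpectrum A))} (t : Sec (affine A) W)
    {s : FullSpectrum A} (hs : s ∈ W) (h : IsUnit (evalAt s hs t)) :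
    ∃ (V : Opens (TopCat.of (FullSpectrum A))) (hVW : V ≤ W), s ∈ V ∧
      IsUnit (res (X := affine A) hVW t) := by
  obtain ⟨V, hVW, f, hf, hV, e⟩ := exists_ofExpression t hs
  obtain ⟨n, a, c, ha, hac⟩ := hf.exists_fraction ⟨s, hV⟩
  obtain ⟨k, d, hd⟩ := Fraction.exists_concat a (Fraction.single c)
  have hsd : s ∈ FullSpectrum.D d := by
    obtain ⟨ψ, hψ⟩ := Fraction.exists_lift_of_mem_D ha
    refine (hd _).2 ⟨ψ, hψ, (Fraction.single_invertible _ _).2 ?_⟩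
    rw [← hac ⟨s, hV⟩ ψ hψ]
    have e' : evalAt s hs t = f ⟨s, hV⟩ := DFunLike.congr_arg (evalAt s hV) e
    rwa [← e']
  -- On `D(d)` the element `c` is invertible, hence so is `f` at every point of `V'`; its pointwise
  -- inverse is an expression by the constructor `inv`.
  let V' : Opens (TopCat.of (FullSpectrum A)) := V ⊓ ⟨FullSpectrum.D d, isOpen_D d⟩
  have hV' : V' ≤ V := inf_le_left
  have hu : ∀ y : V', IsUnit (f ⟨y.1, hV' y.2⟩) := by
    intro y
    obtain ⟨ψ, hψ, hc⟩ := (hd _).1 y.2.2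
    rw [Fraction.single_invertible] at hc
    rwa [hac ⟨y.1, hV' y.2⟩ ψ hψ]
  have hf' : IsExpression A (V' : Set (FullSpectrum A)) (fun y => f ⟨y.1, hV' y.2⟩) :=
    (expressions A).res hV' f hf
  let g : ∀ y : V', y.1.LocAt := fun y => ((hu y).unit⁻¹ : (y.1.LocAt)ˣ)
  have h1 : (fun y : V' => f ⟨y.1, hV' y.2⟩) * g = 1 := funext fun y => (hu y).mul_val_inv
  have h2 : g * (fun y : V' => f ⟨y.1, hV' y.2⟩) = 1 := funext fun y => (hu y).val_inv_mul
  have e' : res (X := affine A) (hV'.trans hVW) t = ofExpression _ hf' :=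
    eval_ext fun y hy => DFunLike.congr_arg (evalAt y (hV' hy)) e
  refine ⟨V', hV'.trans hVW, ⟨hV, hsd⟩, ?_⟩
  rw [e']
  exact ⟨⟨_, ofExpression g (.inv _ g hf' h1 h2), eval_ext fun y hy => congrFun h1 ⟨y, hy⟩,
    eval_ext fun y hy => congrFun h2 ⟨y, hy⟩⟩, rfl⟩

/-- The homomorphism `𝒪_{A,𝒮} → A_𝒮` sending a germ to its value. -/
def evStalk (s : FullSpectrum A) : Stalk (affine A) s →+* s.LocAt :=
  stalkDesc (X := affine A) s (fun _ hs => evalAt s hs) fun _ _ => rfl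

theorem evStalk_germ (s : FullSpectrum A) {W : Opens (TopCat.of (FullSpectrum A))} (hs : s ∈ W)
    (t : Sec (affine A) W) : evStalk s (germ (X := affine A) s hs t) = evalAt s hs t :=
  stalkDesc_germ (X := affine A) s (fun _ hs => evalAt s hs) (fun _ _ => rfl) hs t

instance (s : FullSpectrum A) : Nontrivial (Stalk (affine A) s) := (evStalk s).domain_nontrivial

instance (s : FullSpectrum A) : IsLocalHom (evStalk s) where
  map_nonunit g hg := by
    obtain ⟨W, -, hs, t, rfl⟩ := exists_germ (X := affine A) s g (U := ⊤) trivial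
    have hg' : IsUnit (evalAt s hs t) := (evStalk_germ s hs t) ▸ hg
    obtain ⟨V, hVW, hV, hu⟩ := exists_isUnit_res t hs hg'
    exact germ_res (X := affine A) hVW s hV t ▸ hu.map (germ (X := affine A) s hV)

/-- Since evaluation is local, `A → 𝒪_{A,𝒮}` defines the point `𝒮` and therefore extends to `χ` on
`A_𝒮`. That `χ` inverts evaluation is checked by induction on expressions. -/
theorem evStalk_bijective (s : FullSpectrum A) : Function.Bijective (evStalk s) := by
  let κ : A →+* Stalk (affine A) s := (germ (X := affine A) (U := ⊤) s trivial).comp (const ⊤)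
  have hκ : (evStalk s).comp κ = s.of := RingHom.ext fun a => evStalk_germ s _ _
  obtain ⟨χ, hχ, -⟩ : ∃ χ : s.LocAt →+* Stalk (affine A) s, χ.comp s.of = κ ∧ IsLocalHom χ := by
    refine pt_eq_iff.1 ?_
    rw [← pt_comp κ (evStalk s), hκ, pt_of]
  have h1 : (evStalk s).comp χ = RingHom.id _ := FullSpectrum.hom_ext _ (by
    rw [RingHom.comp_assoc, hχ, hκ]; rfl)
  have key : ∀ {W : Opens (TopCat.of (FullSpectrum A))} (hs : s ∈ W) (f : ∀ s : W, s.1.LocAt)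
      (hf : IsExpression A (W : Set (FullSpectrum A)) f),
      χ (f ⟨s, hs⟩) = germ (X := affine A) s hs (ofExpression f hf) := by
    intro W hs f hf
    induction hf with
    | const a =>
      exact (DFunLike.congr_fun hχ a).trans (germ_res (X := affine A) (U := ⊤) le_top s hs
        (const ⊤ a)).symm
    | neg f hf ih =>
      exact (map_neg χ _).trans ((congrArg _ ih).trans
        (map_neg (germ (X := affine A) s hs) (ofExpression f hf)).symm)
    | add f g hf hg ih ih' =>
      exact (map_add χ _ _).trans ((congrArg₂ _ ih ih').trans
        (map_add (germ (X := affine A) s hs) (ofExpression f hf) (ofExpression g hg)).symm)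
    | mul f g hf hg ih ih' =>
      exact (map_mul χ _ _).trans ((congrArg₂ _ ih ih').trans
        (map_mul (germ (X := affine A) s hs) (ofExpression f hf) (ofExpression g hg)).symm)
    | inv f g hf hfg hgf ih =>
      have e1 : χ (g ⟨s, hs⟩) * χ (f ⟨s, hs⟩) = 1 :=
        (map_mul χ _ _).symm.trans ((congrArg χ (congrFun hgf ⟨s, hs⟩)).trans (map_one χ))
      refine left_inv_eq_right_inv e1 ?_
      rw [ih]
      exact (map_mul (germ (X := affine A) s hs) _ _).symm.trans
        ((congrArg (germ (X := affine A) s hs) (eval_ext fun y hy => congrFun hfg ⟨y, hy⟩)).trans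
          (map_one (germ (X := affine A) s hs)))
  refine Function.bijective_iff_has_inverse.2 ⟨χ, fun g => ?_, fun x => DFunLike.congr_fun h1 x⟩
  obtain ⟨W, -, hs, t, rfl⟩ := exists_germ (X := affine A) s g (U := ⊤) trivial
  obtain ⟨V, hVW, f, hf, hV, e⟩ := exists_ofExpression t hs
  have e' : germ (X := affine A) s hs t = germ (X := affine A) s hV (ofExpression f hf) :=
    (germ_res (X := affine A) hVW s hV t).symm.trans (congrArg _ e)
  exact (congrArg (fun g => χ (evStalk s g)) e').trans
    ((congrArg χ (evStalk_germ s hV (ofExpression f hf))).trans ((key hV f hf).trans e'.symm))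

/-- Near the point of a surjection `q : A → B`, every expression agrees, modulo the kernel of `q`,
with an element of `A`. -/
theorem IsExpression.exists_const [Nontrivial B] {q : A →+* B} (hq : Function.Surjective q)
    {U : Set (FullSpectrum A)} {f : ∀ s : U, s.1.LocAt} (hf : IsExpression A U f) (hU : pt q ∈ U) :
    ∃ c : A, ∀ (z : U) {C : Type u} [Ring C] (θ : z.1.LocAt →+* C) (β : B →+* C),
      θ.comp z.1.of = β.comp q → θ (f z) = β (q c) := by
  induction hf with
  | const a => exact ⟨a, fun z C _ θ β h => DFunLike.congr_fun h a⟩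
  | neg f _ ih =>
    obtain ⟨c, h⟩ := ih
    exact ⟨-c, fun z C _ θ β hθ => by rw [map_neg, map_neg, ← h z θ β hθ, ← map_neg]; rfl⟩
  | add f g _ _ ih ih' =>
    obtain ⟨c, h⟩ := ih
    obtain ⟨d, h'⟩ := ih'
    refine ⟨c + d, fun z C _ θ β hθ => ?_⟩
    rw [map_add, map_add, ← h z θ β hθ, ← h' z θ β hθ, ← map_add]; rfl
  | mul f g _ _ ih ih' =>
    obtain ⟨c, h⟩ := ih
    obtain ⟨d, h'⟩ := ih'
    refine ⟨c * d, fun z C _ θ β hθ => ?_⟩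
    rw [map_mul, map_mul, ← h z θ β hθ, ← h' z θ β hθ, ← map_mul]; rfl
  | inv f g _ hfg hgf ih =>
    obtain ⟨c, h⟩ := ih
    -- The inverse at the point of `q` already lives in `B`, so it lifts to some `d ∈ A`. The
    -- relation `q c * q d = 1` then serves at every other point.
    obtain ⟨d, hd⟩ := hq (ptLift q (g ⟨pt q, hU⟩))
    have e : q c * q d = 1 := by
      rw [hd, ← RingHom.id_apply (q c), ← h ⟨pt q, hU⟩ (ptLift q) (RingHom.id B) rfl, ← map_mul]
      exact (congrArg (ptLift q) (congrFun hfg ⟨pt q, hU⟩)).trans (map_one _)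
    refine ⟨d, fun z C _ θ β hθ => left_inv_eq_right_inv (a := θ (f z)) ?_ ?_⟩
    · exact (map_mul θ _ _).symm.trans ((congrArg θ (congrFun hgf z)).trans (map_one _))
    · rw [h z θ β hθ, ← map_mul, e, map_one]

/-- Global sections of `𝒪_A` are constant. -/
theorem exists_const_eq [Nontrivial A] {W : Opens (TopCat.of (FullSpectrum A))}
    (hW : pt (RingHom.id A) ∈ W) (t : Sec (affine A) W) : ∃ c, t = const W c := by
  obtain ⟨V, hVW, f, hf, hV, e⟩ := exists_ofExpression t hW
  obtain ⟨c, hc⟩ := hf.exists_const (q := RingHom.id A) Function.surjective_id hV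
  refine ⟨c, eval_ext fun s hs => ?_⟩
  have hsV : s ∈ V := mem_of_pt_id_mem V.2 hV s
  exact (DFunLike.congr_arg (evalAt s hsV) e).trans (hc ⟨s, hsV⟩ (RingHom.id _) s.of rfl)

theorem of_pt_id_injective [Nontrivial A] : Function.Injective (pt (RingHom.id A)).of :=
  Function.LeftInverse.injective (g := ptLift (RingHom.id A)) fun _ => rfl

end Affine
/-! ### Two-sided ideals and quotients -/

section Ideals

variable {R : Type*} [Ring R] {S : Type*} [Ring S] {T : Type*} [Ring T]

theorem subset_jacobson_iff (I : TwoSidedIdeal R) :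
    (I : Set R) ⊆ Ring.jacobson R ↔ ∀ x ∈ I, IsUnit (1 + x) := by
  rw [← Ideal.jacobson_bot]
  constructor
  · intro h
    have left : ∀ x ∈ I, ∃ z, z * (1 + x) = 1 := by
      intro x hx
      obtain ⟨z, hz⟩ := Ideal.mem_jacobson_iff.1 (h hx) 1
      refine ⟨z, ?_⟩
      rw [← sub_eq_zero, ← Ideal.mem_bot.1 hz]
      noncomm_ring
    intro x hx
    obtain ⟨z, hz⟩ := left x hx
    -- The left inverse `z = 1 - z * x` is again of the form `1 +` element of `I`, so it has a left
    -- inverse too; this makes `1 + x` two-sided invertible.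
    obtain ⟨w, hw⟩ := left (-(z * x)) (I.neg_mem (I.mul_mem_left _ _ hx))
    have e : 1 + -(z * x) = z := by rw [← hz]; noncomm_ring
    rw [e] at hw
    have : w = 1 + x := left_inv_eq_right_inv hw hz
    rw [← this]
    exact ⟨⟨w, z, hw, this ▸ hz⟩, rfl⟩
  · intro h x hx
    refine Ideal.mem_jacobson_iff.2 fun y => ?_
    obtain ⟨z, hz, -⟩ := (h (y * x) (I.mul_mem_left _ _ hx)).exists_left_inv.imp
      fun z hz => And.intro hz trivial
    refine ⟨z, Ideal.mem_bot.2 ?_⟩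
    rw [← hz]
    noncomm_ring

theorem TwoSidedIdeal.mk'_eq_zero_iff (I : TwoSidedIdeal R) (x : R) :
    RingCon.mk' I.ringCon x = 0 ↔ x ∈ I := by
  rw [← TwoSidedIdeal.mem_ker, TwoSidedIdeal.ker_ringCon_mk']

/-- If `f b` is the inverse of `f a`, then `a * b` and `b * a` lie in `1 + ker f` and are units, so
`a` has a right and a left inverse. -/
theorem isLocalHom_of_surjective {f : R →+* S} (hf : Function.Surjective f)
    (h : ∀ x, f x = 0 → IsUnit (1 + x)) : IsLocalHom f where
  map_nonunit a ha := by
    obtain ⟨u, hu⟩ := ha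
    obtain ⟨b, hb⟩ := hf (u⁻¹ : Sˣ)
    have h1 := h (a * b - 1) (by simp [hb, ← hu])
    have h2 := h (b * a - 1) (by simp [hb, ← hu])
    rw [add_sub_cancel] at h1 h2
    obtain ⟨c, hc⟩ := h1.exists_right_inv
    obtain ⟨d, hd⟩ := h2.exists_left_inv
    have e1 : a * (b * c) = 1 := by rw [← mul_assoc, hc]
    have e2 : (d * b) * a = 1 := by rw [mul_assoc, hd]
    exact ⟨⟨a, b * c, e1, left_inv_eq_right_inv e2 e1 ▸ e2⟩, rfl⟩

theorem isLocalHom_mk' {I : TwoSidedIdeal R} (h : ∀ x ∈ I, IsUnit (1 + x)) :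
    IsLocalHom (RingCon.mk' I.ringCon) :=
  isLocalHom_of_surjective (RingCon.mk'_surjective _)
    fun x hx => h x ((TwoSidedIdeal.mk'_eq_zero_iff I x).1 hx)

theorem nontrivial_of_isLocalHom [Nontrivial R] (f : R →+* S) [IsLocalHom f] : Nontrivial S := by
  rcases subsingleton_or_nontrivial S with h | h
  · exact absurd ((isUnit_map_iff f 0).1 (isUnit_of_subsingleton _)) not_isUnit_zero
  · exact h

theorem exists_factor {f : R →+* S} (hf : Function.Surjective f) (g : R →+* T)
    (h : ∀ x, f x = 0 → g x = 0) : ∃ k : S →+* T, k.comp f = g :=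
  ⟨RingHom.liftOfSurjective f hf ⟨g, h⟩, RingHom.liftOfSurjective_comp f hf ⟨g, h⟩⟩

theorem map_le_iff {f : R →+* S} {I : TwoSidedIdeal R} {J : TwoSidedIdeal S} :
    I.map f ≤ J ↔ ∀ x ∈ I, f x ∈ J := by
  rw [TwoSidedIdeal.map, TwoSidedIdeal.span_le, Set.image_subset_iff]
  rfl

theorem mem_map {f : R →+* S} {I : TwoSidedIdeal R} {x : R} (hx : x ∈ I) : f x ∈ I.map f :=
  map_le_iff.1 le_rfl x hx

theorem map_mem_map_of_comp {f : R →+* S} {g : S →+* T} {I : TwoSidedIdeal R} {x : S}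
    (hx : x ∈ I.map f) : g x ∈ I.map (g.comp f) := by
  have : I.map f ≤ TwoSidedIdeal.comap g (I.map (g.comp f)) :=
    map_le_iff.2 fun x hx => (TwoSidedIdeal.mem_comap g).2 (mem_map (f := g.comp f) hx)
  exact (TwoSidedIdeal.mem_comap g).1 (this hx)

theorem map_map (f : R →+* S) (g : S →+* T) (I : TwoSidedIdeal R) :
    (I.map f).map g = I.map (g.comp f) :=
  le_antisymm (map_le_iff.2 fun _ hx => map_mem_map_of_comp hx)
    (map_le_iff.2 fun _ hx => mem_map (mem_map hx))

theorem map_mem_map_comp_iff {f : R →+* S} {g : S →+* T} (hg : Function.Bijective g)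
    {I : TwoSidedIdeal R} {x : S} : g x ∈ I.map (g.comp f) ↔ x ∈ I.map f := by
  refine ⟨fun h => ?_, map_mem_map_of_comp⟩
  let e := RingEquiv.ofBijective g hg
  have h' : e.symm.toRingHom (g x) ∈ I.map (e.symm.toRingHom.comp (g.comp f)) :=
    map_mem_map_of_comp h
  have e1 : e.symm.toRingHom.comp (g.comp f) = f := RingHom.ext fun y => e.symm_apply_apply _
  rw [e1] at h'
  rwa [show e.symm.toRingHom (g x) = x from e.symm_apply_apply x] at h'

theorem eq_zero_of_mem_map {f : R →+* S} {g : S →+* T} {I : TwoSidedIdeal R}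
    (h : ∀ x ∈ I, g (f x) = 0) {x : S} (hx : x ∈ I.map f) : g x = 0 := by
  have : I.map f ≤ TwoSidedIdeal.ker g :=
    map_le_iff.2 fun x hx => (TwoSidedIdeal.mem_ker (f := g)).2 (h x hx)
  exact (TwoSidedIdeal.mem_ker (f := g)).1 (this hx)

end Ideals

/-! ### The subset of `F(A)` defined by an ideal, and surjections -/

section Surjections

variable {A : Type u} [Ring A] {B : Type u} [Ring B]

/-- The set of all `𝒮` such that the ideal of `A_𝒮` generated by `I` is contained in `J(A_𝒮)`. -/
def locus (I : TwoSidedIdeal A) : Set (FullSpectrum A) :=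
  {y | ∀ x ∈ I.map y.of, IsUnit (1 + x)}

theorem mem_hatIdeal' {I : TwoSidedIdeal A} {W : Opens (TopCat.of (FullSpectrum A))}
    {t : Sec (affine A) W} : t ∈ hatIdeal I W ↔ ∀ s (hs : s ∈ W), evalAt s hs t ∈ I.map s.of :=
  Iff.rfl

variable {φ : A →+* B} (hφ : Function.Surjective φ)

include hφ in
theorem exists_toQuotient (y : FullSpectrum A) : ∃ β : B →+*
    ((TwoSidedIdeal.ker φ).map y.of).ringCon.Quotient,
      β.comp φ = (RingCon.mk' ((TwoSidedIdeal.ker φ).map y.of).ringCon).comp y.of :=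
  exists_factor hφ _ fun _ hx => (TwoSidedIdeal.mk'_eq_zero_iff _ _).2
    (mem_map ((TwoSidedIdeal.mem_ker (f := φ)).2 hx))

theorem comapLift_eq_zero (s : FullSpectrum B) {x : (comap φ s).LocAt}
    (hx : x ∈ (TwoSidedIdeal.ker φ).map (comap φ s).of) : comapLift φ s x = 0 :=
  eq_zero_of_mem_map (fun a ha => by
    rw [comapLift_of, (TwoSidedIdeal.mem_ker (f := φ)).1 ha, map_zero]) hx

theorem comap_mem_locus (s : FullSpectrum B) : comap φ s ∈ locus (TwoSidedIdeal.ker φ) := by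
  intro x hx
  rw [← isUnit_map_iff (comapLift φ s), map_add, comapLift_eq_zero s hx, map_one, add_zero]
  exact isUnit_one

include hφ in
-- For `y` in the locus, `A_y` modulo the ideal generated by `ker φ` is a nonzero ring and the
-- projection to it is local. It receives a map from `B`, whose point lies over `y`.
theorem range_comap_of_surjective : Set.range (comap φ) = locus (TwoSidedIdeal.ker φ) := by
  ext y
  constructor
  · rintro ⟨s, rfl⟩
    exact comap_mem_locus s
  · intro hy
    obtain ⟨β, hβ⟩ := exists_toQuotient hφ y
    have hloc := isLocalHom_mk' hy
    have := nontrivial_of_isLocalHom (RingCon.mk' ((TwoSidedIdeal.ker φ).map y.of).ringCon)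
    refine ⟨pt β, ?_⟩
    rw [comap_pt, hβ, pt_comp, pt_of]

include hφ in
-- With `y` the image of `s`, the map `A_y → B_s` factors through a local homomorphism `γ` on `A_y /
-- (ker φ)`. So `s` is the point of `B → A_y / (ker φ)`, which depends on `y` alone.
theorem comap_injective_of_surjective : Function.Injective (comap φ) := by
  have key : ∀ (y : FullSpectrum A) (s : FullSpectrum B), comap φ s = y →
      ∀ β : B →+* ((TwoSidedIdeal.ker φ).map y.of).ringCon.Quotient,
      β.comp φ = (RingCon.mk' ((TwoSidedIdeal.ker φ).map y.of).ringCon).comp y.of →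
      ∃ _ : Nontrivial ((TwoSidedIdeal.ker φ).map y.of).ringCon.Quotient, pt β = s := by
    rintro _ s rfl β hβ
    set q := RingCon.mk' ((TwoSidedIdeal.ker φ).map (comap φ s).of).ringCon with hq
    have hqs : Function.Surjective q := RingCon.mk'_surjective _
    obtain ⟨γ, hγ⟩ := exists_factor hqs (comapLift φ s) fun x hx =>
      comapLift_eq_zero s ((TwoSidedIdeal.mk'_eq_zero_iff _ x).1 hx)
    have hn := γ.domain_nontrivial
    have hloc : IsLocalHom γ := ⟨fun x hx => by
      obtain ⟨a, rfl⟩ := hqs x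
      rw [← RingHom.comp_apply, hγ, isUnit_map_iff] at hx
      exact hx.map q⟩
    refine ⟨hn, ?_⟩
    rw [← pt_comp β γ]
    suffices H : γ.comp β = s.of by rw [H, pt_of]
    refine RingHom.ext fun b => ?_
    obtain ⟨a, rfl⟩ := hφ b
    have := DFunLike.congr_fun hβ a
    rw [RingHom.comp_apply] at this
    rw [RingHom.comp_apply, this, ← RingHom.comp_apply, ← RingHom.comp_assoc, hγ]
    rfl
  intro s s' h
  obtain ⟨β, hβ⟩ := exists_toQuotient hφ (comap φ s)
  obtain ⟨_, h1⟩ := key _ s rfl β hβ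
  obtain ⟨_, h2⟩ := key _ s' h.symm β hβ
  exact h1.symm.trans h2

include hφ in
theorem isEmbedding_comap_of_surjective : Topology.IsEmbedding (comap φ) := by
  refine ⟨⟨le_antisymm (continuous_comap φ).le_induced ?_⟩, comap_injective_of_surjective hφ⟩
  refine le_generateFrom ?_
  rintro _ ⟨n, b, rfl⟩
  obtain ⟨a, rfl⟩ := Fraction.map_surjective hφ b
  exact ⟨FullSpectrum.D a, isOpen_D a, Set.ext fun s => comap_mem_D φ s a⟩

include hφ in
-- Vanishing on `F(B)` has to control the values of `t` also at points outside the image of `F(B)`.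
-- Locally `t` is given by `c ∈ A_𝐚`, so it suffices that `c` vanish in `A_𝐚 / (ker φ)`. If this
-- ring is nonzero, it receives a map from `B` and so defines a point of `F(B)` over `D(𝐚)`;
-- vanishing of `t` there gives the claim.
theorem mem_hatIdeal_ker_iff {W : Opens (TopCat.of (FullSpectrum A))} {t : Sec (affine A) W} :
    t ∈ hatIdeal (TwoSidedIdeal.ker φ) W ↔
      ∀ s (hs : comap φ s ∈ W), comapLift φ s (evalAt (comap φ s) hs t) = 0 := by
  rw [mem_hatIdeal']
  refine ⟨fun h s hs => comapLift_eq_zero s (h _ hs), fun h w hw => ?_⟩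
  obtain ⟨n, a, c, hwa, haW, hac⟩ := exists_fraction t hw
  obtain ⟨ψ, hψ⟩ := Fraction.exists_lift_of_mem_D hwa
  rw [hac w hw ψ hψ, ← hψ]
  refine map_mem_map_of_comp ?_
  rw [← TwoSidedIdeal.mk'_eq_zero_iff]
  set q := RingCon.mk' ((TwoSidedIdeal.ker φ).map a.of).ringCon
  rcases subsingleton_or_nontrivial ((TwoSidedIdeal.ker φ).map a.of).ringCon.Quotient with h0 | h0
  · exact Subsingleton.elim _ _
  obtain ⟨β, hβ⟩ : ∃ β : B →+* _, β.comp φ = q.comp a.of :=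
    exists_factor hφ _ fun _ hx => (TwoSidedIdeal.mk'_eq_zero_iff _ _).2
      (mem_map ((TwoSidedIdeal.mem_ker (f := φ)).2 hx))
  have hmem : comap φ (pt β) ∈ FullSpectrum.D a := by
    rw [comap_pt, hβ]
    exact (pt_mem_D _ a).2 ((Fraction.invertible_iff a _).2 ⟨q, rfl⟩)
  obtain ⟨ξ, hξ⟩ := Fraction.exists_lift_of_mem_D hmem
  have e : ((ptLift β).comp (comapLift φ (pt β))).comp ξ = q := Fraction.hom_ext a (by
    rw [RingHom.comp_assoc, hξ, RingHom.comp_assoc, comapLift_comp_of, ← RingHom.comp_assoc,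
      ptLift_comp_of, hβ])
  rw [← e, RingHom.comp_apply, RingHom.comp_apply, ← hac _ (haW hmem) ξ hξ, h _ (haW hmem),
    map_zero]

theorem locus_ker_mk' (I : TwoSidedIdeal A) :
    Set.range (comap (RingCon.mk' I.ringCon)) = locus I := by
  rw [range_comap_of_surjective (RingCon.mk'_surjective _), TwoSidedIdeal.ker_ringCon_mk']

/-- A nonempty set `Z(I) ⊆ F(A)` has a point all of whose neighbourhoods contain `Z(I)`. -/
theorem exists_least_of_locus {I : TwoSidedIdeal A} (h : (locus I).Nonempty) :
    ∃ _ : Nontrivial I.ringCon.Quotient, pt (RingCon.mk' I.ringCon) ∈ locus I ∧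
      ∀ V : Set (FullSpectrum A), IsOpen V → pt (RingCon.mk' I.ringCon) ∈ V → locus I ⊆ V := by
  rw [← locus_ker_mk'] at h ⊢
  obtain ⟨_, s, rfl⟩ := h
  have : Nontrivial I.ringCon.Quotient := s.of.domain_nontrivial
  refine ⟨this, ⟨pt (RingHom.id _), comap_pt _ _⟩, ?_⟩
  rintro V hV h _ ⟨s, rfl⟩
  exact pt_comp_mem_of_isOpen hV _ s.of h

/-- Near the least point of `Z(I)`, sections agree modulo `I` with elements of `A`. -/
theorem exists_const_mod {I : TwoSidedIdeal A} [Nontrivial I.ringCon.Quotient]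
    {W : Opens (TopCat.of (FullSpectrum A))} (hW : pt (RingCon.mk' I.ringCon) ∈ W)
    (t : Sec (affine A) W) : ∃ c : A, ∀ z (hz : z ∈ W), z ∈ locus I →
      evalAt z hz (t - const W c) ∈ I.map z.of := by
  obtain ⟨V, hVW, f, hf, hV, e⟩ := exists_ofExpression t hW
  obtain ⟨c, hc⟩ := hf.exists_const (RingCon.mk'_surjective _) hV
  refine ⟨c, fun z hz hzI => ?_⟩
  have hzV : z ∈ V := by
    obtain ⟨_, -, h⟩ := exists_least_of_locus ⟨z, hzI⟩
    exact h V V.2 hV hzI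
  have e' : evalAt z hz t = f ⟨z, hzV⟩ := DFunLike.congr_arg (evalAt z hzV) e
  obtain ⟨β, hβ⟩ := exists_factor (RingCon.mk'_surjective I.ringCon)
    ((RingCon.mk' (I.map z.of).ringCon).comp z.of) fun x hx =>
      (TwoSidedIdeal.mk'_eq_zero_iff _ _).2 (mem_map ((TwoSidedIdeal.mk'_eq_zero_iff I x).1 hx))
  have := hc ⟨z, hzV⟩ (RingCon.mk' (I.map z.of).ringCon) β hβ.symm
  rw [← TwoSidedIdeal.mk'_eq_zero_iff, map_sub, map_sub, e', this, evalAt_const,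
    ← RingHom.comp_apply, hβ]
  exact sub_self _

end Surjections

/-! ### Morphisms of affine F-schemes -/

section AffineMorphisms

variable {A : Type u} [Ring A] {B : Type u} [Ring B]

theorem IsExpression.comap {φ : A →+* B} {U : Set (FullSpectrum A)} {f : ∀ s : U, s.1.LocAt}
    (hf : IsExpression A U f) :
    IsExpression B (FSch.comap φ ⁻¹' U) (fun s => comapLift φ s.1 (f ⟨FSch.comap φ s.1, s.2⟩)) := by
  induction hf with
  | const a => exact .const (φ a)
  | neg f _ ih => simpa only [Pi.neg_apply, map_neg] using! IsExpression.neg _ ih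
  | add f g _ _ ih ih' => simpa only [Pi.add_apply, map_add] using! IsExpression.add _ _ ih ih'
  | mul f g _ _ ih ih' => simpa only [Pi.mul_apply, map_mul] using! IsExpression.mul _ _ ih ih'
  | inv f g _ hfg hgf ih =>
    refine IsExpression.inv _ _ ih (funext fun s => ?_) (funext fun s => ?_)
    · exact (map_mul (comapLift φ s.1) _ _).symm.trans
        ((congrArg _ (congrFun hfg ⟨_, s.2⟩)).trans (map_one _))
    · exact (map_mul (comapLift φ s.1) _ _).symm.trans
        ((congrArg _ (congrFun hgf ⟨_, s.2⟩)).trans (map_one _))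

variable (φ : A →+* B)

/-- Pullback of sections along `F(B) → F(A)`. -/
def comapSec (U : Opens (TopCat.of (FullSpectrum A))) :
    Sec (affine A) U →+* Sec (affine B) (U.comap ⟨comap φ, continuous_comap φ⟩) where
  toFun t := (⟨fun s => comapLift φ s.1 (evalAt (comap φ s.1) s.2 t), fun s => by
    obtain ⟨V, hV, i, hf⟩ := (show (expressions A).sections U from t).2 ⟨comap φ s.1, s.2⟩
    exact ⟨V.comap ⟨comap φ, continuous_comap φ⟩, hV, homOfLE fun x hx => i.le hx,
      IsExpression.comap hf⟩⟩ : (expressions B).sections _)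
  map_zero' := Subtype.ext (funext fun _ => (congrArg _ (map_zero (evalAt _ _))).trans (map_zero _))
  map_one' := Subtype.ext (funext fun _ => (congrArg _ (map_one (evalAt _ _))).trans (map_one _))
  map_add' t t' := Subtype.ext (funext fun _ =>
    (congrArg _ (map_add (evalAt _ _) t t')).trans (map_add _ _ _))
  map_mul' t t' := Subtype.ext (funext fun _ =>
    (congrArg _ (map_mul (evalAt _ _) t t')).trans (map_mul _ _ _))

/-- The morphism `F(B) → F(A)` induced by `φ : A → B`. -/
def comapHom : affine B ⟶ affine A :=
  InducedCategory.homMk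
    { base := TopCat.ofHom ⟨comap φ, continuous_comap φ⟩
      c := { app := fun U => RingCat.ofHom (comapSec φ U.unop)
             naturality := fun _ _ _ => rfl } }

theorem evStalk_stalkHom_comapHom (s : FullSpectrum B) (g : Stalk (affine A) (comap φ s)) :
    evStalk s (stalkHom (comapHom φ) s g) = comapLift φ s (evStalk (comap φ s) g) := by
  obtain ⟨U, -, hs, t, rfl⟩ := exists_germ (X := affine A) _ g (U := ⊤) trivial
  refine (congrArg (evStalk s) (stalkHom_germ (comapHom φ) s hs t)).trans ?_
  refine (evStalk_germ s (W := (Opens.map (comapHom φ).hom.base).obj U) hs _).trans ?_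
  exact congrArg (comapLift φ s) (evStalk_germ (comap φ s) hs t).symm

theorem isIso_of_bijective {R S : RingCat.{u}} (f : R ⟶ S) (hf : Function.Bijective f.hom) :
    IsIso f :=
  (ConcreteCategory.isIso_iff_bijective f).2 hf

theorem isOpenImmersion_comapHom_fraction {n : ℕ} (a : Fraction n A) :
    SheafedSpace.IsOpenImmersion (comapHom a.of) := by
  have : ∀ s : affine a.ring, IsIso ((comapHom a.of).hom.stalkMap s) := by
    intro s
    refine isIso_of_bijective _ ?_
    refine Function.Bijective.of_comp_left (f := evStalk (A := a.ring) s)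
      (g := stalkHom (comapHom a.of) s) ?_ (evStalk_bijective (A := a.ring) s).1
    have e : (evStalk (A := a.ring) s ∘ stalkHom (comapHom a.of) s) =
        comapLift a.of s ∘ evStalk (comap a.of s) :=
      funext fun g => evStalk_stalkHom_comapHom a.of s g
    rw [e]
    exact (comapLift_fraction_bijective a s).comp (evStalk_bijective _)
  exact SheafedSpace.IsOpenImmersion.of_stalk_iso (comapHom a.of)
    (isOpenEmbedding_comap_fraction a)

/-- The map `F(B) → F(A)` underlying a morphism. -/
def baseMap (g : affine B ⟶ affine A) (s : FullSpectrum B) : FullSpectrum A := g.hom.base s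

/-- A local morphism `F(B) → F(A)` is induced by a homomorphism `A → B`. -/
theorem exists_eq_comap [Nontrivial B] {g : affine B ⟶ affine A} (hg : IsLocalMorphism g) :
    ∃ φ : A →+* B, (∀ c, pull g ⊤ (const ⊤ c) = const (A := B) ⊤ (φ c)) ∧
      (∀ s : FullSpectrum B, baseMap g s = comap φ s) ∧
      ∀ (U : Opens (TopCat.of (FullSpectrum A))) (t : Sec (affine A) U) (s : FullSpectrum B)
        (hs : baseMap g s ∈ U) (hs' : comap φ s ∈ U),
        evalAt s (W := (Opens.map g.hom.base).obj U) hs (pull g U t) =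
          comapLift φ s (evalAt (comap φ s) hs' t) := by
  let κ : A →+* Sec (affine B) ⊤ := (pull g ⊤).comp (const (A := A) ⊤)
  -- Evaluation at the point of the identity, followed by `ptLift`, is the inverse of the
  -- identification of `B` with the global sections of `𝒪_B`.
  let φ : A →+* B := ((ptLift (RingHom.id B)).comp (evalAt (W := ⊤) (pt (RingHom.id B)) trivial)).comp κ
  have hφ : ∀ c, pull g ⊤ (const ⊤ c) = const (A := B) ⊤ (φ c) := by
    intro c
    obtain ⟨d, hd⟩ := exists_const_eq (A := B) (W := ⊤) trivial (κ c)
    have e : φ c = d := congrArg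
      (fun t => ptLift (RingHom.id B) (evalAt (W := ⊤) (pt (RingHom.id B)) trivial t)) hd
    rw [e]
    exact hd
  -- The stalk map of `g`, transported to the localizations along `evStalk`. Its locality is what
  -- forces `baseMap g s` to be the point of `s.of ∘ φ`.
  have key : ∀ s : FullSpectrum B, ∃ χ : FullSpectrum.LocAt (baseMap g s) →+* s.LocAt,
      IsLocalHom χ ∧ ∀ (U : Opens (TopCat.of (FullSpectrum A))) (t : Sec (affine A) U)
        (hs : baseMap g s ∈ U), evalAt s (W := (Opens.map g.hom.base).obj U) hs (pull g U t) =
          χ (evalAt (baseMap g s) hs t) := by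
    intro s
    let e := RingEquiv.ofBijective (evStalk (baseMap g s)) (evStalk_bijective _)
    have h1 : IsLocalHom (stalkHom g s) := isLocalHom_stalkHom hg s
    have h2 : IsLocalHom e.symm.toRingHom :=
      ⟨fun x hx => by simpa using hx.map e⟩
    have h3 : IsLocalHom ((evStalk s).comp (stalkHom g s)) :=
      @RingHom.isLocalHom_comp _ _ _ _ _ _ (evStalk s) (stalkHom g s) inferInstance h1
    refine ⟨((evStalk s).comp (stalkHom g s)).comp e.symm.toRingHom,
      @RingHom.isLocalHom_comp _ _ _ _ _ _ ((evStalk s).comp (stalkHom g s)) _ h3 h2, fun U t hs => ?_⟩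
    have e1 : e.symm (evalAt (baseMap g s) hs t) =
        germ (X := affine A) (baseMap g s) hs t := by
      rw [RingEquiv.symm_apply_eq]
      exact (evStalk_germ (A := A) (baseMap g s) hs t).symm
    refine ((congrArg (fun x => evStalk s (stalkHom g s x)) e1).trans ?_).symm
    refine (congrArg (evStalk s) (stalkHom_germ g s hs t)).trans ?_
    exact evStalk_germ s (W := (Opens.map g.hom.base).obj U) hs _
  have hof : ∀ (s : FullSpectrum B) (χ : FullSpectrum.LocAt (baseMap g s) →+* s.LocAt),
      (∀ (U : Opens (TopCat.of (FullSpectrum A))) (t : Sec (affine A) U)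
        (hs : baseMap g s ∈ U), evalAt s (W := (Opens.map g.hom.base).obj U) hs (pull g U t) =
          χ (evalAt (baseMap g s) hs t)) →
      χ.comp (FullSpectrum.of (baseMap g s)) = s.of.comp φ := by
    intro s χ hχ
    refine RingHom.ext fun c => ?_
    exact (hχ ⊤ (const ⊤ c) trivial).symm.trans
      (DFunLike.congr_arg (evalAt (W := ⊤) s trivial) (hφ c))
  have hbase : ∀ s : FullSpectrum B, baseMap g s = comap φ s := by
    intro s
    obtain ⟨χ, hχ, h⟩ := key s
    exact (pt_eq_of_isLocalHom χ (hof s χ h)).symm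
  refine ⟨φ, hφ, hbase, fun U t s hs hs' => ?_⟩
  obtain ⟨χ, hχ, h⟩ := key s
  rw [h U t hs]
  have hχ' := hof s χ h
  clear h hχ
  -- `baseMap g s` and `comap φ s` are equal only propositionally, so the point is generalized
  -- before `hom_ext` can compare the two homomorphisms.
  have gen : ∀ (y : FullSpectrum A) (hy : y ∈ U) (χ : y.LocAt →+* s.LocAt),
      y = comap φ s → χ.comp y.of = s.of.comp φ →
        χ (evalAt y hy t) = comapLift φ s (evalAt (comap φ s) hs' t) := by
    rintro _ hy χ rfl hχ
    rw [FullSpectrum.hom_ext _ (hχ.trans (comapLift_comp_of φ s).symm)]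
  exact gen _ hs χ (hbase s) hχ'

end AffineMorphisms
/-! ### Open immersions and affine charts -/

section OpenImmersions

variable {X Y Z P : NCRingedSpace.{u}}

theorem stalkHom_comp (f : X ⟶ Y) (g : Y ⟶ Z) (x : X) :
    stalkHom (f ≫ g) x = (stalkHom f x).comp (stalkHom g (f.hom.base x)) :=
  congrArg RingCat.Hom.hom (PresheafedSpace.stalkMap.comp f.hom g.hom x)

theorem germ_pull_congr {f g : X ⟶ Y} (h : f = g) {U : Opens Y} (s : Sec Y U) (x : X)
    (hx : f.hom.base x ∈ U) (hx' : g.hom.base x ∈ U) :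
    germ x (U := (Opens.map f.hom.base).obj U) hx (pull f U s) =
      germ x (U := (Opens.map g.hom.base).obj U) hx' (pull g U s) := by
  subst h; rfl

theorem base_congr {f g : X ⟶ Y} (h : f = g) (x : X) : f.hom.base x = g.hom.base x := by
  rw [h]

theorem isOpenEmbedding_base (j : P ⟶ Y) [h : SheafedSpace.IsOpenImmersion j] :
    Topology.IsOpenEmbedding j.hom.base :=
  h.base_open

theorem continuous_base (f : X ⟶ Y) : Continuous f.hom.base := f.hom.base.hom.continuous

theorem isOpen_range_base (j : P ⟶ Y) [h : SheafedSpace.IsOpenImmersion j] :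
    IsOpen (Set.range j.hom.base) :=
  h.base_open.isOpen_range

theorem bijective_of_isIso {R S : RingCat.{u}} (f : R ⟶ S) [IsIso f] : Function.Bijective f.hom :=
  (ConcreteCategory.isIso_iff_bijective f).1 inferInstance

theorem pull_bijective (j : P ⟶ Y) [h : SheafedSpace.IsOpenImmersion j] {U : Opens Y}
    (hU : (U : Set Y) ⊆ Set.range j.hom.base) : Function.Bijective (pull j U) :=
  @bijective_of_isIso _ _ _ (PresheafedSpace.IsOpenImmersion.isIso_of_subset j.hom (H := h) U hU)

theorem stalkHom_bijective (j : P ⟶ Y) [SheafedSpace.IsOpenImmersion j] (x : P) :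
    Function.Bijective (stalkHom j x) :=
  bijective_of_isIso (j.hom.stalkMap x)

theorem exists_lift (j : P ⟶ Y) [h : SheafedSpace.IsOpenImmersion j] (f : X ⟶ Y)
    (hf : Set.range f.hom.base ⊆ Set.range j.hom.base) : ∃ l : X ⟶ P, l ≫ j = f :=
  ⟨InducedCategory.homMk (@PresheafedSpace.IsOpenImmersion.lift _ _ _ _ _ j.hom h f.hom hf),
    InducedCategory.hom_ext (@PresheafedSpace.IsOpenImmersion.lift_fac _ _ _ _ _ j.hom h f.hom hf)⟩

theorem isOpenImmersion_of_comp (l : X ⟶ P) (j : P ⟶ Y) [SheafedSpace.IsOpenImmersion j]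
    [SheafedSpace.IsOpenImmersion (l ≫ j)] : SheafedSpace.IsOpenImmersion l := by
  have : ∀ x : X, IsIso (l.hom.stalkMap x) := by
    intro x
    refine isIso_of_bijective _ ?_
    have h := stalkHom_bijective (l ≫ j) x
    rw [stalkHom_comp] at h
    exact (Function.Bijective.of_comp_iff (stalkHom l x) (stalkHom_bijective j _)).1 h
  exact SheafedSpace.IsOpenImmersion.of_stalk_iso l
    (Topology.IsOpenEmbedding.of_comp l.hom.base (isOpenEmbedding_base j)
      (isOpenEmbedding_base (l ≫ j)))

theorem IsLocalMorphism.comp {f : X ⟶ Y} {g : Y ⟶ Z} (hf : IsLocalMorphism f)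
    (hg : IsLocalMorphism g) : IsLocalMorphism (f ≫ g) := by
  intro x
  change IsLocalHom (stalkHom (f ≫ g) x)
  rw [stalkHom_comp]
  exact @RingHom.isLocalHom_comp _ _ _ _ _ _ (stalkHom f x) _ (hf x) (hg (f.hom.base x))

theorem isLocalMorphism_of_isOpenImmersion (j : P ⟶ Y) [SheafedSpace.IsOpenImmersion j] :
    IsLocalMorphism j := fun x =>
  ⟨fun a ha => by
    let e := RingEquiv.ofBijective (stalkHom j x) (stalkHom_bijective j x)
    have h : IsUnit (e a) := ha
    simpa using h.map e.symm⟩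

theorem IsLocalMorphism.of_comp {l : X ⟶ P} {j : P ⟶ Y} [SheafedSpace.IsOpenImmersion j]
    (h : IsLocalMorphism (l ≫ j)) : IsLocalMorphism l := by
  intro x
  refine ⟨fun a ha => ?_⟩
  obtain ⟨b, rfl⟩ := (stalkHom_bijective j (l.hom.base x)).2 a
  have h' := h x
  change IsLocalHom (stalkHom (l ≫ j) x) at h'
  rw [stalkHom_comp] at h'
  exact (h'.map_nonunit b ha).map (stalkHom j (l.hom.base x))

/-- Sections over an open set contained in the range of an open immersion `j` are equal if their
pullbacks are. -/
theorem pull_eq_zero_iff (j : P ⟶ Y) [SheafedSpace.IsOpenImmersion j] {U : Opens Y}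
    (hU : (U : Set Y) ⊆ Set.range j.hom.base) {s : Sec Y U} : pull j U s = 0 ↔ s = 0 :=
  map_eq_zero_iff (pull j U) (pull_bijective j hU).1

end OpenImmersions

/-! ### Affine charts and their shrinking by fractions -/

section Charts

variable {X Y : NCRingedSpace.{u}}

/-- Every neighbourhood of every point of `X` contains a neighbourhood isomorphic to some `F(A)`. -/
def HasCharts (X : NCRingedSpace.{u}) : Prop :=
  ∀ (x : X) (U : Opens X), x ∈ U → ∃ (A : Type u) (_ : Ring A) (j : affine A ⟶ X),
    SheafedSpace.IsOpenImmersion j ∧ x ∈ Set.range j.hom.base ∧ Set.range j.hom.base ⊆ U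

theorem exists_fraction_chart {A : Type u} [Ring A] (j : affine A ⟶ X)
    [SheafedSpace.IsOpenImmersion j] {x : X} (hx : x ∈ Set.range j.hom.base) {U : Opens X}
    (hU : x ∈ U) : ∃ (n : ℕ) (a : Fraction n A),
      x ∈ Set.range (comapHom a.of ≫ j).hom.base ∧
      Set.range (comapHom a.of ≫ j).hom.base ⊆ U := by
  obtain ⟨s, rfl⟩ := hx
  obtain ⟨n, a, ha, haU⟩ := exists_D_subset (A := A) (U := j.hom.base ⁻¹' U)
    (U.2.preimage (continuous_base j)) (s := s) hU
  refine ⟨n, a, ?_, ?_⟩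
  · rw [← range_comap_fraction] at ha
    obtain ⟨s', hs'⟩ := ha
    exact ⟨s', congrArg j.hom.base hs'⟩
  · rintro _ ⟨s', rfl⟩
    exact haU (comap_fraction_mem_D a s')

theorem IsFScheme.hasCharts (hX : IsFScheme X) : HasCharts X := by
  intro x U hU
  obtain ⟨V, hV, A, _, ⟨e⟩⟩ := hX x
  have h2 : SheafedSpace.IsOpenImmersion (X.ofRestrict V.isOpenEmbedding) := inferInstance
  have h1 : SheafedSpace.IsOpenImmersion (e.inv ≫ X.ofRestrict V.isOpenEmbedding) := inferInstance
  have hx : x ∈ Set.range (e.inv ≫ X.ofRestrict V.isOpenEmbedding).hom.base := by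
    refine ⟨e.hom.hom.base ⟨x, hV⟩, ?_⟩
    have := base_congr (f := e.hom ≫ e.inv ≫ X.ofRestrict V.isOpenEmbedding)
      (g := X.ofRestrict V.isOpenEmbedding) (by simp) ⟨x, hV⟩
    exact this
  obtain ⟨n, a, hxa, haU⟩ := exists_fraction_chart _ hx hU
  have := isOpenImmersion_comapHom_fraction a
  exact ⟨a.ring, inferInstance, _, inferInstance, hxa, haU⟩

theorem HasCharts.of_isOpenImmersion {P : NCRingedSpace.{u}} (hX : HasCharts X) (o : P ⟶ X)
    [SheafedSpace.IsOpenImmersion o] : HasCharts P := by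
  intro p U hU
  obtain ⟨A, _, j, hj, hpj, hjU⟩ := hX (o.hom.base p)
    ⟨o.hom.base '' U, (isOpenEmbedding_base o).isOpenMap _ U.2⟩ ⟨p, hU, rfl⟩
  obtain ⟨l, rfl⟩ := exists_lift o j (hjU.trans (Set.image_subset_range _ _))
  refine ⟨A, _, l, isOpenImmersion_of_comp l o, ?_, ?_⟩
  · obtain ⟨s, hs⟩ := hpj
    exact ⟨s, (isOpenEmbedding_base o).injective hs⟩
  · rintro _ ⟨s, rfl⟩
    obtain ⟨q, hq, e⟩ := hjU ⟨s, rfl⟩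
    have e' : q = l.hom.base s := (isOpenEmbedding_base o).injective e
    rwa [← e']

/-- On the range of `j : F(A) → X`, the sheaf of ideals `𝓘` corresponds to the ideal `I` of `A`. -/
def Represents {A : Type u} [Ring A] (j : affine A ⟶ X) (𝓘 : IdealSheaf X) (I : TwoSidedIdeal A) :
    Prop :=
  ∀ W : Opens X, (W : Set X) ⊆ Set.range j.hom.base → ∀ t : Sec X W, t ∈ 𝓘.ideal W ↔
    pull j W t ∈ hatIdeal I ((Opens.map j.hom.base).obj W)

/-- Local rings do not change on passing from `D(𝐚)` to `F(A_𝐚)`, hence neither do the ideals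
generated in them. So charts representing a quasi-coherent ideal sheaf can be made arbitrarily
small. -/
theorem mem_hatIdeal_fraction {A : Type u} [Ring A] {n : ℕ} (a : Fraction n A)
    (I : TwoSidedIdeal A) {W : Opens (TopCat.of (FullSpectrum A))}
    (hW : (W : Set (FullSpectrum A)) ⊆ FullSpectrum.D a) (t : Sec (affine A) W) :
    t ∈ hatIdeal I W ↔ pull (comapHom a.of) W t ∈ hatIdeal (I.map a.of)
      ((Opens.map (comapHom a.of).hom.base).obj W) := by
  have key : ∀ (s : FullSpectrum a.ring) (hs : comap a.of s ∈ W),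
      evalAt s (W := (Opens.map (comapHom a.of).hom.base).obj W) hs (pull (comapHom a.of) W t) ∈
        (I.map a.of).map s.of ↔ evalAt (comap a.of s) hs t ∈ I.map (comap a.of s).of := by
    intro s hs
    rw [map_map, ← comapLift_comp_of]
    exact map_mem_map_comp_iff (comapLift_fraction_bijective a s)
  refine ⟨fun h s hs => (key s hs).2 (h _ hs), fun h y hy => ?_⟩
  obtain ⟨s, rfl⟩ : y ∈ Set.range (comap a.of) := by
    rw [range_comap_fraction]
    exact hW hy
  exact (key s hy).1 (h s hy)

theorem IdealSheaf.QuasiCoherent.exists_chart {𝓘 : IdealSheaf X} (h𝓘 : 𝓘.QuasiCoherent) {x : X}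
    {U : Opens X} (hU : x ∈ U) : ∃ (A : Type u) (_ : Ring A) (j : affine A ⟶ X),
      SheafedSpace.IsOpenImmersion j ∧ x ∈ Set.range j.hom.base ∧ Set.range j.hom.base ⊆ U ∧
        ∃ I : TwoSidedIdeal A, Represents j 𝓘 I := by
  obtain ⟨A, _, j, hj, hx, I, hI⟩ := h𝓘 x
  obtain ⟨n, a, hxa, haU⟩ := exists_fraction_chart j hx hU
  have := isOpenImmersion_comapHom_fraction a
  refine ⟨a.ring, inferInstance, _, inferInstance, hxa, haU, I.map a.of, fun W hW t => ?_⟩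
  refine (hI W (hW.trans ?_) t).trans (mem_hatIdeal_fraction a I ?_ (pull j W t))
  · rintro _ ⟨s, rfl⟩
    exact ⟨_, rfl⟩
  · intro y hy
    obtain ⟨s, hs⟩ := hW hy
    rw [← (isOpenEmbedding_base j).injective hs]
    exact comap_fraction_mem_D a s

end Charts
/-! ### The kernel of a morphism and closed immersions -/

section Kernel

variable {X Y : NCRingedSpace.{u}}

theorem hom_ext_germ {f g : X ⟶ Y} (hb : f.hom.base = g.hom.base)
    (h : ∀ (U : Opens Y) (s : Sec Y U) (x : X) (hx : f.hom.base x ∈ U) (hx' : g.hom.base x ∈ U),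
      germ x (U := (Opens.map f.hom.base).obj U) hx (pull f U s) =
        germ x (U := (Opens.map g.hom.base).obj U) hx' (pull g U s)) : f = g := by
  obtain ⟨⟨fb, fc⟩⟩ := f
  obtain ⟨⟨gb, gc⟩⟩ := g
  obtain rfl : fb = gb := hb
  suffices H : fc = gc by rw [H]
  refine NatTrans.ext (funext fun U => RingCat.hom_ext (RingHom.ext fun s => ?_))
  exact section_ext (X := X) (U := (Opens.map fb).obj U.unop) fun x hx => h U.unop s x hx hx

/-- A family of germs which locally comes from sections comes from a section. -/
theorem exists_section_of_germs {U : Opens X} (g : ∀ x : U, Stalk X x.1)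
    (h : ∀ x : U, ∃ (V : Opens X) (hVU : V ≤ U) (s : Sec X V), x.1 ∈ V ∧
      ∀ y (hy : y ∈ V), germ y hy s = g ⟨y, hVU hy⟩) :
    ∃ u : Sec X U, ∀ x (hx : x ∈ U), germ x hx u = g ⟨x, hx⟩ := by
  choose V hVU s hxV hs using h
  obtain ⟨u, hu, -⟩ := TopCat.Sheaf.existsUnique_gluing' X.sheaf V U (fun x => homOfLE (hVU x))
    (fun x hx => Opens.mem_iSup.2 ⟨⟨x, hx⟩, hxV ⟨x, hx⟩⟩) s (fun x y => by
      refine section_ext (X := X) (U := V x ⊓ V y) fun z hz => ?_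
      exact (germ_res inf_le_left z hz (s x)).trans ((hs x z hz.1).trans
        ((hs y z hz.2).symm.trans (germ_res inf_le_right z hz (s y)).symm)))
  refine ⟨u, fun x hx => ?_⟩
  have e : res (hVU ⟨x, hx⟩) u = s ⟨x, hx⟩ := hu ⟨x, hx⟩
  exact (germ_res (hVU ⟨x, hx⟩) x (hxV _) u).symm.trans
    ((congrArg (germ x (hxV ⟨x, hx⟩)) e).trans (hs ⟨x, hx⟩ x (hxV _)))

theorem isLocallySurjective_iff (f : X ⟶ Y) : TopCat.Presheaf.IsLocallySurjective f.hom.c ↔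
    ∀ (U : Opens Y) (t : Sec X ((Opens.map f.hom.base).obj U)) (y : Y), y ∈ U →
      ∃ (V : Opens Y) (hVU : V ≤ U) (s : Sec Y V), y ∈ V ∧
        pull f V s = res (U := (Opens.map f.hom.base).obj U) (V := (Opens.map f.hom.base).obj V)
          (fun _ hx => hVU hx) t := by
  rw [TopCat.Presheaf.isLocallySurjective_iff]
  constructor
  · intro h U t y hy
    obtain ⟨V, hVU, ⟨s, hs⟩, hyV⟩ := h U t y hy
    exact ⟨V, hVU, s, hyV, hs⟩
  · intro h U t y hy
    obtain ⟨V, hVU, s, hyV, hs⟩ := h U t y hy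
    exact ⟨V, hVU, ⟨s, hs⟩, hyV⟩

variable (f : X ⟶ Y)

/-- The kernel of `𝒪_Y → f_* 𝒪_X`. -/
def kerSheaf : IdealSheaf Y where
  ideal U := TwoSidedIdeal.ker (pull f U)
  res_mem {U V} h s hs := by
    refine (TwoSidedIdeal.mem_ker (f := pull f V)).2 ?_
    refine (pull_res f h s).trans ?_
    rw [(TwoSidedIdeal.mem_ker (f := pull f U)).1 hs, map_zero]
  glue U s h := by
    refine (TwoSidedIdeal.mem_ker (f := pull f U)).2 ?_
    refine section_ext (X := X) (U := (Opens.map f.hom.base).obj U) fun x hx => ?_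
    obtain ⟨V, hVU, hxV, hs⟩ := h (f.hom.base x) hx
    have e := (pull_res f hVU s).symm.trans ((TwoSidedIdeal.mem_ker (f := pull f V)).1 hs)
    rw [map_zero, ← germ_res (X := X) (U := (Opens.map f.hom.base).obj U)
      (V := (Opens.map f.hom.base).obj V) (fun _ hx => hVU hx) x hxV, e, map_zero]

theorem mem_kerSheaf {U : Opens Y} {s : Sec Y U} :
    s ∈ (kerSheaf f).ideal U ↔ pull f U s = 0 :=
  TwoSidedIdeal.mem_ker (f := pull f U)

theorem _root_.FSch.IdealSheaf.germ_mem_stalk (𝓘 : IdealSheaf Y) {U : Opens Y} {s : Sec Y U}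
    (hs : s ∈ 𝓘.ideal U) (y : Y) (hy : y ∈ U) : germ y hy s ∈ 𝓘.stalk y :=
  TwoSidedIdeal.subset_span ⟨U, hy, s, hs, rfl⟩

theorem stalkHom_eq_zero_of_mem (x : X) {g : Stalk Y (f.hom.base x)}
    (hg : g ∈ (kerSheaf f).stalk (f.hom.base x)) : stalkHom f x g = 0 := by
  have : (kerSheaf f).stalk (f.hom.base x) ≤ TwoSidedIdeal.ker (stalkHom f x) := by
    rw [IdealSheaf.stalk, TwoSidedIdeal.span_le]
    rintro _ ⟨U, hx, t, ht, rfl⟩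
    refine (TwoSidedIdeal.mem_ker (f := stalkHom f x)).2 ?_
    refine (stalkHom_germ f x hx t).trans ?_
    rw [(mem_kerSheaf f).1 ht, map_zero]
  exact (TwoSidedIdeal.mem_ker (f := stalkHom f x)).1 (this hg)

/-- The homomorphism `𝒪_{Y,f(x)} / 𝓘_{f(x)} → 𝒪_{X,x}` for the kernel `𝓘` of `f`. -/
def quotStalkHom (x : X) : (kerSheaf f).QuotStalk (f.hom.base x) →+* Stalk X x :=
  RingCon.lift _ (stalkHom f x) fun a b h => by
    have := stalkHom_eq_zero_of_mem f x ((TwoSidedIdeal.rel_iff _ a b).1 h)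
    rwa [map_sub, sub_eq_zero] at this

theorem quotStalkHom_mk' (x : X) (g : Stalk Y (f.hom.base x)) :
    quotStalkHom f x (RingCon.mk' _ g) = stalkHom f x g := rfl

theorem quotStalkHom_quotGerm (x : X) {U : Opens Y} (hx : f.hom.base x ∈ U) (s : Sec Y U) :
    quotStalkHom f x ((kerSheaf f).quotGerm U (f.hom.base x) hx s) =
      germ x (U := (Opens.map f.hom.base).obj U) hx (pull f U s) :=
  stalkHom_germ f x hx s

variable {f}

/-- A section of `𝒪_Y` whose pullback vanishes near `x` vanishes on some `f⁻¹(V')` with `V'` open in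
`Y`, the topology of `X` being induced; over `V'` it belongs to the kernel. -/
theorem quotStalkHom_injective (hf : Topology.IsEmbedding f.hom.base) (x : X) :
    Function.Injective (quotStalkHom f x) := by
  rw [injective_iff_map_eq_zero]
  intro a ha
  obtain ⟨g, rfl⟩ := RingCon.mk'_surjective _ a
  rw [quotStalkHom_mk'] at ha
  obtain ⟨U, -, hU, s, rfl⟩ := exists_germ (f.hom.base x) g (U := ⊤) trivial
  rw [stalkHom_germ, ← map_zero (germ (X := X) (U := (Opens.map f.hom.base).obj U) x hU)] at ha
  obtain ⟨W, hWU, hWU', hxW, e⟩ := exists_res_eq (X := X) (U := (Opens.map f.hom.base).obj U)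
    (V := (Opens.map f.hom.base).obj U) hU hU ha
  obtain ⟨V, hV, hVW⟩ := hf.isInducing.isOpen_iff.1 W.2
  let V' : Opens Y := ⟨V, hV⟩ ⊓ U
  have hxV : f.hom.base x ∈ V' := ⟨by
    have : x ∈ f.hom.base ⁻¹' V := by rw [hVW]; exact hxW
    exact this, hU⟩
  refine (TwoSidedIdeal.mk'_eq_zero_iff _ _).2 ?_
  rw [← germ_res (V := V') inf_le_right (f.hom.base x) hxV]
  refine (kerSheaf f).germ_mem_stalk ((mem_kerSheaf f).2 ?_) _ hxV
  rw [pull_res]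
  refine section_ext (X := X) (U := (Opens.map f.hom.base).obj V') fun y hy => ?_
  have hyW : y ∈ W := by
    have : y ∈ f.hom.base ⁻¹' V := hy.1
    rwa [hVW] at this
  refine (germ_res (X := X) (U := (Opens.map f.hom.base).obj U) _ y hy _).trans ?_
  rw [← germ_res (X := X) (U := (Opens.map f.hom.base).obj U) hWU y hyW, e, map_zero,
    map_zero, map_zero]

/-! ### The isomorphism from the source onto the zero locus of the kernel -/

section Iso

variable (hf : Topology.IsEmbedding f.hom.base)
  (hr : Set.range f.hom.base = (kerSheaf f).zeroLocus)

/-- The homeomorphism from `X` to the zero locus of the kernel. -/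
def homeoZeroLocus : X ≃ₜ (kerSheaf f).zeroLocus :=
  hf.toHomeomorph.trans (Homeomorph.setCongr hr)

/-- The continuous map from `X` to the zero locus of the kernel. -/
def toZeroLocus : X.carrier ⟶ (kerSheaf f).closedSub.carrier :=
  (TopCat.isoOfHomeo (Y := TopCat.of (kerSheaf f).zeroLocus) (homeoZeroLocus hf hr)).hom

instance : IsIso (toZeroLocus hf hr) := by
  unfold toZeroLocus
  exact inferInstanceAs (IsIso
    (TopCat.isoOfHomeo (Y := TopCat.of (kerSheaf f).zeroLocus) (homeoZeroLocus hf hr)).hom)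

/-- The value of a section of `𝒪_Y/𝓘` on `Z(𝓘)` at the image of a point of `X`. -/
def valueAt {V : Opens (kerSheaf f).closedSub} (x : X) (hx : toZeroLocus hf hr x ∈ V) :
    Sec (kerSheaf f).closedSub V →+* (kerSheaf f).QuotStalk (f.hom.base x) :=
  (Pi.evalRingHom (fun z : V => (kerSheaf f).QuotStalk z.1.1) ⟨toZeroLocus hf hr x, hx⟩).comp
    ((kerSheaf f).quotSections.sections V).subtype

theorem valueAt_ext {V : Opens (kerSheaf f).closedSub} {t t' : Sec (kerSheaf f).closedSub V}
    (h : ∀ x (hx : toZeroLocus hf hr x ∈ V), valueAt hf hr x hx t = valueAt hf hr x hx t') :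
    t = t' := by
  refine Subtype.ext (funext fun z => ?_)
  obtain ⟨z, hz⟩ := z
  obtain ⟨x, rfl⟩ := (homeoZeroLocus hf hr).surjective z
  exact h x hz

theorem exists_valueAt_eq {V : Opens (kerSheaf f).closedSub} (t : Sec (kerSheaf f).closedSub V)
    (x : X) (hx : toZeroLocus hf hr x ∈ V) :
    ∃ (V' : Opens (kerSheaf f).closedSub) (hV : V' ≤ V) (U : Opens Y)
      (hU : ∀ y, toZeroLocus hf hr y ∈ V' → f.hom.base y ∈ U) (s : Sec Y U),
      toZeroLocus hf hr x ∈ V' ∧ ∀ y (hy : toZeroLocus hf hr y ∈ V'),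
        valueAt hf hr y (hV hy) t = (kerSheaf f).quotGerm U (f.hom.base y) (hU y hy) s := by
  obtain ⟨V', hV', i, U, hU, s, hs⟩ :=
    (show (kerSheaf f).quotSections.sections V from t).2 ⟨toZeroLocus hf hr x, hx⟩
  exact ⟨V', i.le, U, fun y hy => hU ⟨_, hy⟩, s, hV', fun y hy => hs ⟨_, hy⟩⟩

theorem exists_pullZero {V : Opens (kerSheaf f).closedSub} (t : Sec (kerSheaf f).closedSub V) :
    ∃ u : Sec X ((Opens.map (toZeroLocus hf hr)).obj V),
      ∀ x (hx : toZeroLocus hf hr x ∈ V),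
        germ (U := (Opens.map (toZeroLocus hf hr)).obj V) x hx u =
          quotStalkHom f x (valueAt hf hr x hx t) := by
  refine exists_section_of_germs (X := X) (U := (Opens.map (toZeroLocus hf hr)).obj V)
    (fun x => quotStalkHom f x.1 (valueAt hf hr x.1 x.2 t)) fun x => ?_
  obtain ⟨V', hV, U, hU, s, hxV, h⟩ := exists_valueAt_eq hf hr t x.1 x.2
  refine ⟨(Opens.map (toZeroLocus hf hr)).obj V', fun y hy => hV hy,
    res (X := X) (U := (Opens.map f.hom.base).obj U) (fun y hy => hU y hy) (pull f U s), hxV,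
    fun y hy => ?_⟩
  refine (germ_res (X := X) (U := (Opens.map f.hom.base).obj U) _ y hy _).trans ?_
  exact (quotStalkHom_quotGerm f y (hU y hy) s).symm.trans
    (congrArg (quotStalkHom f y) (h y hy).symm)

/-- The homomorphism from sections of `𝒪_Y/𝓘` on `Z(𝓘)` to sections of `𝒪_X`. -/
def pullZero (V : Opens (kerSheaf f).closedSub) :
    Sec (kerSheaf f).closedSub V →+* Sec X ((Opens.map (toZeroLocus hf hr)).obj V) where
  toFun t := (exists_pullZero hf hr t).choose
  map_zero' := section_ext (X := X) fun x hx => by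
    rw [(exists_pullZero hf hr _).choose_spec x hx, map_zero, map_zero, map_zero]
  map_one' := section_ext (X := X) fun x hx => by
    rw [(exists_pullZero hf hr _).choose_spec x hx, map_one, map_one, map_one]
  map_add' t t' := section_ext (X := X) fun x hx => by
    rw [(exists_pullZero hf hr _).choose_spec x hx, map_add, map_add, map_add,
      (exists_pullZero hf hr _).choose_spec x hx, (exists_pullZero hf hr _).choose_spec x hx]
  map_mul' t t' := section_ext (X := X) fun x hx => by
    rw [(exists_pullZero hf hr _).choose_spec x hx, map_mul, map_mul, map_mul,
      (exists_pullZero hf hr _).choose_spec x hx, (exists_pullZero hf hr _).choose_spec x hx]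

theorem germ_pullZero {V : Opens (kerSheaf f).closedSub} (t : Sec (kerSheaf f).closedSub V) (x : X)
    (hx : toZeroLocus hf hr x ∈ V) :
    germ (U := (Opens.map (toZeroLocus hf hr)).obj V) x hx (pullZero hf hr V t) =
      quotStalkHom f x (valueAt hf hr x hx t) :=
  (exists_pullZero hf hr t).choose_spec x hx

/-- The morphism `X → (Z(𝓘), 𝒪_Y/𝓘)` for the kernel `𝓘`. -/
def toClosedSub : X ⟶ (kerSheaf f).closedSub :=
  InducedCategory.homMk
    { base := toZeroLocus hf hr
      c := { app := fun V => RingCat.ofHom (pullZero hf hr V.unop)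
             naturality := fun V V' i => by
              refine RingCat.hom_ext (RingHom.ext fun t => ?_)
              refine section_ext (X := X) (U := (Opens.map (toZeroLocus hf hr)).obj V'.unop)
                fun x hx => ?_
              refine (germ_pullZero hf hr _ x hx).trans ?_
              refine ((germ_pullZero hf hr t x (i.unop.le hx)).symm).trans ?_
              exact (germ_res (X := X) (U := (Opens.map (toZeroLocus hf hr)).obj V.unop)
                (V := (Opens.map (toZeroLocus hf hr)).obj V'.unop) (fun _ h => i.unop.le h) x hx
                (pullZero hf hr V.unop t)).symm } }

theorem toClosedSub_comp : toClosedSub hf hr ≫ (kerSheaf f).closedSubι = f := by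
  refine hom_ext_germ rfl fun U s x hx hx' => ?_
  exact (germ_pullZero hf hr (V := (Opens.map (kerSheaf f).closedSubι.hom.base).obj U)
    (pull (kerSheaf f).closedSubι U s) x hx).trans (quotStalkHom_quotGerm f x hx' s)

/-- Injectivity is checked on quotient stalks. For surjectivity, a section of `𝒪_X` is lifted
locally to `Y`; the lifts agree modulo the kernel by `quotStalkHom_injective`, so they define one
section of the quotient sheaf. -/
theorem pullZero_bijective (hs : TopCat.Presheaf.IsLocallySurjective f.hom.c)
    (V : Opens (kerSheaf f).closedSub) : Function.Bijective (pullZero hf hr V) := by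
  constructor
  · intro t t' h
    refine valueAt_ext hf hr fun x hx => quotStalkHom_injective hf x ?_
    rw [← germ_pullZero, ← germ_pullZero, h]
  · intro u
    have loc : ∀ z : V, ∃ (U : Opens Y) (hz : z.1.1 ∈ U) (s : Sec Y U),
        ∀ x (hx : toZeroLocus hf hr x ∈ V) (hxU : f.hom.base x ∈ U),
          germ x (U := (Opens.map f.hom.base).obj U) hxU (pull f U s) =
            germ (U := (Opens.map (toZeroLocus hf hr)).obj V) x hx u := by
      intro z
      obtain ⟨V₀, hV₀, e⟩ : ∃ V₀ : Set Y, IsOpen V₀ ∧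
          (Subtype.val : (kerSheaf f).zeroLocus → Y) ⁻¹' V₀ = V.1 := isOpen_induced_iff.1 V.2
      have he : ∀ x, f.hom.base x ∈ V₀ → toZeroLocus hf hr x ∈ V := fun x hx => by
        change homeoZeroLocus hf hr x ∈ V.1
        rw [← e]; exact hx
      obtain ⟨U, hU, s, hz, h⟩ := (isLocallySurjective_iff f).1 hs ⟨V₀, hV₀⟩
        (res (X := X) (U := (Opens.map (toZeroLocus hf hr)).obj V)
          (V := (Opens.map f.hom.base).obj ⟨V₀, hV₀⟩) he u) z.1.1
        (by have : z.1 ∈ V.1 := z.2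
            rw [← e] at this; exact this)
      refine ⟨U, hz, s, fun x hx hxU => ?_⟩
      rw [h]
      exact (germ_res (X := X) _ x _ _).trans (germ_res (X := X) _ x _ _)
    choose U hz s h using loc
    let t : ∀ z : V, (kerSheaf f).QuotStalk z.1.1 := fun z =>
      (kerSheaf f).quotGerm (U z) z.1.1 (hz z) (s z)
    have ht : ∀ (z : V) (z' : V) (hz' : z'.1.1 ∈ U z),
        t z' = (kerSheaf f).quotGerm (U z) z'.1.1 hz' (s z) := by
      rintro z ⟨z', hz'V⟩ hz'
      obtain ⟨x, rfl⟩ := (homeoZeroLocus hf hr).surjective z'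
      refine quotStalkHom_injective hf x ?_
      refine (quotStalkHom_quotGerm f x _ _).trans ?_
      refine Eq.trans ?_ (quotStalkHom_quotGerm f x hz' _).symm
      exact (h _ x hz'V _).trans (h z x hz'V hz').symm
    have htV : t ∈ (kerSheaf f).quotSections.sections V := by
      intro z
      refine ⟨V ⊓ (Opens.map (kerSheaf f).closedSubι.hom.base).obj (U z), ⟨z.2, hz z⟩,
        homOfLE inf_le_left, U z, fun z' => z'.2.2, s z, fun z' => ?_⟩
      exact ht z ⟨z'.1, z'.2.1⟩ z'.2.2
    refine ⟨(⟨t, htV⟩ : (kerSheaf f).quotSections.sections V), ?_⟩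
    refine section_ext (X := X) (U := (Opens.map (toZeroLocus hf hr)).obj V) fun x hx => ?_
    refine (germ_pullZero hf hr _ x hx).trans ?_
    exact (quotStalkHom_quotGerm f x _ _).trans (h _ x hx _)

/-- An embedding with locally surjective homomorphism of sheaves, onto the zero locus of its
kernel, is a closed immersion if the kernel is quasi-coherent. -/
theorem isClosedImmersion_of_ker (hf : Topology.IsEmbedding f.hom.base)
    (hr : Set.range f.hom.base = (kerSheaf f).zeroLocus)
    (hs : TopCat.Presheaf.IsLocallySurjective f.hom.c)
    (hq : (kerSheaf f).QuasiCoherent) : IsClosedImmersion f := by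
  have h1 : IsIso (toClosedSub hf hr).hom.base := inferInstanceAs (IsIso (toZeroLocus hf hr))
  have h2 : IsIso (toClosedSub hf hr).hom.c := by
    rw [NatTrans.isIso_iff_isIso_app]
    exact fun V => isIso_of_bijective _ (pullZero_bijective hf hr hs V.unop)
  have h3 : IsIso (toClosedSub hf hr).hom := PresheafedSpace.isIso_of_components _
  refine ⟨kerSheaf f, hq, SheafedSpace.isoMk (asIso (toClosedSub hf hr).hom), ?_⟩
  exact (toClosedSub_comp hf hr).symm

end Iso

end Kernel
/-! ### Closed immersions and affine charts -/

section ChartValues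

variable {X Y : NCRingedSpace.{u}} {A : Type u} [Ring A] {B : Type u} [Ring B]

/-- The range of an open immersion. -/
def rangeOpens {P : NCRingedSpace.{u}} (j : P ⟶ X) [SheafedSpace.IsOpenImmersion j] : Opens X :=
  ⟨Set.range j.hom.base, isOpen_range_base j⟩

theorem evalAt_pull_congr {f g : affine A ⟶ X} (h : f = g) {U : Opens X} (t : Sec X U)
    (s : FullSpectrum A) (hs : f.hom.base s ∈ U) (hs' : g.hom.base s ∈ U) :
    evalAt s (W := (Opens.map f.hom.base).obj U) hs (pull f U t) =
      evalAt s (W := (Opens.map g.hom.base).obj U) hs' (pull g U t) := by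
  subst h; rfl

theorem evalAt_pull_res (j : affine A ⟶ X) {U V : Opens X} (h : V ≤ U) (t : Sec X U)
    (s : FullSpectrum A) (hs : j.hom.base s ∈ V) :
    evalAt s (W := (Opens.map j.hom.base).obj V) hs (pull j V (res h t)) =
      evalAt s (W := (Opens.map j.hom.base).obj U) (h hs) (pull j U t) := by
  rw [pull_res]
  rfl

/-- The value of a germ at a point of an affine chart. -/
def chartEval (j : affine A ⟶ X) (s : FullSpectrum A) : Stalk X (j.hom.base s) →+* s.LocAt :=
  (evStalk s).comp (stalkHom j s)

theorem chartEval_germ (j : affine A ⟶ X) (s : FullSpectrum A) {U : Opens X}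
    (hs : j.hom.base s ∈ U) (t : Sec X U) : chartEval j s (germ (j.hom.base s) hs t) =
      evalAt s (W := (Opens.map j.hom.base).obj U) hs (pull j U t) :=
  (congrArg (evStalk s) (stalkHom_germ j s hs t)).trans
    (evStalk_germ s (W := (Opens.map j.hom.base).obj U) hs _)

theorem chartEval_bijective (j : affine A ⟶ X) [SheafedSpace.IsOpenImmersion j]
    (s : FullSpectrum A) : Function.Bijective (chartEval j s) :=
  (evStalk_bijective s).comp (stalkHom_bijective j s)

/-- The section on the range of a chart defined by an element of `A`. -/
theorem exists_const_section (j : affine A ⟶ X) [SheafedSpace.IsOpenImmersion j] (c : A) :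
    ∃ t : Sec X (rangeOpens j),
      pull j (rangeOpens j) t = const (A := A) ((Opens.map j.hom.base).obj (rangeOpens j)) c :=
  (pull_bijective j (U := rangeOpens j) subset_rfl).2 _

/-- For the converse direction, elements of `I` are constant sections of `𝓘` over the whole chart,
so their germs generate the ideal of `A_𝒮`. -/
theorem Represents.mem_stalk_iff {j : affine A ⟶ X} [SheafedSpace.IsOpenImmersion j]
    {𝓘 : IdealSheaf X} {I : TwoSidedIdeal A} (h : Represents j 𝓘 I) (s : FullSpectrum A)
    (g : Stalk X (j.hom.base s)) : g ∈ 𝓘.stalk (j.hom.base s) ↔ chartEval j s g ∈ I.map s.of := by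
  have h1 : 𝓘.stalk (j.hom.base s) ≤ TwoSidedIdeal.comap (chartEval j s) (I.map s.of) := by
    rw [IdealSheaf.stalk, TwoSidedIdeal.span_le]
    rintro _ ⟨U, hx, t, ht, rfl⟩
    refine (TwoSidedIdeal.mem_comap _).2 ?_
    have hmem : j.hom.base s ∈ U ⊓ rangeOpens j := ⟨hx, s, rfl⟩
    have := (h (U ⊓ rangeOpens j) (fun _ hy => hy.2) (res inf_le_left t)).1
      (𝓘.res_mem inf_le_left t ht) s hmem
    change chartEval j s (germ (j.hom.base s) hx t) ∈ _
    rw [chartEval_germ, ← evalAt_pull_res j inf_le_left t s hmem]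
    exact this
  refine ⟨fun hg => (TwoSidedIdeal.mem_comap _).1 (h1 hg), fun hg => ?_⟩
  have h2 : I.map s.of ≤ (𝓘.stalk (j.hom.base s)).map (chartEval j s) := by
    rw [map_le_iff]
    intro a ha
    obtain ⟨t, ht⟩ := exists_const_section j a
    have hts : t ∈ 𝓘.ideal (rangeOpens j) := by
      refine (h (rangeOpens j) subset_rfl t).2 ?_
      rw [ht]
      exact fun y _ => mem_map ha
    have e : chartEval j s (germ (j.hom.base s) (U := rangeOpens j) ⟨s, rfl⟩ t) = s.of a :=
      (chartEval_germ j s (U := rangeOpens j) ⟨s, rfl⟩ t).trans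
        ((congrArg (evalAt s (W := (Opens.map j.hom.base).obj (rangeOpens j)) ⟨s, rfl⟩) ht).trans
          rfl)
    rw [← e]
    exact mem_map (𝓘.germ_mem_stalk hts _ _)
  have h3 := (map_mem_map_comp_iff (f := RingHom.id _) (g := chartEval j s)
    (chartEval_bijective j s)).1 (h2 hg)
  exact (map_le_iff (f := RingHom.id _)).2 (fun x hx => hx) h3

theorem Represents.mem_zeroLocus_iff {j : affine A ⟶ X} [SheafedSpace.IsOpenImmersion j]
    {𝓘 : IdealSheaf X} {I : TwoSidedIdeal A} (h : Represents j 𝓘 I) (s : FullSpectrum A) :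
    j.hom.base s ∈ 𝓘.zeroLocus ↔ s ∈ locus I := by
  refine (subset_jacobson_iff _).trans ?_
  have hb := chartEval_bijective j s
  constructor
  · intro H x hx
    obtain ⟨g, rfl⟩ := hb.2 x
    rw [← map_one (chartEval j s), ← map_add]
    exact (H g ((h.mem_stalk_iff s g).2 hx)).map _
  · intro H g hg
    have := H _ ((h.mem_stalk_iff s g).1 hg)
    rw [← map_one (chartEval j s), ← map_add] at this
    obtain ⟨u, hu⟩ := this
    obtain ⟨v, hv⟩ := hb.2 ((u⁻¹ : (s.LocAt)ˣ) : s.LocAt)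
    refine isUnit_iff_exists.2 ⟨v, hb.1 ?_, hb.1 ?_⟩
    · rw [map_mul, hv, ← hu, Units.mul_inv, map_one]
    · rw [map_mul, hv, ← hu, Units.inv_mul, map_one]

end ChartValues

/-! ### Morphisms that are affine over small affine pieces of the target -/

section AffineOver

variable {X Y : NCRingedSpace.{u}}

/-- Every point of `Y` has arbitrarily small affine neighbourhoods whose preimage in `X` is empty
or affine. -/
def AffineOver (f : X ⟶ Y) : Prop :=
  ∀ (y : Y) (U : Opens Y), y ∈ U → ∃ (A : Type u) (_ : Ring A) (j : affine A ⟶ Y),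
    SheafedSpace.IsOpenImmersion j ∧ y ∈ Set.range j.hom.base ∧ Set.range j.hom.base ⊆ U ∧
      (f.hom.base ⁻¹' Set.range j.hom.base = ∅ ∨
        ∃ (B : Type u) (_ : Ring B) (_ : Nontrivial B) (i : affine B ⟶ X),
          SheafedSpace.IsOpenImmersion i ∧
            f.hom.base ⁻¹' Set.range j.hom.base = Set.range i.hom.base)

/-- In a chart where `𝓘` is given by `I`, let `f(x₀)` be the least point of a nonempty `Z(I)`. An
affine chart of `X` around `x₀` lying over the chart of `Y` is open, hence the trace of an open
subset of `Y`; that subset contains the least point, so it contains all of `Z(I)`. The chart of `X`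
is thus the whole preimage. -/
theorem affineOver_of_isEmbedding (hX : HasCharts X) {f : X ⟶ Y}
    (hf : Topology.IsEmbedding f.hom.base) {𝓘 : IdealSheaf Y} (h𝓘 : 𝓘.QuasiCoherent)
    (hr : Set.range f.hom.base = 𝓘.zeroLocus) : AffineOver f := by
  intro y U hU
  obtain ⟨A, _, j, hj, hyj, hjU, I, hI⟩ := h𝓘.exists_chart hU
  refine ⟨A, _, j, hj, hyj, hjU, ?_⟩
  have hloc : ∀ (x : X) (s : FullSpectrum A), j.hom.base s = f.hom.base x → s ∈ locus I :=
    fun x s hs => (hI.mem_zeroLocus_iff s).1 (by rw [← hr, hs]; exact ⟨x, rfl⟩)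
  rcases (locus I).eq_empty_or_nonempty with h0 | h0
  · left
    refine Set.eq_empty_of_forall_notMem fun x hx => ?_
    obtain ⟨s, hs⟩ := hx
    have := hloc x s hs
    rwa [h0] at this
  · right
    obtain ⟨_, hz, hleast⟩ := exists_least_of_locus h0
    have hz' := (hI.mem_zeroLocus_iff _).2 hz
    rw [← hr] at hz'
    obtain ⟨x₀, hx₀⟩ := hz'
    obtain ⟨B, _, i, hi, ⟨(s₀ : FullSpectrum B), hs₀⟩, hiU⟩ := hX x₀ ((Opens.map f.hom.base).obj (rangeOpens j))
      ⟨_, hx₀.symm⟩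
    refine ⟨B, _, s₀.of.domain_nontrivial, i, hi,
      subset_antisymm ?_ hiU⟩
    obtain ⟨V, hV, hVi⟩ := hf.isInducing.isOpen_iff.1 (isOpen_range_base i)
    rintro x ⟨s, hs⟩
    have h1 : pt (RingCon.mk' I.ringCon) ∈ j.hom.base ⁻¹' V := by
      have : x₀ ∈ f.hom.base ⁻¹' V := by rw [hVi]; exact ⟨s₀, hs₀⟩
      change f.hom.base x₀ ∈ V at this
      rwa [hx₀] at this
    have h2 : s ∈ j.hom.base ⁻¹' V :=
      hleast _ (hV.preimage (continuous_base j)) h1 (hloc x s hs)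
    rw [← hVi]
    change f.hom.base x ∈ V
    rw [← hs]
    exact h2

variable {A : Type u} [Ring A] {B : Type u} [Ring B]

/-- Over the chart, `f` becomes a local morphism `F(B) → F(A)`, hence comes from some `φ`.
Surjectivity of `φ` follows from local surjectivity at one point, and the kernel is computed by
`mem_hatIdeal_ker_iff`. -/
theorem exists_surjective {f : X ⟶ Y} (hf : IsLocalMorphism f)
    (hs : TopCat.Presheaf.IsLocallySurjective f.hom.c) (j : affine A ⟶ Y)
    [SheafedSpace.IsOpenImmersion j] [Nontrivial B] (i : affine B ⟶ X)
    [SheafedSpace.IsOpenImmersion i]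
    (hij : f.hom.base ⁻¹' Set.range j.hom.base = Set.range i.hom.base) :
    ∃ φ : A →+* B, Function.Surjective φ ∧
      (∀ s : FullSpectrum B, f.hom.base (i.hom.base s) = j.hom.base (comap φ s)) ∧
      Represents j (kerSheaf f) (TwoSidedIdeal.ker φ) := by
  obtain ⟨g, hg⟩ := exists_lift j (i ≫ f) (by
    rintro _ ⟨s, rfl⟩
    have : i.hom.base s ∈ f.hom.base ⁻¹' Set.range j.hom.base := by rw [hij]; exact ⟨s, rfl⟩
    exact this)
  have hgl : IsLocalMorphism g := by
    have : IsLocalMorphism (g ≫ j) := by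
      rw [hg]; exact (isLocalMorphism_of_isOpenImmersion i).comp hf
    exact this.of_comp
  obtain ⟨φ, -, hb, hφ⟩ := exists_eq_comap hgl
  have hbase : ∀ s : FullSpectrum B, f.hom.base (i.hom.base s) = j.hom.base (comap φ s) := by
    intro s
    rw [← hb s]
    exact (base_congr hg s).symm
  have hval : ∀ (W : Opens Y) (t : Sec Y W) (s : FullSpectrum B)
      (h : f.hom.base (i.hom.base s) ∈ W) (h' : j.hom.base (comap φ s) ∈ W),
      evalAt s (W := (Opens.map i.hom.base).obj ((Opens.map f.hom.base).obj W)) h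
        (pull i ((Opens.map f.hom.base).obj W) (pull f W t)) =
      comapLift φ s (evalAt (comap φ s) (W := (Opens.map j.hom.base).obj W) h' (pull j W t)) := by
    intro W t s h h'
    have h2 : j.hom.base (g.hom.base s) ∈ W := by
      have := (base_congr hg s).symm ▸ h
      exact this
    exact (evalAt_pull_congr hg.symm t s h h2).trans
      (hφ ((Opens.map j.hom.base).obj W) (pull j W t) s h2 h')
  have : Nontrivial A := φ.domain_nontrivial
  have hsurj : Function.Surjective φ := by
    intro b
    obtain ⟨t, ht⟩ := (pull_bijective i (U := (Opens.map f.hom.base).obj (rangeOpens j))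
      hij.le).2 (const (A := B) _ b)
    -- The lift is taken near the point of the identity of `A`, so it exists over the whole chart
    -- and is a constant `c`; this `c` is the preimage of `b`.
    obtain ⟨V, hVR, s, hV, hsV⟩ := (isLocallySurjective_iff f).1 hs (rangeOpens j) t
      (j.hom.base (pt (RingHom.id A))) ⟨_, rfl⟩
    obtain ⟨c, hc⟩ := exists_const_eq (A := A) (W := (Opens.map j.hom.base).obj V) hV (pull j V s)
    have hVall : ∀ z : FullSpectrum A, j.hom.base z ∈ V := fun z =>
      mem_of_pt_id_mem (U := j.hom.base ⁻¹' V) (V.2.preimage (continuous_base j)) hV z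
    refine ⟨c, of_pt_id_injective ?_⟩
    have h' := hVall (comap φ (pt (RingHom.id B)))
    have h : f.hom.base (i.hom.base (pt (RingHom.id B))) ∈ V := by rw [hbase]; exact h'
    have e1 := hval V s (pt (RingHom.id B)) h h'
    rw [hsV, hc] at e1
    refine e1.symm.trans ?_
    refine (evalAt_pull_res i (U := (Opens.map f.hom.base).obj (rangeOpens j))
      (V := (Opens.map f.hom.base).obj V) (fun _ hx => hVR hx) t (pt (RingHom.id B)) h).trans ?_
    rw [ht]
    rfl
  refine ⟨φ, hsurj, hbase, fun W hW t => ?_⟩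
  rw [mem_kerSheaf, ← pull_eq_zero_iff i (U := (Opens.map f.hom.base).obj W)
    (fun x hx => hij.le (hW hx))]
  refine Iff.trans ?_ (mem_hatIdeal_ker_iff hsurj).symm
  constructor
  · intro h0 s hs'
    have h : f.hom.base (i.hom.base s) ∈ W := by rw [hbase]; exact hs'
    rw [← hval W t s h hs', h0, map_zero]
  · intro h0
    refine eval_ext (A := B)
      (W := (Opens.map i.hom.base).obj ((Opens.map f.hom.base).obj W)) fun s h => ?_
    have h' : j.hom.base (comap φ s) ∈ W := by rw [← hbase]; exact h
    rw [map_zero]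
    exact (hval W t s h h').trans (h0 s h')

theorem represents_top {f : X ⟶ Y} {j : affine A ⟶ Y}
    (h0 : f.hom.base ⁻¹' Set.range j.hom.base = ∅) : Represents j (kerSheaf f) ⊤ := by
  intro W hW t
  refine iff_of_true ((mem_kerSheaf f).2 ?_) fun s hs => ?_
  · refine section_ext (X := X) (U := (Opens.map f.hom.base).obj W) fun x hx => ?_
    have : x ∈ f.hom.base ⁻¹' Set.range j.hom.base := hW hx
    rw [h0] at this
    exact this.elim
  · have h1 := mem_map (f := s.of) (I := (⊤ : TwoSidedIdeal A)) (x := 1) trivial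
    rw [map_one] at h1
    have := TwoSidedIdeal.mul_mem_left _ (evalAt s (W := (Opens.map j.hom.base).obj W) hs
      (pull j W t)) 1 h1
    rwa [mul_one] at this

theorem locus_top : locus (⊤ : TwoSidedIdeal A) = ∅ := by
  refine Set.eq_empty_of_forall_notMem fun s hs => ?_
  have h1 := mem_map (f := s.of) (I := (⊤ : TwoSidedIdeal A)) (x := -1) trivial
  have := hs _ h1
  rw [map_neg, map_one, add_neg_cancel] at this
  exact not_isUnit_zero this

/-- Injectivity, the induced topology, the image and quasi-coherence of the kernel are all local on
`Y`. On each chart they are the properties of `comap φ` for a surjection `φ`, or the preimage is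
empty and the kernel is represented by the unit ideal. -/
theorem isClosedImmersion_of_affineOver {f : X ⟶ Y} (hf : IsLocalMorphism f)
    (hs : TopCat.Presheaf.IsLocallySurjective f.hom.c) (ha : AffineOver f) :
    IsClosedImmersion f := by
  have hinj : Function.Injective f.hom.base := by
    intro x x' hxx
    obtain ⟨A, _, j, hj, hy, -, h⟩ := ha (f.hom.base x) ⊤ trivial
    rcases h with h | ⟨B, _, _, i, hi, h⟩
    · have : x ∈ f.hom.base ⁻¹' Set.range j.hom.base := hy
      rw [h] at this
      exact this.elim
    · obtain ⟨φ, hφ, hb, -⟩ := exists_surjective hf hs j i h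
      obtain ⟨(s : FullSpectrum B), rfl⟩ : x ∈ Set.range i.hom.base := h.le hy
      obtain ⟨(s' : FullSpectrum B), rfl⟩ : x' ∈ Set.range i.hom.base := h.le (by
        change f.hom.base x' ∈ Set.range j.hom.base
        rw [← hxx]; exact hy)
      congr 1
      refine comap_injective_of_surjective hφ ((isOpenEmbedding_base j).injective ?_)
      exact (hb s).symm.trans (hxx.trans (hb s'))
  have hemb : Topology.IsEmbedding f.hom.base := by
    refine ⟨Topology.isInducing_iff_nhds.2 fun x => ?_, hinj⟩
    refine le_antisymm (continuous_base f).continuousAt.le_comap ?_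
    intro N hN
    obtain ⟨A, _, j, hj, hy, -, h⟩ := ha (f.hom.base x) ⊤ trivial
    rcases h with h | ⟨B, _, _, i, hi, h⟩
    · have : x ∈ f.hom.base ⁻¹' Set.range j.hom.base := hy
      rw [h] at this
      exact this.elim
    · obtain ⟨φ, hφ, hb, -⟩ := exists_surjective hf hs j i h
      obtain ⟨(s : FullSpectrum B), rfl⟩ : x ∈ Set.range i.hom.base := h.le hy
      -- `F(B)` carries the topology induced from `F(A)`, so `N` contains the trace of a
      -- neighbourhood `M` in the chart of `Y`.
      have hN' : i.hom.base ⁻¹' N ∈ Filter.comap (comap φ) (nhds (comap φ s)) :=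
        ((isEmbedding_comap_of_surjective hφ).isInducing.nhds_eq_comap s).ge
          ((continuous_base i).continuousAt hN)
      obtain ⟨M, hM, hMN⟩ := hN'
      refine ⟨j.hom.base '' M, ?_, ?_⟩
      · rw [hb s]
        exact (isOpenEmbedding_base j).isOpenMap.image_mem_nhds hM
      · rintro x' ⟨z, hz, hzx⟩
        obtain ⟨s', rfl⟩ : x' ∈ Set.range i.hom.base := h.le ⟨z, hzx⟩
        have : comap φ s' = z :=
          (isOpenEmbedding_base j).injective ((hb s').symm.trans hzx.symm)
        exact hMN (show comap φ s' ∈ M by rw [this]; exact hz)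
  refine isClosedImmersion_of_ker hemb ?_ hs ?_
  · ext y
    obtain ⟨A, _, j, hj, ⟨(s : FullSpectrum A), rfl⟩, -, h⟩ := ha y ⊤ trivial
    rcases h with h | ⟨B, _, _, i, hi, h⟩
    · refine Iff.trans ?_ ((represents_top h).mem_zeroLocus_iff s).symm
      rw [locus_top]
      refine iff_of_false ?_ id
      rintro ⟨x, hx⟩
      have : x ∈ f.hom.base ⁻¹' Set.range j.hom.base := ⟨s, hx.symm⟩
      rwa [h] at this
    · obtain ⟨φ, hφ, hb, hrep⟩ := exists_surjective hf hs j i h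
      refine Iff.trans ?_ (hrep.mem_zeroLocus_iff s).symm
      rw [← range_comap_of_surjective hφ]
      constructor
      · rintro ⟨x, hx⟩
        obtain ⟨s', rfl⟩ : x ∈ Set.range i.hom.base := h.le ⟨s, hx.symm⟩
        exact ⟨s', (isOpenEmbedding_base j).injective ((hb s').symm.trans hx)⟩
      · rintro ⟨s', rfl⟩
        exact ⟨i.hom.base s', hb s'⟩
  · intro y
    obtain ⟨A, _, j, hj, hy, -, h⟩ := ha y ⊤ trivial
    rcases h with h | ⟨B, _, _, i, hi, h⟩
    · exact ⟨A, _, j, hj, hy, ⊤, represents_top h⟩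
    · obtain ⟨φ, hφ, hb, hrep⟩ := exists_surjective hf hs j i h
      exact ⟨A, _, j, hj, hy, _, hrep⟩

end AffineOver

/-! ### Consequences of being a closed immersion, and the local criterion -/

section ClosedImmersions

variable {X Y Z : NCRingedSpace.{u}}

theorem IsClosedImmersion.exists_isEmbedding {f : X ⟶ Y} (hf : IsClosedImmersion f) :
    Topology.IsEmbedding f.hom.base ∧ ∃ 𝓘 : IdealSheaf Y, 𝓘.QuasiCoherent ∧
      Set.range f.hom.base = 𝓘.zeroLocus := by
  obtain ⟨𝓘, h𝓘, e, rfl⟩ := hf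
  refine ⟨Topology.IsEmbedding.subtypeVal.comp (isOpenEmbedding_base e.hom).isEmbedding,
    𝓘, h𝓘, ?_⟩
  ext y
  constructor
  · rintro ⟨x, rfl⟩
    exact (e.hom.hom.base x : 𝓘.zeroLocus).2
  · intro hy
    refine ⟨e.inv.hom.base (⟨y, hy⟩ : 𝓘.zeroLocus), ?_⟩
    exact base_congr (f := e.inv ≫ e.hom ≫ 𝓘.closedSubι) (g := 𝓘.closedSubι) (by simp) ⟨y, hy⟩

/-- A section of the quotient sheaf is represented near the least point of `Z(I)` by a section of
`𝒪_Y`, which is constant modulo `I` on `Z(I)`. The constant extends to the entire chart and is the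
required lift, even around points outside `Z(𝓘)`. -/
theorem IsClosedImmersion.isLocallySurjective {f : X ⟶ Y} (hf : IsClosedImmersion f) :
    TopCat.Presheaf.IsLocallySurjective f.hom.c := by
  obtain ⟨𝓘, h𝓘, e, rfl⟩ := hf
  rw [isLocallySurjective_iff]
  intro U t y hy
  obtain ⟨A, _, j, hj, hyj, hjU, I, hI⟩ := h𝓘.exists_chart hy
  have hrange : ∀ V : Opens 𝓘.closedSub, (V : Set 𝓘.closedSub) ⊆ Set.range e.hom.hom.base :=
    fun V z _ => ⟨e.inv.hom.base z,
      base_congr (f := e.inv ≫ e.hom) (g := 𝟙 _) (by simp) z⟩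
  have hRU : rangeOpens j ≤ U := hjU
  obtain ⟨t, rfl⟩ := (pull_bijective e.hom (hrange ((Opens.map 𝓘.closedSubι.hom.base).obj U))).2 t
  suffices H : ∃ s : Sec Y (rangeOpens j), pull 𝓘.closedSubι (rangeOpens j) s =
      res (X := 𝓘.closedSub) (U := (Opens.map 𝓘.closedSubι.hom.base).obj U)
        (V := (Opens.map 𝓘.closedSubι.hom.base).obj (rangeOpens j)) (fun _ hx => hRU hx) t by
    obtain ⟨s, hs⟩ := H
    exact ⟨rangeOpens j, hRU, s, hyj, (congrArg (pull e.hom _) hs).trans (pull_res e.hom _ t)⟩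
  have ext : ∀ (V : Opens Y) (t t' : 𝓘.quotSections.sections ((Opens.map 𝓘.closedSubι.hom.base).obj V)),
      (∀ (z : Y) (hz : z ∈ 𝓘.zeroLocus) (hzV : z ∈ V), t.1 ⟨⟨z, hz⟩, hzV⟩ = t'.1 ⟨⟨z, hz⟩, hzV⟩) →
      t = t' := fun V t t' h => Subtype.ext (funext fun z => h z.1.1 z.1.2 z.2)
  rcases (locus I).eq_empty_or_nonempty with h0 | h0
  · refine ⟨0, ext _ _ _ ?_⟩
    rintro _ hz ⟨s, rfl⟩
    have := (hI.mem_zeroLocus_iff s).1 hz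
    rw [h0] at this
    exact this.elim
  obtain ⟨_, hz₀, hleast⟩ := exists_least_of_locus h0
  obtain ⟨V', hzV', i, U', hU', s, hs⟩ :=
    (show 𝓘.quotSections.sections ((Opens.map 𝓘.closedSubι.hom.base).obj U) from t).2
      ⟨⟨_, (hI.mem_zeroLocus_iff _).2 hz₀⟩, hRU ⟨_, rfl⟩⟩
  obtain ⟨V₀, hV₀, hV₀V'⟩ : ∃ V₀ : Set Y, IsOpen V₀ ∧
    (Subtype.val : 𝓘.zeroLocus → Y) ⁻¹' V₀ = V'.1 := isOpen_induced_iff.1 V'.2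
  have hmemV' : ∀ (z : Y) (hz : z ∈ 𝓘.zeroLocus), z ∈ V₀ ↔ (⟨z, hz⟩ : 𝓘.zeroLocus) ∈ V' := by
    intro z hz
    change (⟨z, hz⟩ : 𝓘.zeroLocus) ∈ (Subtype.val : 𝓘.zeroLocus → Y) ⁻¹' V₀ ↔ _ ∈ V'.1
    rw [hV₀V']
  let W : Opens Y := ⟨V₀, hV₀⟩ ⊓ U'
  have hWz : j.hom.base (pt (RingCon.mk' I.ringCon)) ∈ W :=
    ⟨(hmemV' _ ((hI.mem_zeroLocus_iff _).2 hz₀)).2 hzV', hU' ⟨_, hzV'⟩⟩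
  obtain ⟨c, hc⟩ := exists_const_mod (A := A) (W := (Opens.map j.hom.base).obj W) hWz
    (pull j W (res inf_le_right s))
  obtain ⟨σ, hσ⟩ := exists_const_section j c
  refine ⟨σ, ext _ _ _ ?_⟩
  rintro _ hz ⟨(z : FullSpectrum A), rfl⟩
  have hzI := (hI.mem_zeroLocus_iff z).1 hz
  -- `W` contains the least point and hence all of `Z(I)`, so the one representative `s` describes
  -- `t` at every relevant point.
  have hzW : j.hom.base z ∈ W :=
    hleast (j.hom.base ⁻¹' W) (W.2.preimage (continuous_base j)) hWz hzI
  refine Eq.trans ?_ (hs ⟨⟨_, hz⟩, (hmemV' _ hz).1 hzW.1⟩).symm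
  refine (sub_eq_zero.1 ?_).symm
  refine (map_sub (RingCon.mk' (𝓘.stalk (j.hom.base z)).ringCon) _ _).symm.trans ?_
  refine (TwoSidedIdeal.mk'_eq_zero_iff _ _).2 ?_
  refine (hI.mem_stalk_iff z _).2 ?_
  have e1 := hc z hzW hzI
  rw [map_sub] at e1 ⊢
  convert e1 using 2
  · refine (chartEval_germ j z (hU' ⟨⟨_, hz⟩, (hmemV' _ hz).1 hzW.1⟩) s).trans ?_
    exact (evalAt_pull_res j (V := W) inf_le_right s z hzW).symm
  · refine (chartEval_germ j z (U := rangeOpens j) ⟨z, rfl⟩ σ).trans ?_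
    rw [hσ]
    rfl

theorem isClosedImmersion_iff {f : X ⟶ Y} (hX : HasCharts X) (hf : IsLocalMorphism f) :
    IsClosedImmersion f ↔ TopCat.Presheaf.IsLocallySurjective f.hom.c ∧ AffineOver f := by
  refine ⟨fun h => ⟨h.isLocallySurjective, ?_⟩, fun h => isClosedImmersion_of_affineOver hf h.1 h.2⟩
  obtain ⟨h1, 𝓘, h𝓘, hr⟩ := h.exists_isEmbedding
  exact affineOver_of_isEmbedding hX h1 h𝓘 hr

end ClosedImmersions
/-! ### Restriction over open subspaces and composition -/

/-- Comparing germs avoids identifying the different expressions for one and the same preimage that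
arise for composites and restrictions. -/
theorem isLocallySurjective_iff_germ {X Y : NCRingedSpace.{u}} (f : X ⟶ Y) :
    TopCat.Presheaf.IsLocallySurjective f.hom.c ↔
      ∀ (U : Opens Y) (t : Sec X ((Opens.map f.hom.base).obj U)) (y : Y), y ∈ U →
        ∃ (V : Opens Y) (hVU : V ≤ U) (s : Sec Y V), y ∈ V ∧
          ∀ (x : X) (hx : f.hom.base x ∈ V),
            germ x (U := (Opens.map f.hom.base).obj V) hx (pull f V s) =
              germ x (U := (Opens.map f.hom.base).obj U) (hVU hx) t := by
  rw [isLocallySurjective_iff]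
  refine forall_congr' fun U => forall_congr' fun t => forall_congr' fun y =>
    imp_congr_right fun _ => exists_congr fun V => exists_congr fun hVU => exists_congr fun s =>
      and_congr_right fun _ => ⟨fun h x hx => ?_, fun h => ?_⟩
  · rw [h]
    exact germ_res (X := X) (U := (Opens.map f.hom.base).obj U)
      (V := (Opens.map f.hom.base).obj V) _ x hx t
  · exact section_ext (X := X) (U := (Opens.map f.hom.base).obj V) fun x hx =>
      (h x hx).trans (germ_res (X := X) (U := (Opens.map f.hom.base).obj U)
        (V := (Opens.map f.hom.base).obj V) (fun _ hx => hVU hx) x hx t).symm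

/-! ### Locality on the target -/

section Square

variable {X Y X' Y' : NCRingedSpace.{u}} {f : X ⟶ Y} {f' : X' ⟶ Y'} {oX : X' ⟶ X} {oY : Y' ⟶ Y}

/-- `f'` is the restriction of `f` over the open subspace `Y'` of `Y`. -/
structure IsRestriction (f : X ⟶ Y) (f' : X' ⟶ Y') (oX : X' ⟶ X) (oY : Y' ⟶ Y) : Prop where
  left : SheafedSpace.IsOpenImmersion oX
  right : SheafedSpace.IsOpenImmersion oY
  comm : f' ≫ oY = oX ≫ f
  range_eq : Set.range oX.hom.base = f.hom.base ⁻¹' Set.range oY.hom.base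

/-- The image of an open set under an open immersion. -/
def imageOpens (o : X' ⟶ X) [SheafedSpace.IsOpenImmersion o] (U : Opens X') : Opens X :=
  ⟨o.hom.base '' U, (isOpenEmbedding_base o).isOpenMap _ U.2⟩

namespace IsRestriction

theorem base_eq (h : IsRestriction f f' oX oY) (x : X') :
    oY.hom.base (f'.hom.base x) = f.hom.base (oX.hom.base x) :=
  base_congr h.comm x

theorem germ_eq (h : IsRestriction f f' oX oY) {V : Opens Y} (s : Sec Y V) (x : X')
    (h1 : oY.hom.base (f'.hom.base x) ∈ V) (h2 : f.hom.base (oX.hom.base x) ∈ V) :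
    germ x (U := (Opens.map f'.hom.base).obj ((Opens.map oY.hom.base).obj V)) h1
        (pull f' ((Opens.map oY.hom.base).obj V) (pull oY V s)) =
      germ x (U := (Opens.map oX.hom.base).obj ((Opens.map f.hom.base).obj V)) h2
        (pull oX ((Opens.map f.hom.base).obj V) (pull f V s)) :=
  germ_pull_congr h.comm s x h1 h2

/-- Set-theoretically the square is cartesian; this transfers preimages of affine pieces between
`f'` and `f`. -/
theorem preimage_image (h : IsRestriction f f' oX oY) (T : Set Y') :
    f.hom.base ⁻¹' (oY.hom.base '' T) = oX.hom.base '' (f'.hom.base ⁻¹' T) := by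
  have := h.right
  ext x
  constructor
  · rintro ⟨y, hy, hyx⟩
    obtain ⟨x', rfl⟩ : x ∈ Set.range oX.hom.base := h.range_eq.ge ⟨y, hyx⟩
    have e : y = f'.hom.base x' :=
      (isOpenEmbedding_base oY).injective (hyx.trans (h.base_eq x').symm)
    exact ⟨x', show f'.hom.base x' ∈ T from e ▸ hy, rfl⟩
  · rintro ⟨x', hx', rfl⟩
    exact ⟨_, hx', h.base_eq x'⟩

theorem isLocalMorphism (h : IsRestriction f f' oX oY) (hf : IsLocalMorphism f) :
    IsLocalMorphism f' := by
  have := h.left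
  have := h.right
  have : IsLocalMorphism (f' ≫ oY) := by
    rw [h.comm]
    exact (isLocalMorphism_of_isOpenImmersion oX).comp hf
  exact this.of_comp

theorem isLocallySurjective (h : IsRestriction f f' oX oY)
    (hf : TopCat.Presheaf.IsLocallySurjective f.hom.c) :
    TopCat.Presheaf.IsLocallySurjective f'.hom.c := by
  have := h.left
  have := h.right
  rw [isLocallySurjective_iff_germ] at hf ⊢
  intro U' t' y' hy'
  have hle : ∀ x : X', f.hom.base (oX.hom.base x) ∈ imageOpens oY U' → f'.hom.base x ∈ U' := by
    rintro x ⟨y, hy, e⟩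
    rwa [← (isOpenEmbedding_base oY).injective (e.trans (h.base_eq x).symm)]
  obtain ⟨t, ht⟩ := (pull_bijective oX (U := (Opens.map f.hom.base).obj (imageOpens oY U')) (by
    rintro x ⟨y, -, hyx⟩
    exact h.range_eq.ge ⟨y, hyx⟩)).2 (res (U := (Opens.map f'.hom.base).obj U')
      (V := (Opens.map oX.hom.base).obj ((Opens.map f.hom.base).obj (imageOpens oY U')))
      (fun x hx => hle x hx) t')
  obtain ⟨V, hVU, s, hyV, hs⟩ := hf (imageOpens oY U') t (oY.hom.base y') ⟨y', hy', rfl⟩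
  refine ⟨(Opens.map oY.hom.base).obj V, ?_, pull oY V s, hyV, fun x hx => ?_⟩
  · intro y hy
    obtain ⟨z, hz, e⟩ := hVU hy
    rwa [← (isOpenEmbedding_base oY).injective e]
  · have hx2 : f.hom.base (oX.hom.base x) ∈ V := by
      rw [← h.base_eq x]
      exact hx
    refine (h.germ_eq s x hx hx2).trans ?_
    refine (stalkHom_germ oX x (U := (Opens.map f.hom.base).obj V) hx2 _).symm.trans ?_
    refine (congrArg (stalkHom oX x) (hs _ hx2)).trans ?_
    refine (stalkHom_germ oX x (U := (Opens.map f.hom.base).obj (imageOpens oY U'))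
      (hVU hx2) t).trans ?_
    rw [ht]
    exact germ_res (X := X') (U := (Opens.map f'.hom.base).obj U') _ x (hVU hx2) t'

theorem affineOver (h : IsRestriction f f' oX oY) (hf : AffineOver f) : AffineOver f' := by
  have := h.left
  have := h.right
  intro y' U' hy'
  obtain ⟨A, _, j, hj, hyj, hjU, hfj⟩ := hf (oY.hom.base y') (imageOpens oY U') ⟨y', hy', rfl⟩
  obtain ⟨j', rfl⟩ := exists_lift oY j (hjU.trans (Set.image_subset_range _ _))
  have hr : Set.range (j' ≫ oY).hom.base = oY.hom.base '' Set.range j'.hom.base :=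
    Set.range_comp oY.hom.base j'.hom.base
  rw [hr] at hyj hjU hfj
  rw [h.preimage_image] at hfj
  have hinj := (isOpenEmbedding_base oY).injective
  refine ⟨A, _, j', isOpenImmersion_of_comp j' oY, (hinj.mem_set_image).1 hyj,
    (Set.image_subset_image_iff hinj).1 hjU, ?_⟩
  rcases hfj with h0 | ⟨B, _, hB, i, hi, hfi⟩
  · exact Or.inl (Set.image_eq_empty.1 h0)
  · obtain ⟨i', rfl⟩ := exists_lift oX i (hfi.symm.le.trans (Set.image_subset_range _ _))
    refine Or.inr ⟨B, _, hB, i', isOpenImmersion_of_comp i' oX,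
      (isOpenEmbedding_base oX).injective.image_injective ?_⟩
    exact hfi.trans (Set.range_comp oX.hom.base i'.hom.base)

/-- The condition `AffineOver` concerns one point of `Y` at a time, so a single member of a covering
that contains the point suffices. `isLocallySurjective_at` plays the same role for sheaves. -/
theorem affineOver_at (h : IsRestriction f f' oX oY) (hf' : AffineOver f') (y' : Y') (U : Opens Y)
    (hU : oY.hom.base y' ∈ U) : ∃ (A : Type u) (_ : Ring A) (j : affine A ⟶ Y),
      SheafedSpace.IsOpenImmersion j ∧ oY.hom.base y' ∈ Set.range j.hom.base ∧
        Set.range j.hom.base ⊆ U ∧ (f.hom.base ⁻¹' Set.range j.hom.base = ∅ ∨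
        ∃ (B : Type u) (_ : Ring B) (_ : Nontrivial B) (i : affine B ⟶ X),
          SheafedSpace.IsOpenImmersion i ∧
            f.hom.base ⁻¹' Set.range j.hom.base = Set.range i.hom.base) := by
  have := h.left
  have := h.right
  obtain ⟨A, _, j', hj', hyj, hjU, hfj⟩ := hf' y' ((Opens.map oY.hom.base).obj U) hU
  have hr : Set.range (j' ≫ oY).hom.base = oY.hom.base '' Set.range j'.hom.base :=
    Set.range_comp oY.hom.base j'.hom.base
  refine ⟨A, _, j' ≫ oY, inferInstance, ?_, ?_, ?_⟩
  · rw [hr]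
    exact ⟨_, hyj, rfl⟩
  · rw [hr]
    exact Set.image_subset_iff.2 hjU
  · rw [hr, h.preimage_image]
    rcases hfj with h0 | ⟨B, _, hB, i', hi', hfi⟩
    · exact Or.inl (by rw [h0, Set.image_empty])
    · refine Or.inr ⟨B, _, hB, i' ≫ oX, inferInstance, ?_⟩
      rw [hfi]
      exact (Set.range_comp oX.hom.base i'.hom.base).symm

theorem isLocallySurjective_at (h : IsRestriction f f' oX oY)
    (hf' : TopCat.Presheaf.IsLocallySurjective f'.hom.c) (U : Opens Y)
    (t : Sec X ((Opens.map f.hom.base).obj U)) (y' : Y') (hy' : oY.hom.base y' ∈ U) :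
    ∃ (V : Opens Y) (hVU : V ≤ U) (s : Sec Y V), oY.hom.base y' ∈ V ∧
      ∀ (x : X) (hx : f.hom.base x ∈ V),
        germ x (U := (Opens.map f.hom.base).obj V) hx (pull f V s) =
          germ x (U := (Opens.map f.hom.base).obj U) (hVU hx) t := by
  have := h.left
  have := h.right
  have hle : ∀ x : X', oY.hom.base (f'.hom.base x) ∈ U → f.hom.base (oX.hom.base x) ∈ U :=
    fun x hx => by rwa [← h.base_eq x]
  obtain ⟨V', hVU', s', hyV', hs'⟩ := (isLocallySurjective_iff_germ f').1 hf'
    ((Opens.map oY.hom.base).obj U)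
    (res (X := X') (U := (Opens.map oX.hom.base).obj ((Opens.map f.hom.base).obj U))
      (V := (Opens.map f'.hom.base).obj ((Opens.map oY.hom.base).obj U)) (fun x hx => hle x hx)
      (pull oX ((Opens.map f.hom.base).obj U) t)) y' hy'
  have hV : imageOpens oY V' ≤ U := by
    rintro _ ⟨z, hz, rfl⟩
    exact hVU' hz
  have hV' : (Opens.map oY.hom.base).obj (imageOpens oY V') ≤ V' := by
    rintro z ⟨w, hw, e⟩
    rwa [← (isOpenEmbedding_base oY).injective e]
  obtain ⟨s, hs⟩ := (pull_bijective oY (U := imageOpens oY V') (Set.image_subset_range _ _)).2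
    (res hV' s')
  refine ⟨imageOpens oY V', hV, s, ⟨y', hyV', rfl⟩, fun x hx => ?_⟩
  obtain ⟨x', hx', rfl⟩ : x ∈ oX.hom.base '' (f'.hom.base ⁻¹' V') := by
    rw [← h.preimage_image]
    exact hx
  refine (stalkHom_bijective oX x').1 ?_
  have hx2 : oY.hom.base (f'.hom.base x') ∈ imageOpens oY V' := ⟨_, hx', rfl⟩
  refine (stalkHom_germ oX x' (U := (Opens.map f.hom.base).obj (imageOpens oY V')) hx _).trans ?_
  refine (h.germ_eq s x' hx2 hx).symm.trans ?_
  rw [hs]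
  refine (stalkHom_germ f' x' (U := (Opens.map oY.hom.base).obj (imageOpens oY V')) hx2
    _).symm.trans ?_
  refine (congrArg (stalkHom f' x') (germ_res hV' (f'.hom.base x') hx2 s')).trans ?_
  refine (stalkHom_germ f' x' hx' s').trans ((hs' x' hx').trans ?_)
  refine (germ_res (X := X') (U := (Opens.map oX.hom.base).obj ((Opens.map f.hom.base).obj U)) _ x'
    (hVU' hx') _).trans ?_
  exact (stalkHom_germ oX x' (U := (Opens.map f.hom.base).obj U) (hV hx) t).symm

end IsRestriction

theorem isRestriction_restrictTarget (f : X ⟶ Y) (U : Opens Y) :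
    IsRestriction f (restrictTarget f U)
      (X.ofRestrict ((Opens.map f.hom.base).obj U).isOpenEmbedding)
      (Y.ofRestrict U.isOpenEmbedding) where
  left := inferInstance
  right := inferInstance
  comm := InducedCategory.hom_ext (PresheafedSpace.IsOpenImmersion.lift_fac _ _ (by
    rintro _ ⟨x, rfl⟩
    exact ⟨⟨f.hom.base x.1, x.2⟩, rfl⟩))
  range_eq := by
    ext x
    exact ⟨fun ⟨z, hz⟩ => hz ▸ ⟨⟨f.hom.base z.1, z.2⟩, rfl⟩,
      fun ⟨z, hz⟩ => ⟨⟨x, by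
        change f.hom.base x ∈ U
        rw [← hz]
        exact z.2⟩, rfl⟩⟩

theorem isClosedImmersion_iff_restrictTarget (hX : HasCharts X) (hf : IsLocalMorphism f)
    {ι : Type u} (U : ι → Opens Y) (hU : ∀ y : Y, ∃ i, y ∈ U i) :
    IsClosedImmersion f ↔ ∀ i, IsClosedImmersion (restrictTarget f (U i)) := by
  have key : ∀ i, IsClosedImmersion (restrictTarget f (U i)) ↔ _ := fun i =>
    isClosedImmersion_iff
      (hX.of_isOpenImmersion (X.ofRestrict ((Opens.map f.hom.base).obj (U i)).isOpenEmbedding))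
      ((isRestriction_restrictTarget f (U i)).isLocalMorphism hf)
  rw [isClosedImmersion_iff hX hf]
  constructor
  · exact fun h i => (key i).2 ⟨(isRestriction_restrictTarget f (U i)).isLocallySurjective h.1,
      (isRestriction_restrictTarget f (U i)).affineOver h.2⟩
  · intro h
    refine ⟨(isLocallySurjective_iff_germ f).2 fun V t y hy => ?_, fun y V hy => ?_⟩
    · obtain ⟨i, hi⟩ := hU y
      exact (isRestriction_restrictTarget f (U i)).isLocallySurjective_at ((key i).1 (h i)).1 V t
        ⟨y, hi⟩ hy
    · obtain ⟨i, hi⟩ := hU y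
      exact (isRestriction_restrictTarget f (U i)).affineOver_at ((key i).1 (h i)).2 ⟨y, hi⟩ V hy

end Square

/-! ### Composition of closed immersions -/

section Composition

variable {X Y Z : NCRingedSpace.{u}} {f : X ⟶ Y} {g : Y ⟶ Z}

/-- The range of an affine chart is the smallest open neighbourhood of one of its points. -/
theorem exists_least_point {B : Type u} [Ring B] [Nontrivial B] (i : affine B ⟶ Y) :
    ∃ y ∈ Set.range i.hom.base, ∀ V : Opens Y, y ∈ V → Set.range i.hom.base ⊆ V := by
  refine ⟨i.hom.base (pt (RingHom.id B)), ⟨_, rfl⟩, fun V hV => ?_⟩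
  rintro _ ⟨s, rfl⟩
  exact mem_of_pt_id_mem (U := i.hom.base ⁻¹' V) (V.2.preimage (continuous_base i)) hV s

/-- If the preimage of a chart under `g` is affine, it is the smallest neighbourhood of one of its
points `y`. A piece around `y` that lies inside it and is good for `f` must be all of it. -/
theorem AffineOver.comp (hf : AffineOver f) (hg : AffineOver g) : AffineOver (f ≫ g) := by
  intro z U hz
  obtain ⟨A, _, j, hj, hzj, hjU, h⟩ := hg z U hz
  refine ⟨A, _, j, hj, hzj, hjU, ?_⟩
  change f.hom.base ⁻¹' (g.hom.base ⁻¹' Set.range j.hom.base) = ∅ ∨ ∃ (B : Type u) (_ : Ring B)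
    (_ : Nontrivial B) (i : affine B ⟶ X), SheafedSpace.IsOpenImmersion i ∧
      f.hom.base ⁻¹' (g.hom.base ⁻¹' Set.range j.hom.base) = Set.range i.hom.base
  rcases h with h | ⟨B, _, _, i, hi, h⟩
  · left
    rw [h, Set.preimage_empty]
  · obtain ⟨y, hy, hle⟩ := exists_least_point i
    obtain ⟨C, _, k, hk, hyk, hkU, h'⟩ := hf y (rangeOpens i) hy
    have e : Set.range k.hom.base = Set.range i.hom.base :=
      subset_antisymm hkU (hle (rangeOpens k) hyk)
    rwa [h, ← e]

/-- Direct image along `g` need not preserve surjectivity of sheaves. Here a lift along `f` near the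
least point of the affine preimage under `g` is already defined over that whole preimage, so it can
be lifted further along `g`. -/
theorem isLocallySurjective_comp (hf : TopCat.Presheaf.IsLocallySurjective f.hom.c)
    (hg : TopCat.Presheaf.IsLocallySurjective g.hom.c) (hga : AffineOver g) :
    TopCat.Presheaf.IsLocallySurjective (f ≫ g).hom.c := by
  rw [isLocallySurjective_iff_germ] at hf hg ⊢
  intro U t z hz
  obtain ⟨A, _, j, hj, hzj, hjU, h⟩ := hga z U hz
  suffices H : ∃ u : Sec Y ((Opens.map g.hom.base).obj (rangeOpens j)),
      ∀ (x : X) (hx : g.hom.base (f.hom.base x) ∈ rangeOpens j),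
        germ x (U := (Opens.map f.hom.base).obj ((Opens.map g.hom.base).obj (rangeOpens j))) hx
          (pull f ((Opens.map g.hom.base).obj (rangeOpens j)) u) =
        germ x (U := (Opens.map (f ≫ g).hom.base).obj U) (hjU hx) t by
    obtain ⟨u, hu⟩ := H
    obtain ⟨V, hVj, s, hzV, hs⟩ := hg (rangeOpens j) u z hzj
    refine ⟨V, hVj.trans hjU, s, hzV, fun x hx => ?_⟩
    refine Eq.trans ?_ (hu x (hVj hx))
    refine (stalkHom_germ f x (U := (Opens.map g.hom.base).obj V) hx (pull g V s)).symm.trans ?_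
    refine (congrArg (stalkHom f x) (hs (f.hom.base x) hx)).trans ?_
    exact stalkHom_germ f x (U := (Opens.map g.hom.base).obj (rangeOpens j)) (hVj hx) u
  rcases h with h | ⟨B, _, _, i, hi, h⟩
  · refine ⟨0, fun x hx => ?_⟩
    have : f.hom.base x ∈ g.hom.base ⁻¹' Set.range j.hom.base := hx
    rw [h] at this
    exact this.elim
  · obtain ⟨y, hy, hle⟩ := exists_least_point i
    obtain ⟨V, hVU, s, hyV, hs⟩ := hf ((Opens.map g.hom.base).obj U) t y (hjU (h.ge hy))
    have hjV : (Opens.map g.hom.base).obj (rangeOpens j) ≤ V := fun w hw => hle V hyV (h.le hw)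
    refine ⟨res hjV s, fun x hx => ?_⟩
    refine Eq.trans ?_ (hs x (hjV hx))
    rw [pull_res]
    exact germ_res (X := X) (U := (Opens.map f.hom.base).obj V) _ x hx _

theorem IsClosedImmersion.comp (hX : HasCharts X) (hY : HasCharts Y) (hfl : IsLocalMorphism f)
    (hgl : IsLocalMorphism g) (hf : IsClosedImmersion f) (hg : IsClosedImmersion g) :
    IsClosedImmersion (f ≫ g) := by
  rw [isClosedImmersion_iff hX hfl] at hf
  rw [isClosedImmersion_iff hY hgl] at hg
  rw [isClosedImmersion_iff hX (hfl.comp hgl)]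
  exact ⟨isLocallySurjective_comp hf.1 hg.1 hg.2, hf.2.comp hg.2⟩

theorem isClosedImmersion_iff_isEmbedding (hX : HasCharts X) (hf : IsLocalMorphism f) :
    IsClosedImmersion f ↔
      (Topology.IsEmbedding f.hom.base ∧ IsSemiClosed (Set.range f.hom.base)) ∧
        TopCat.Presheaf.IsLocallySurjective f.hom.c := by
  constructor
  · exact fun h => ⟨h.exists_isEmbedding, h.isLocallySurjective⟩
  · rintro ⟨⟨he, 𝓘, h𝓘, hr⟩, hs⟩
    exact isClosedImmersion_of_affineOver hf hs (affineOver_of_isEmbedding hX he h𝓘 hr)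

end Composition
end
end FSch

theorem mainTheorem10 :
    -- characterization of closed immersions
    (∀ (X Y : FSch.NCRingedSpace.{u}), FSch.IsFScheme X → FSch.IsFScheme Y →
      ∀ f : X ⟶ Y, FSch.IsLocalMorphism f →
        (FSch.IsClosedImmersion f ↔
          (Topology.IsEmbedding f.hom.base ∧ FSch.IsSemiClosed (Set.range f.hom.base)) ∧
            TopCat.Presheaf.IsLocallySurjective f.hom.c)) ∧
    -- closed immersions are local on the target
    (∀ (X Y : FSch.NCRingedSpace.{u}), FSch.IsFScheme X → FSch.IsFScheme Y →
      ∀ f : X ⟶ Y, FSch.IsLocalMorphism f →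
        ∀ (ι : Type u) (U : ι → Opens Y), (∀ y : Y, ∃ i, y ∈ U i) →
          (FSch.IsClosedImmersion f ↔
            ∀ i, FSch.IsClosedImmersion (FSch.restrictTarget f (U i)))) ∧
    -- closed immersions are closed under composition
    (∀ (X Y Z : FSch.NCRingedSpace.{u}),
      FSch.IsFScheme X → FSch.IsFScheme Y → FSch.IsFScheme Z →
      ∀ (f : X ⟶ Y) (g : Y ⟶ Z), FSch.IsLocalMorphism f → FSch.IsLocalMorphism g →
        FSch.IsClosedImmersion f → FSch.IsClosedImmersion g →
          FSch.IsClosedImmersion (f ≫ g)) :=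
  ⟨fun _ _ hX _ _ hf => FSch.isClosedImmersion_iff_isEmbedding hX.hasCharts hf,
    fun _ _ hX _ _ hf _ U hU =>
      FSch.isClosedImmersion_iff_restrictTarget hX.hasCharts hf U hU,
    fun _ _ _ hX hY _ _ _ hf hg =>
      FSch.IsClosedImmersion.comp hX.hasCharts hY.hasCharts hf hg⟩
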